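/- **Setting.** For $j=1,2,\dots$ let $\mathcal H_j$ be a Hilbert space with a self-adjoint operator $h_j$, a bounded self-adjoint operator $G_j$, and a normal state $\mu_j$ (given by a density matrix $\sum_k|\xi_{j,k}\rangle\langle\xi_{j,k}|$); assume $g=\sup_j\|G_j\|<\infty$. Let $\mathcal H_R$ be a Hilbert space with a self-adjoint operator $H_R$, possibly unbounded self-adjoint operators $B_j$ ($j\ge1$), and a normal state $\mu_R$ given by a density matrix $\sum_k|\Omega_k\rangle\langle\Omega_k|$. Let $\lambda\in\mathbb R$. For $N\ge 1$ assume that $$H_N=\sum_{j=1}^N h_j+H_R+\frac{\lambda}{\sqrt N}\sum_{j=1}^N G_j\otimes B_j$$ on $\mathcal H_1\otimes\cdots\otimes\mathcal H_N\otimes\mathcal H_R$, with its natural domain, is essentially self-adjoint, and denote its closure by the same symbol. Put $\tau^t_{\lambda,N}(A)=e^{itH_N}Ae^{-itH_N}$ and $\omega_N=\mu_1\otimes\cdots\otimes\mu_N\otimes\mu_R$. Let $n\ge0$, let $A_S$ be a bounded operator on $\mathcal H_1\otimes\cdots\otimes\mathcal H_n$, let $A_R$ be a closable, possibly unbounded operator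 on $\mathcal H_R$, and let $A=A_S\otimes A_R$ (the closure of this operator). Write $G_j(s)=e^{ish_j}G_je^{-ish_j}$, $B_j(s)=e^{isH_R}B_je^{-isH_R}$, $A_R(t)=e^{itH_R}A_Re^{-itH_R}$, and $A(t)=\tau^t_{0,n}(A)$ for the free evolution. *Regularity of $\mu_R$.* For all $k$, all indices $j_1,\dots,j_r$ and all times $s_1,\dots,s_r,t\ge 0$, the vectors $v_k=B_{j_1}(s_1)\cdots B_{j_r}(s_r)\Omega_k$ and $A_R(t)v_k$ are well defined and depend continuously on $(s_1,\dots,s_r)$; and for all $N$, $T$ and $\varepsilon>0$ there is a constant $C$ such that $(\sum_k\|v_k\|^2)^{1/2}\le C\varepsilon^r r!$ and $(\sum_k\|A_R(t)v_k\|^2)^{1/2}\le C\varepsilon^r r!$ for all $r$, all $j_i\le N$ and all $s_i,t\in[0,T]$. (If all $B_j$ and $A_R$ are bounded, this always holds.) *Notation.* $\mu_R$ of a product of operators $B_j(s)$ with one factor $A_R(t)$ is $\sum_k\langle\,\cdot\,,\cdot\,\rangle$ with the factors on the left of $A_R(t)$ moved to the left entry of the inner product; commutators are likewise understood in the sense of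 forms. For $r\ge1$ let $$\beta_r(A_R,t)=\sup\big|\mu_R\big(B_{j_1}(t_1)\cdots B_{j_l}(t_l)\,A_R(t)\,B_{j_{l+1}}(t_{l+1})\cdots B_{j_r}(t_r)\big)\big|\in[0,\infty],$$ the supremum being over $0\le l\le r$, all indices $j_i\ge1$ and all $t_i\in[0,t]$, and $$b(A_R,t)=\limsup_{r\to\infty}\frac{\beta_r(A_R,t)^{1/r}}{\sqrt r},\qquad S_\nu(A_R,t)=\sum_{s\ge\delta_{0,\nu}}\frac{(2|\lambda|gt)^{2s}}{s!}\beta_{2(\nu+s)}(A_R,t)\quad(\nu=0,1,2,\dots).$$ For $n<N$ and integers $p_1,\dots,p_N\ge0$ with sum $r$ let $\mathcal C_r(p_1,\dots,p_N)$ be the family of all $$T_t=\big[G_{j_r}(t_r)\otimes B_{j_r}(t_r),[\dots,[G_{j_1}(t_1)\otimes B_{j_1}(t_1),A(t)]\dots]\big]$$ indexed by the $(j_1,\dots,j_r)\in\{1,\dots,N\}^r$ in which each $i$ occurs exactly $p_i$ times, and define $$X_{\nu,N}(A(t))=N^\nu\sum_{\substack{r\ge2\nu,\ r\ne0\\ r\text{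 even}}}(i\lambda)^rN^{-r/2}\sum_{p_1+\cdots+p_n=2\nu}\ \sum_{\substack{p_{n+1}+\cdots+p_N=r-2\nu\\ p_{n+1},\dots,p_N\text{ even}}}\int_0^tdt_1\cdots\int_0^{t_{r-1}}dt_r\sum_{T_t\in\mathcal C_r(p_1,\dots,p_N)}\omega_N(T_t),$$ $$Y_{\nu,N}(A(t))=N^{\nu+1/2}\sum_{\substack{r\ge2\nu+1\\ r\text{ odd}}}(i\lambda)^rN^{-r/2}\sum_{p_1+\cdots+p_n=2\nu+1}\ \sum_{\substack{p_{n+1}+\cdots+p_N=r-2\nu-1\\ p_{n+1},\dots,p_N\text{ even}}}\int_0^tdt_1\cdots\int_0^{t_{r-1}}dt_r\sum_{T_t\in\mathcal C_r(p_1,\dots,p_N)}\omega_N(T_t).$$ *Conditions at a time $t\ge0$* (in (A1) and (G), $0\cdot\infty=0$): - (A0) $\mu_j(G_j(t_1)\cdots G_j(t_{2k+1}))=0$ for all $j\ge1$, $k\ge0$, $t_1,\dots,t_{2k+1}\in[0,t]$; - (A1) $2\sqrt{2e}\,|\lambda|\,g\,t\,b(A_R,t)<1$; - (G) $(n\,e\,|\lambda|\,g\,t)^2\,\limsup_{\nu\to\infty}S_\nu(A_R,t)^{1/\nu}/\nu^2<1$.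 **Theorem.** (i) Let $t\ge0$ satisfy (A0), (A1) and (G). Then for every $N>n$ the series defining $X_{\nu,N}(A(t))$ and $Y_{\nu,N}(A(t))$, $\nu\ge0$, converge absolutely, $\omega_N(\tau^t_{\lambda,N}(A))$ is well defined, and $$\omega_N\big(\tau^t_{\lambda,N}(A)\big)=\omega_n(A(t))+\sum_{\nu=0}^\infty\Big[N^{-\nu}X_{\nu,N}(A(t))+N^{-\nu-1/2}Y_{\nu,N}(A(t))\Big],$$ where the series converges absolutely, and uniformly in $N>n$: the sums over $\nu\ge M$ of $|N^{-\nu}X_{\nu,N}(A(t))|+|N^{-\nu-1/2}Y_{\nu,N}(A(t))|$ tend to $0$ as $M\to\infty$, uniformly in $N>n$. (ii) Let $K\subset[0,\infty)$ be compact, such that (A0) and (G) hold for every $t\in K$ and (A1) holds uniformly on $K$, that is, $$\limsup_{r\to\infty}\ \sup_{t\in K}\ 2\sqrt{2e}\,|\lambda|\,g\,t\,\frac{\beta_r(A_R,t)^{1/r}}{\sqrt r}<1 .$$ Then the convergence in (i) is uniform in $N>n$ and $t\in K$ jointly. -/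

import Mathlib

open scoped ENNReal
open Complex (I)

noncomputable section

namespace MeanField

universe u v w

section General

variable {E : Type*} [NormedAddCommGroup E] [InnerProductSpace ℂ E]

/-- A strongly continuous one-parameter unitary group `t ↦ exp (-i t K)`. By Stone's theorem these
correspond exactly to the self-adjoint operators `K`. -/
structure UnitaryGroup (E : Type*) [NormedAddCommGroup E] [InnerProductSpace ℂ E] where
  toFun : ℝ → E ≃ₗᵢ[ℂ] E
  map_zero' : ∀ v, toFun 0 v = v
  map_add' : ∀ s t v, toFun (s + t) v = toFun s (toFun t v)
  continuous' : ∀ v, Continuous fun t => toFun t v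

instance : CoeFun (UnitaryGroup E) fun _ => ℝ → E ≃ₗᵢ[ℂ] E := ⟨UnitaryGroup.toFun⟩

/-- The graph of the self-adjoint generator `K` of `U t = exp (-i t K)`: the pair `(v, w)` belongs
to it iff `v` is in the domain of `K` and `K v = w`. -/
def UnitaryGroup.generatorGraph (U : UnitaryGroup E) : Set (E × E) :=
  {p | HasDerivAt (fun t : ℝ => U t p.1) (-(I • p.2)) 0}

/-- A partially defined operator, as a function on the whole space with value `0` off its domain. -/
def extendZero (T : E →ₗ.[ℂ] E) (x : E) : E :=
  open Classical in if h : x ∈ T.domain then T ⟨x, h⟩ else 0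

/-- The iterated integral `∫₀ᵗ dt₁ ∫₀^{t₁} dt₂ ⋯ ∫₀^{t_{r-1}} dt_r f (t₁, …, t_r)`. -/
def iteratedIntegral : (r : ℕ) → ℝ → ((Fin r → ℝ) → ℂ) → ℂ
  | 0, _, f => f Fin.elim0
  | r + 1, t, f => ∫ s in (0 : ℝ)..t, iteratedIntegral r s fun x => f (Fin.cons s x)

/-- The sesquilinear form of the commutator `[V, Q]` for a symmetric operator `V`, in terms of the
form `q (x, y) = ⟪x, Q y⟫`:  `⟪x, [V, Q] y⟫ = ⟪V x, Q y⟫ - ⟪x, Q V y⟫`. -/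
def formCommutator {X : Type*} (V : X → X) (q : X → X → ℂ) : X → X → ℂ :=
  fun x y => q (V x) y - q x (V y)

/-- The form of the multi-commutator `[V_r, [⋯, [V_2, [V_1, Q]] ⋯ ]]`, where `V_1` is `V 0`. -/
def multiCommutator {X : Type*} : (r : ℕ) → (Fin r → X → X) → (X → X → ℂ) → X → X → ℂ
  | 0, _, q => q
  | r + 1, V, q => multiCommutator r (fun i => V i.succ) (formCommutator (V 0) q)

end General

section Tensor

/-- The Hilbert space `H_1 ⊗ ⋯ ⊗ H_N`, realised as `ℓ²` of the product of the index sets of Hilbert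
bases of the factors. -/
abbrev PSpace (ι : ℕ → Type w) (N : ℕ) : Type w :=
  lp (fun _ : (∀ j : Fin N, ι j) => ℂ) 2

/-- The Hilbert space `H_1 ⊗ ⋯ ⊗ H_N ⊗ R`, realised as the `R`-valued `ℓ²` space over the same
index set. -/
abbrev TSpace (ι : ℕ → Type w) (R : Type v) [NormedAddCommGroup R] (N : ℕ) : Type (max w v) :=
  lp (fun _ : (∀ j : Fin N, ι j) => R) 2

theorem summable_prod_pi {α : Type*} [Fintype α] {κ : α → Type*} (f : ∀ a, κ a → ℝ)
    (h0 : ∀ a i, 0 ≤ f a i) (hf : ∀ a, Summable (f a)) :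
    Summable fun c : (∀ a, κ a) => ∏ a, f a (c a) := by
  classical
  refine summable_of_sum_le (c := ∏ a, ∑' i, f a i)
    (fun c => Finset.prod_nonneg fun a _ => h0 a _) fun F => ?_
  calc ∑ c ∈ F, ∏ a, f a (c a)
      ≤ ∑ c ∈ Fintype.piFinset (fun a => F.image fun c => c a), ∏ a, f a (c a) := by
        refine Finset.sum_le_sum_of_subset_of_nonneg (fun c hc => ?_)
          (fun c _ _ => Finset.prod_nonneg fun a _ => h0 a _)
        exact Fintype.mem_piFinset.2 fun a => Finset.mem_image_of_mem (fun c => c a) hc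
    _ = ∏ a, ∑ i ∈ F.image (fun c => c a), f a i := (Finset.prod_univ_sum _ _).symm
    _ ≤ ∏ a, ∑' i, f a i :=
        Finset.prod_le_prod (fun a _ => Finset.sum_nonneg fun i _ => h0 a i)
          fun a _ => (hf a).sum_le_tsum _ fun i _ => h0 a i

theorem memℓp_two_iff {α : Type*} {F : Type*} [NormedAddCommGroup F] (f : α → F) :
    Memℓp f 2 ↔ Summable fun a => ‖f a‖ ^ 2 := by
  rw [memℓp_gen_iff (by norm_num)]
  simp

variable {H : ℕ → Type u} [∀ j, NormedAddCommGroup (H j)] [∀ j, InnerProductSpace ℂ (H j)]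
  {ι : ℕ → Type w} {R : Type v} [NormedAddCommGroup R] [InnerProductSpace ℂ R]

theorem summable_coeff (b : ∀ j, HilbertBasis (ι j) ℂ (H j)) (j : ℕ) (x : H j) :
    Summable fun i => ‖(b j).repr x i‖ ^ 2 :=
  (memℓp_two_iff _).1 (lp.memℓp ((b j).repr x))

/-- The elementary tensor `φ_1 ⊗ ⋯ ⊗ φ_N`. -/
def pureTensor (b : ∀ j, HilbertBasis (ι j) ℂ (H j)) (N : ℕ) (φ : ∀ j : Fin N, H j) :
    PSpace ι N :=
  ⟨fun c => ∏ j : Fin N, (b j).repr (φ j) (c j), by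
    refine (memℓp_two_iff _).2 ?_
    simp only [norm_prod, ← Finset.prod_pow]
    exact summable_prod_pi (κ := fun j : Fin N => ι j)
      (fun (j : Fin N) i => ‖(b j).repr (φ j) i‖ ^ 2)
      (fun _ _ => by positivity) (fun j => summable_coeff b j (φ j))⟩

/-- The tensor `x ⊗ φ_{n+1} ⊗ ⋯ ⊗ φ_N` for `x ∈ H_1 ⊗ ⋯ ⊗ H_n` and `n ≤ N`. (The first `n`
components of `φ` are not used.) -/
def appendTensor (b : ∀ j, HilbertBasis (ι j) ℂ (H j)) {n N : ℕ} (h : n ≤ N) (x : PSpace ι n)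
    (φ : ∀ j : Fin N, H j) : PSpace ι N :=
  ⟨fun c => x (fun i : Fin n => c (Fin.castLE h i)) *
      ∏ j : {j : Fin N // n ≤ (j : ℕ)}, (b j).repr (φ j) (c j), by
    refine (memℓp_two_iff _).2 ?_
    have h1 : Summable fun c => ‖x c‖ ^ 2 := (memℓp_two_iff _).1 (lp.memℓp x)
    have h2 := summable_prod_pi (κ := fun j : {j : Fin N // n ≤ (j : ℕ)} => ι j)
      (fun (j : {j : Fin N // n ≤ (j : ℕ)}) i => ‖(b j).repr (φ j) i‖ ^ 2)
      (fun _ _ => by positivity) (fun j => summable_coeff b j (φ j))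
    have h3 := h1.mul_of_nonneg h2 (fun _ => by positivity)
      (fun _ => Finset.prod_nonneg fun _ _ => by positivity)
    have h4 := h3.comp_injective (i := fun c : (∀ j : Fin N, ι j) =>
      ((fun i : Fin n => c (Fin.castLE h i) : ∀ i : Fin n, ι i),
        (fun j => c j : ∀ j : {j : Fin N // n ≤ (j : ℕ)}, ι j))) (by
      intro c d hcd
      obtain ⟨h5, h6⟩ := Prod.mk.inj hcd
      funext j
      by_cases hj : (j : ℕ) < n
      · exact congrFun h5 ⟨j, hj⟩
      · exact congrFun h6 ⟨j, not_lt.1 hj⟩)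
    refine h4.congr fun c => ?_
    simp only [Function.comp_apply, norm_mul, norm_prod, mul_pow, Finset.prod_pow]⟩

/-- The tensor `x ⊗ χ` for `x ∈ H_1 ⊗ ⋯ ⊗ H_N` and `χ ∈ R`. -/
def tensorRes {N : ℕ} (x : PSpace ι N) (χ : R) : TSpace ι R N :=
  ⟨fun c => x c • χ, by
    refine (memℓp_two_iff _).2 ?_
    simp only [norm_smul, mul_pow]
    exact ((memℓp_two_iff _).1 (lp.memℓp x)).mul_right _⟩

end Tensor

/-- The data of the model: a sequence of particles `j = 0, 1, 2, …` with Hilbert spaces `H j`, and a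
reservoir with Hilbert space `R`. -/
structure Model (H : ℕ → Type u) [∀ j, NormedAddCommGroup (H j)] [∀ j, InnerProductSpace ℂ (H j)]
    [∀ j, CompleteSpace (H j)] (ι : ℕ → Type w)
    (R : Type v) [NormedAddCommGroup R] [InnerProductSpace ℂ R] [CompleteSpace R] where
  /-- Hilbert bases of the particle spaces, in which the tensor products are realised. -/
  basis : ∀ j, HilbertBasis (ι j) ℂ (H j)
  /-- The groups `exp (-i t h_j)` of the particle Hamiltonians. -/
  particle : ∀ j, UnitaryGroup (H j)
  /-- The group `exp (-i t H_R)` of the reservoir Hamiltonian. -/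
  reservoir : UnitaryGroup R
  /-- The interaction operators of the particles. -/
  G : ∀ j, H j →L[ℂ] H j
  G_selfAdjoint : ∀ j, IsSelfAdjoint (G j)
  /-- `sup_j ‖G_j‖` is finite. -/
  G_bounded : BddAbove (Set.range fun j => ‖G j‖)
  /-- The interaction operators of the reservoir, possibly unbounded. -/
  B : ℕ → R →ₗ.[ℂ] R
  B_selfAdjoint : ∀ j, IsSelfAdjoint (B j)
  /-- The state `μ_j` is given by the density matrix `∑ₖ |ξ j k⟩⟨ξ j k|`. -/
  ξ : ∀ j, ℕ → H j
  ξ_trace : ∀ j, HasSum (fun k => ‖ξ j k‖ ^ 2) 1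
  /-- The state `μ_R` is given by the density matrix `∑ₖ |Ω k⟩⟨Ω k|`. -/
  Ω : ℕ → R
  Ω_trace : HasSum (fun k => ‖Ω k‖ ^ 2) 1

namespace Model

variable {H : ℕ → Type u} [∀ j, NormedAddCommGroup (H j)] [∀ j, InnerProductSpace ℂ (H j)]
  [∀ j, CompleteSpace (H j)] {ι : ℕ → Type w}
  {R : Type v} [NormedAddCommGroup R] [InnerProductSpace ℂ R] [CompleteSpace R]
  (S : Model H ι R)

/-- The elementary tensor `φ_1 ⊗ ⋯ ⊗ φ_N ⊗ χ`. -/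
def tens {N : ℕ} (x : (∀ j : Fin N, H j) × R) : TSpace ι R N :=
  tensorRes (pureTensor S.basis N x.1) x.2

/-! ### The Hamiltonian -/

/-- The graph of the free Hamiltonian `∑_j h_j + H_R`, the closure of the operator given by this
expression on the elementary tensors with factors in the domains of `h_1, …, h_N, H_R`. -/
def freeGraph (N : ℕ) : Submodule ℂ (TSpace ι R N × TSpace ι R N) :=
  (Submodule.span ℂ {p | ∃ (φ φ' : ∀ j : Fin N, H j) (χ χ' : R),
    (∀ j : Fin N, (φ j, φ' j) ∈ (S.particle j).generatorGraph) ∧ (χ, χ') ∈ S.reservoir.generatorGraph ∧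
    p = (S.tens (φ, χ),
      ∑ j, S.tens (Function.update φ j (φ' j), χ) + S.tens (φ, χ'))}).topologicalClosure

/-- The graph of `G_j ⊗ B_j` on the space of `N` particles and the reservoir, the closure of the
operator given by this expression on elementary tensors. -/
def interactionGraph (N : ℕ) (j : Fin N) : Submodule ℂ (TSpace ι R N × TSpace ι R N) :=
  (Submodule.span ℂ {p | ∃ (φ : ∀ j : Fin N, H j) (χ χ' : R), (χ, χ') ∈ (S.B j).graph ∧
    p = (S.tens (φ, χ), S.tens (Function.update φ j (S.G j (φ j)), χ'))}).topologicalClosure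

/-- The graph of `H_N = ∑_j h_j + H_R + λ N^{-1/2} ∑_j G_j ⊗ B_j` on its natural domain, the
intersection of the domains of the free Hamiltonian and of all `G_j ⊗ B_j`. -/
def hamiltonianGraph (lam : ℝ) (N : ℕ) : Set (TSpace ι R N × TSpace ι R N) :=
  {p | ∃ (w₀ : TSpace ι R N) (w : Fin N → TSpace ι R N), (p.1, w₀) ∈ S.freeGraph N ∧
    (∀ j, (p.1, w j) ∈ S.interactionGraph N j) ∧
    p.2 = w₀ + ((lam / Real.sqrt N : ℝ) : ℂ) • ∑ j, w j}

/-- `W t = exp (-i t H_N)`: the Hamiltonian `H_N` is (essentially) self-adjoint, and its closure is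
the generator of `W`. -/
def IsPropagator (lam : ℝ) (N : ℕ) (W : UnitaryGroup (TSpace ι R N)) : Prop :=
  W.generatorGraph = closure (S.hamiltonianGraph lam N)

/-! ### The initial state and the observables -/

/-- The vectors of the density matrix of `ω_N = μ_1 ⊗ ⋯ ⊗ μ_N ⊗ μ_R`, as families of factors. -/
def stateVec (N : ℕ) (k : (Fin N → ℕ) × ℕ) : (∀ j : Fin N, H j) × R :=
  (fun j => S.ξ j (k.1 j), S.Ω k.2)

/-- The graph of the observable `A = A_S ⊗ 1 ⊗ A_R` on the space of `N ≥ n` particles and the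
reservoir, where `A_S` acts on the first `n` particles: the closure of the operator given by this
expression on tensors. It is the graph of an operator, for closable `A_R`. -/
def observableGraph {n N : ℕ} (h : n ≤ N) (AS : PSpace ι n →L[ℂ] PSpace ι n) (AR : R →ₗ.[ℂ] R) :
    Submodule ℂ (TSpace ι R N × TSpace ι R N) :=
  (Submodule.span ℂ {p | ∃ (x : PSpace ι n) (φ : ∀ j : Fin N, H j) (χ χ' : R),
    (χ, χ') ∈ AR.graph ∧
    p = (tensorRes (appendTensor S.basis h x φ) χ,
      tensorRes (appendTensor S.basis h (AS x) φ) χ')}).topologicalClosure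

/-- The average `ω_N (exp (i t H_N) A exp (-i t H_N))` is well defined and equal to `z`: the vectors
`exp (-i t H_N) Ξ_k` (where `∑ₖ |Ξ_k⟩⟨Ξ_k|` is the initial density matrix) are in the domain of `A`,
and the sum of `⟪exp (-i t H_N) Ξ_k, A exp (-i t H_N) Ξ_k⟫` over `k` converges to `z`. -/
def HasAverage {n N : ℕ} (h : n ≤ N) (AS : PSpace ι n →L[ℂ] PSpace ι n) (AR : R →ₗ.[ℂ] R)
    (W : UnitaryGroup (TSpace ι R N)) (t : ℝ) (z : ℂ) : Prop :=
  ∃ w : (Fin N → ℕ) × ℕ → TSpace ι R N,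
    (∀ k, (W t (S.tens (S.stateVec N k)), w k) ∈ S.observableGraph h AS AR) ∧
    HasSum (fun k => inner ℂ (W t (S.tens (S.stateVec N k))) (w k)) z

/-! ### Free evolution, multi-commutators, and the coefficients of the expansion -/

/-- `G_j(s) = exp (i s h_j) G_j exp (-i s h_j)`. -/
def Gt (j : ℕ) (s : ℝ) (x : H j) : H j := S.particle j (-s) (S.G j (S.particle j s x))

/-- `B_j(s) = exp (i s H_R) B_j exp (-i s H_R)`. -/
def Bt (j : ℕ) (s : ℝ) (x : R) : R :=
  S.reservoir (-s) (extendZero (S.B j) (S.reservoir s x))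

/-- `A_R(t) = exp (i t H_R) A_R exp (-i t H_R)`. -/
def ARt (AR : R →ₗ.[ℂ] R) (t : ℝ) (x : R) : R :=
  S.reservoir (-t) (extendZero AR (S.reservoir t x))

/-- The product `B_{j_1}(s_1) ⋯ B_{j_r}(s_r)` for the list of the `(j_i, s_i)`. -/
def word (L : List (ℕ × ℝ)) (x : R) : R := L.foldr (fun a y => S.Bt a.1 a.2 y) x

/-- `G_j(s) ⊗ B_j(s)`, which maps elementary tensors to elementary tensors. -/
def GB (N : ℕ) (j : Fin N) (s : ℝ) (x : (∀ j : Fin N, H j) × R) : (∀ j : Fin N, H j) × R :=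
  (Function.update x.1 j (S.Gt j s (x.1 j)), S.Bt j s x.2)

/-- The free evolution `exp (-i t (∑_j h_j + H_R))` of elementary tensors. -/
def free (N : ℕ) (t : ℝ) (x : (∀ j : Fin N, H j) × R) : (∀ j : Fin N, H j) × R :=
  (fun j => S.particle j t (x.1 j), S.reservoir t x.2)

/-- The form `(x, y) ↦ ⟪x, A(t) y⟫ = ⟪x(t), A y(t)⟫` on elementary tensors, where
`x(t) = exp (-i t (∑_j h_j + H_R)) x` and `A = A_S ⊗ 1 ⊗ A_R`. -/
def obsForm {n N : ℕ} (h : n ≤ N) (AS : PSpace ι n →L[ℂ] PSpace ι n) (AR : R →ₗ.[ℂ] R) (t : ℝ)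
    (x y : (∀ j : Fin N, H j) × R) : ℂ :=
  inner ℂ (S.tens (S.free N t x))
    (tensorRes (appendTensor S.basis h
      (AS (pureTensor S.basis n fun i => (S.free N t y).1 (Fin.castLE h i)))
      (S.free N t y).1) (extendZero AR (S.free N t y).2))

/-- The value of `ω_N = μ_1 ⊗ ⋯ ⊗ μ_N ⊗ μ_R` on the observable with form `q`. -/
def omega (N : ℕ) (q : (∀ j : Fin N, H j) × R → (∀ j : Fin N, H j) × R → ℂ) : ℂ :=
  ∑' k, q (S.stateVec N k) (S.stateVec N k)

/-- `ω_n (A(t))`. -/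
def freeAverage {n : ℕ} (AS : PSpace ι n →L[ℂ] PSpace ι n) (AR : R →ₗ.[ℂ] R) (t : ℝ) : ℂ :=
  S.omega n (S.obsForm le_rfl AS AR t)

/-- `ω_N (T_t)` for the multi-commutator
`T_t = [G_{j_r}(t_r) ⊗ B_{j_r}(t_r), [⋯, [G_{j_1}(t_1) ⊗ B_{j_1}(t_1), A(t)] ⋯ ]]`. -/
def omegaT {n N : ℕ} (h : n ≤ N) (AS : PSpace ι n →L[ℂ] PSpace ι n) (AR : R →ₗ.[ℂ] R) (t : ℝ)
    {r : ℕ} (j : Fin r → Fin N) (s : Fin r → ℝ) : ℂ :=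
  S.omega N (multiCommutator r (fun i => S.GB N (j i) (s i)) (S.obsForm h AS AR t))

/-- The sum over all `(p_1, …, p_N)` with `p_1 + ⋯ + p_n = m`, with `p_{n+1}, …, p_N` even and with
`p_1 + ⋯ + p_N = r`, of the iterated time integrals of `∑ ω_N (T_t)`, where the inner sum is over
the multi-commutators `T_t` with indices `j_1, …, j_r` of which exactly `p_i` are equal to `i`, for
each `i`. -/
def multiplicitySum {n N : ℕ} (h : n ≤ N) (AS : PSpace ι n →L[ℂ] PSpace ι n) (AR : R →ₗ.[ℂ] R)
    (t : ℝ) (r m : ℕ) : ℂ :=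
  ∑ p ∈ (Finset.piAntidiag (Finset.univ : Finset (Fin N)) r).filter (fun p =>
      ∑ i ∈ Finset.univ.filter (fun i : Fin N => (i : ℕ) < n), p i = m ∧
      ∀ i : Fin N, n ≤ (i : ℕ) → Even (p i)),
    iteratedIntegral r t fun s =>
      ∑ j ∈ Finset.univ.filter (fun j : Fin r → Fin N =>
          ∀ i, (Finset.univ.filter fun a => j a = i).card = p i),
        S.omegaT h AS AR t j s

/-- The term of order `r` in the series defining `X_{ν,N}(A(t))`, without the prefactor `N^ν`. -/
def XTerm {n N : ℕ} (h : n ≤ N) (AS : PSpace ι n →L[ℂ] PSpace ι n) (AR : R →ₗ.[ℂ] R) (lam t : ℝ)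
    (ν r : ℕ) : ℂ :=
  if r ≠ 0 ∧ Even r ∧ 2 * ν ≤ r then
    (I * lam) ^ r * ((Real.sqrt N : ℝ) : ℂ)⁻¹ ^ r * S.multiplicitySum h AS AR t r (2 * ν)
  else 0

/-- The term of order `r` in the series defining `Y_{ν,N}(A(t))`, without the prefactor
`N^{ν+1/2}`. -/
def YTerm {n N : ℕ} (h : n ≤ N) (AS : PSpace ι n →L[ℂ] PSpace ι n) (AR : R →ₗ.[ℂ] R) (lam t : ℝ)
    (ν r : ℕ) : ℂ :=
  if Odd r ∧ 2 * ν + 1 ≤ r then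
    (I * lam) ^ r * ((Real.sqrt N : ℝ) : ℂ)⁻¹ ^ r * S.multiplicitySum h AS AR t r (2 * ν + 1)
  else 0

/-- `X_{ν,N}(A(t))`. -/
def X {n N : ℕ} (h : n ≤ N) (AS : PSpace ι n →L[ℂ] PSpace ι n) (AR : R →ₗ.[ℂ] R) (lam t : ℝ)
    (ν : ℕ) : ℂ :=
  (N : ℂ) ^ ν * ∑' r, S.XTerm h AS AR lam t ν r

/-- `Y_{ν,N}(A(t))`. -/
def Y {n N : ℕ} (h : n ≤ N) (AS : PSpace ι n →L[ℂ] PSpace ι n) (AR : R →ₗ.[ℂ] R) (lam t : ℝ)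
    (ν : ℕ) : ℂ :=
  (N : ℂ) ^ ν * ((Real.sqrt N : ℝ) : ℂ) * ∑' r, S.YTerm h AS AR lam t ν r

/-- `N^{-ν} X_{ν,N}(A(t))`. -/
def expX {n N : ℕ} (h : n ≤ N) (AS : PSpace ι n →L[ℂ] PSpace ι n) (AR : R →ₗ.[ℂ] R) (lam t : ℝ)
    (ν : ℕ) : ℂ :=
  ((N : ℂ) ^ ν)⁻¹ * S.X h AS AR lam t ν

/-- `N^{-ν-1/2} Y_{ν,N}(A(t))`. -/
def expY {n N : ℕ} (h : n ≤ N) (AS : PSpace ι n →L[ℂ] PSpace ι n) (AR : R →ₗ.[ℂ] R) (lam t : ℝ)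
    (ν : ℕ) : ℂ :=
  ((N : ℂ) ^ ν * ((Real.sqrt N : ℝ) : ℂ))⁻¹ * S.Y h AS AR lam t ν

/-! ### Hypotheses -/

/-- Regularity of the initial state: the vectors obtained from the vectors `Ω k` of the density
matrix of `μ_R` by applying operators `B_j(s)` and finally `A_R(t)` are well defined and continuous
in the times `s`, and their norms grow more slowly than `ε^r r!` for each `ε > 0`, where `r` is the
number of the factors `B_j(s)`. -/
structure Regular (AR : R →ₗ.[ℂ] R) : Prop where
  mem_B : ∀ (L : List (ℕ × ℝ)), (∀ a ∈ L, 0 ≤ a.2) → ∀ (j : ℕ) (s : ℝ), 0 ≤ s → ∀ k,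
    S.reservoir s (S.word L (S.Ω k)) ∈ (S.B j).domain
  mem_A : ∀ (L : List (ℕ × ℝ)), (∀ a ∈ L, 0 ≤ a.2) → ∀ (t : ℝ), 0 ≤ t → ∀ k,
    S.reservoir t (S.word L (S.Ω k)) ∈ AR.domain
  continuous_B : ∀ (r : ℕ) (j : Fin r → ℕ) (k : ℕ),
    ContinuousOn (fun s : Fin r → ℝ => S.word (List.ofFn fun i => (j i, s i)) (S.Ω k))
      {s | ∀ i, 0 ≤ s i}
  continuous_A : ∀ (r : ℕ) (j : Fin r → ℕ) (k : ℕ) (t : ℝ), 0 ≤ t →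
    ContinuousOn (fun s : Fin r → ℝ => S.ARt AR t (S.word (List.ofFn fun i => (j i, s i)) (S.Ω k)))
      {s | ∀ i, 0 ≤ s i}
  growth_B : ∀ (N : ℕ) (T ε : ℝ), 0 < ε → ∃ C : ℝ, ∀ L : List (ℕ × ℝ),
    (∀ a ∈ L, a.1 < N ∧ 0 ≤ a.2 ∧ a.2 ≤ T) →
    ∑' k, ‖S.word L (S.Ω k)‖ₑ ^ 2 ≤
      ENNReal.ofReal ((C * ε ^ L.length * (L.length.factorial : ℝ)) ^ 2)
  growth_A : ∀ (N : ℕ) (T ε : ℝ), 0 < ε → ∃ C : ℝ, ∀ L : List (ℕ × ℝ),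
    (∀ a ∈ L, a.1 < N ∧ 0 ≤ a.2 ∧ a.2 ≤ T) → ∀ t : ℝ, 0 ≤ t → t ≤ T →
    ∑' k, ‖S.ARt AR t (S.word L (S.Ω k))‖ₑ ^ 2 ≤
      ENNReal.ofReal ((C * ε ^ L.length * (L.length.factorial : ℝ)) ^ 2)

/-- The product `G_j(t_1) ⋯ G_j(t_r)` for the list of the times `t_i`. -/
def wordG (j : ℕ) (L : List ℝ) (x : H j) : H j := L.foldr (fun s y => S.Gt j s y) x

/-- Vanishing odd moments: `μ_j (G_j(t_1) ⋯ G_j(t_{2k+1})) = 0` for all times in `[0, t]`. -/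
def OddMomentsVanish (t : ℝ) : Prop :=
  ∀ (j : ℕ) (L : List ℝ), Odd L.length → (∀ s ∈ L, 0 ≤ s ∧ s ≤ t) →
    ∑' k, inner ℂ (S.ξ j k) (S.wordG j L (S.ξ j k)) = 0

/-- `g = sup_j ‖G_j‖`. -/
def g : ℝ := ⨆ j, ‖S.G j‖

/-- `β_r(A_R, t)`: the supremum of the absolute values of
`μ_R (B_{j_1}(t_1) ⋯ B_{j_l}(t_l) A_R(t) B_{j_{l+1}}(t_{l+1}) ⋯ B_{j_r}(t_r))` over all positions
`l` of the factor `A_R(t)`, all indices `j_i` and all times `t_i` in `[0, t]`. The factors on the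
left of `A_R(t)` are moved to the left entry of the inner product. -/
def beta (AR : R →ₗ.[ℂ] R) (t : ℝ) (r : ℕ) : ℝ≥0∞ :=
  ⨆ (L : List (ℕ × ℝ)) (L' : List (ℕ × ℝ)) (_ : L.length + L'.length = r)
    (_ : ∀ a ∈ L ++ L', 0 ≤ a.2 ∧ a.2 ≤ t),
    ‖∑' k, inner ℂ (S.word L.reverse (S.Ω k)) (S.ARt AR t (S.word L' (S.Ω k)))‖ₑ

/-- `b(A_R, t) = limsup_r β_r(A_R, t)^{1/r} / √r`. -/
def b (AR : R →ₗ.[ℂ] R) (t : ℝ) : ℝ≥0∞ :=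
  Filter.limsup (fun r : ℕ => S.beta AR t r ^ (1 / (r : ℝ)) / ENNReal.ofReal (Real.sqrt r))
    Filter.atTop

/-- The condition `2 √(2e) |λ| g t b(A_R, t) < 1`. -/
def SmallTime (AR : R →ₗ.[ℂ] R) (lam t : ℝ) : Prop :=
  ENNReal.ofReal (2 * Real.sqrt (2 * Real.exp 1) * |lam| * S.g * t) * S.b AR t < 1

/-- The preceding condition, uniformly in `t ∈ K`:
`limsup_r sup_{t ∈ K} 2 √(2e) |λ| g t β_r(A_R, t)^{1/r} / √r < 1`. -/
def SmallTimeUniform (AR : R →ₗ.[ℂ] R) (lam : ℝ) (K : Set ℝ) : Prop :=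
  Filter.limsup (fun r : ℕ => ⨆ t ∈ K,
    ENNReal.ofReal (2 * Real.sqrt (2 * Real.exp 1) * |lam| * S.g * t) *
      (S.beta AR t r ^ (1 / (r : ℝ)) / ENNReal.ofReal (Real.sqrt r))) Filter.atTop < 1

/-- `S_ν(A_R, t) = ∑_s (2 |λ| g t)^{2s} / s! · β_{2(ν+s)}(A_R, t)`, where the sum starts at `s = 1`
for `ν = 0` and at `s = 0` otherwise. -/
def Sν (AR : R →ₗ.[ℂ] R) (lam t : ℝ) (ν : ℕ) : ℝ≥0∞ :=
  ∑' s : ℕ, if ν = 0 ∧ s = 0 then 0 else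
    ENNReal.ofReal ((2 * |lam| * S.g * t) ^ (2 * s) / (s.factorial : ℝ)) *
      S.beta AR t (2 * (ν + s))

/-- The condition `(n e |λ| g t)² limsup_ν S_ν(A_R, t)^{1/ν} / ν² < 1`. -/
def GrowthBound (n : ℕ) (AR : R →ₗ.[ℂ] R) (lam t : ℝ) : Prop :=
  ENNReal.ofReal ((n * Real.exp 1 * |lam| * S.g * t) ^ 2) *
    Filter.limsup (fun ν : ℕ => S.Sν AR lam t ν ^ (1 / (ν : ℝ)) / (ν : ℝ≥0∞) ^ 2)
      Filter.atTop < 1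

end Model

end MeanField

end

set_option linter.unusedSectionVars false

noncomputable section

namespace MeanField

open Filter Topology MeasureTheory

/-! ### Ordered integrals of functions of lists of letters and times -/

/-! The interacting evolution is expanded in a Dyson series around the free one. On an elementary
tensor, the term of order `r` is an integral over a time simplex, summed over `N ^ r` words of
particle indices. The volume `t ^ r / r!` of the simplex cancels the `r!` in the regularity bounds,
and the free choice of `ε` there absorbs `N`, `g` and the coupling constant. The series therefore
converges at all times, and so does its image under the observable, whose graph is closed. That its
sum is `exp (-i t H_N)` is verified weakly (`hasSum_dyson`). Nothing is assumed about the terms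
lying in the domain of `H_N`, so all unbounded operators are paired with test vectors of the natural
domain. The resulting identity survives the closure of the graph, and a continuous weak solution
must be the unitary evolution (`eq_apply_of_weak_solution`).

Pairing the Dyson series with its image under `A` produces integrals over two independent simplices,
with sign `(-1) ^ l'` for the order `l'` on the right. Interlacing the two ordered sets of times
(the shuffle identity `orderedIntegral_listCommutator`) turns the sum over `l + l' = r` into one
simplex integral of an `r`-fold commutator. Absolute convergence allows the sum over the density
matrix to be taken inside; this gives the perturbation series (`exists_hasAverage`).

Uniformity in `N` is combinatorial. Each expectation factorizes into a particle and a reservoir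
part. By (A0) it vanishes as soon as one particle outside the first `n` is hit an odd number of
times (`omegaT_eq_zero`). If the first `n` particles are hit `m` times and `r = m + 2 s`, at most
`r! * (n ^ m / m!) * (N ^ s / s!)` words remain (`sum_card_words_le`). The `r!` cancels the simplex
volume, and `N ^ s` is compensated by the prefactor `N ^ (-r/2)`. What is left is `‖A_S‖ * n ^ m /
(m! * s!) * (2 |λ| g t) ^ r * β_r`, free of `N` (`enorm_orderTerm_le`).

By (A1) and the inequality `(r / (2 e)) ^ (r/2) ≤ (⌊r/2⌋ + 1)!`, there is `q < 1` with `(2 |λ| g t)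
^ r * β_r ≤ q ^ r * (⌊r/2⌋ + 1)!` for large `r` (`exists_rate`). With `ν = ⌊m/2⌋` the sum over `s`
is a negative binomial series, equal to a power of `1 / (1 - q ^ 2)`. The remaining quotient `(ν +
1)! / (2 ν)!` makes the sum over `ν` converge like an exponential series (`summable_termBound`). The
double family over `(ν, r)` is thus absolutely summable: grouped by `r` it is the perturbation
series, grouped by `ν` it is the expansion in `N ^ (-1/2)`. The majorant involves neither `N` nor
`t`, which gives the uniform tails. -/

/-- `∑_{j_1, …, j_r} ∫₀ᵗ ds₁ ∫₀^{s₁} ds₂ ⋯ ∫₀^{s_{r-1}} ds_r f [(j₁, s₁), …, (j_r, s_r)]`. -/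
def orderedIntegral {J : Type*} [Fintype J] {E : Type*} [NormedAddCommGroup E] [NormedSpace ℝ E] :
    ℕ → ℝ → (List (J × ℝ) → E) → E
  | 0, _, f => f []
  | r + 1, t, f => ∫ s in (0 : ℝ)..t, ∑ j, orderedIntegral r s fun L => f ((j, s) :: L)

section OrderedIntegral

variable {J : Type*} [Fintype J] {E : Type*} [NormedAddCommGroup E] [NormedSpace ℝ E]

theorem orderedIntegral_zero (t : ℝ) (f : List (J × ℝ) → E) : orderedIntegral 0 t f = f [] := rfl

theorem orderedIntegral_succ (r : ℕ) (t : ℝ) (f : List (J × ℝ) → E) :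
    orderedIntegral (r + 1) t f =
      ∫ s in (0 : ℝ)..t, ∑ j, orderedIntegral r s fun L => f ((j, s) :: L) := rfl

theorem orderedIntegral_congr {r : ℕ} {t : ℝ} (ht : 0 ≤ t) {f f' : List (J × ℝ) → E}
    (h : ∀ L : List (J × ℝ), L.length = r → (∀ a ∈ L, 0 ≤ a.2 ∧ a.2 ≤ t) → f L = f' L) :
    orderedIntegral r t f = orderedIntegral r t f' := by
  induction r generalizing t f f' with
  | zero => exact h [] rfl (by simp)
  | succ r ih =>
    refine intervalIntegral.integral_congr fun s hs => Finset.sum_congr rfl fun j _ => ?_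
    rw [Set.uIcc_of_le ht] at hs
    refine ih hs.1 fun L hL hLs => h _ (by simp [hL]) fun a ha => ?_
    rcases List.mem_cons.1 ha with rfl | ha
    · exact hs
    · exact ⟨(hLs a ha).1, (hLs a ha).2.trans hs.2⟩

variable [TopologicalSpace J]

theorem continuous_cons_time (j : J) : Continuous fun p : ℝ × List (J × ℝ) => (j, p.1) :: p.2 :=
  List.continuous_cons.comp ((continuous_const.prodMk continuous_fst).prodMk continuous_snd)

theorem continuous_orderedIntegral {Y : Type*} [TopologicalSpace Y] {r : ℕ}
    {f : Y → List (J × ℝ) → E} (hf : Continuous fun p : Y × List (J × ℝ) => f p.1 p.2)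
    {u : Y → ℝ} (hu : Continuous u) : Continuous fun y => orderedIntegral r (u y) (f y) := by
  induction r generalizing Y with
  | zero => exact hf.comp (continuous_id.prodMk continuous_const)
  | succ r ih =>
    refine intervalIntegral.continuous_parametric_intervalIntegral_of_continuous
      (f := fun y s => ∑ j, orderedIntegral r s fun L => f y ((j, s) :: L)) ?_ hu
    refine continuous_finsetSum _ fun j _ => ?_
    refine ih (Y := Y × ℝ) (f := fun y L => f y.1 ((j, y.2) :: L)) ?_ continuous_snd
    exact hf.comp ((continuous_fst.comp continuous_fst).prodMk ((continuous_cons_time j).comp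
      ((continuous_snd.comp continuous_fst).prodMk continuous_snd)))

theorem continuous_orderedIntegral_cons {r : ℕ} {f : List (J × ℝ) → E} (hf : Continuous f) (j : J) :
    Continuous fun s => orderedIntegral r s fun L => f ((j, s) :: L) :=
  continuous_orderedIntegral (f := fun s L => f ((j, s) :: L)) (hf.comp (continuous_cons_time j))
    continuous_id

theorem continuous_comp_cons {f : List (J × ℝ) → E} (hf : Continuous f) (j : J) (s : ℝ) :
    Continuous fun L => f ((j, s) :: L) :=
  hf.comp ((continuous_cons_time j).comp (continuous_const.prodMk continuous_id))

theorem orderedIntegral_finset_sum {K : Type*} (F : Finset K) {r : ℕ} {t : ℝ}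
    {f : K → List (J × ℝ) → E} (hf : ∀ k ∈ F, Continuous (f k)) :
    orderedIntegral r t (fun L => ∑ k ∈ F, f k L) = ∑ k ∈ F, orderedIntegral r t (f k) := by
  induction r generalizing t f with
  | zero => rfl
  | succ r ih =>
    simp only [orderedIntegral_succ]
    rw [← intervalIntegral.integral_finsetSum fun k hk => (continuous_finsetSum _ fun j _ =>
      continuous_orderedIntegral_cons (hf k hk) j).intervalIntegrable _ _]
    refine intervalIntegral.integral_congr fun s _ => ?_
    rw [Finset.sum_comm]
    exact Finset.sum_congr rfl fun j _ => ih fun k hk => continuous_comp_cons (hf k hk) j s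

theorem orderedIntegral_add {r : ℕ} {t : ℝ} {f f' : List (J × ℝ) → E} (hf : Continuous f)
    (hf' : Continuous f') : orderedIntegral r t (fun L => f L + f' L) =
      orderedIntegral r t f + orderedIntegral r t f' := by
  simpa using orderedIntegral_finset_sum (r := r) (t := t) Finset.univ
    (f := fun b : Bool => bif b then f else f') (by rintro (_ | _) _ <;> assumption)

theorem orderedIntegral_sub {r : ℕ} {t : ℝ} {f f' : List (J × ℝ) → E} (hf : Continuous f)
    (hf' : Continuous f') : orderedIntegral r t (fun L => f L - f' L) =
      orderedIntegral r t f - orderedIntegral r t f' := by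
  have hc : Continuous fun L => f L - f' L := hf.sub hf'
  rw [eq_sub_iff_add_eq, ← orderedIntegral_add hc hf']
  simp only [sub_add_cancel]

section

variable {E' : Type*} [NormedAddCommGroup E'] [NormedSpace ℝ E'] [CompleteSpace E]
  [CompleteSpace E']

theorem ContinuousLinearMap.map_orderedIntegral (T : E →L[ℝ] E') {r : ℕ} {t : ℝ}
    {f : List (J × ℝ) → E} (hf : Continuous f) :
    T (orderedIntegral r t f) = orderedIntegral r t fun L => T (f L) := by
  induction r generalizing t f with
  | zero => rfl
  | succ r ih =>
    simp only [orderedIntegral_succ]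
    rw [← T.intervalIntegral_comp_comm ((continuous_finsetSum _ fun j _ =>
      continuous_orderedIntegral_cons hf j).intervalIntegrable _ _)]
    refine intervalIntegral.integral_congr fun s _ => ?_
    simp only [map_sum]
    exact Finset.sum_congr rfl fun j _ => ih (continuous_comp_cons hf j s)

end

/-- The constant is the number of words times the volume of the simplex. The sum over `k` stays
inside the estimate because, for density matrices, only the sum over `k` is bounded uniformly in the
times. -/
theorem sum_norm_orderedIntegral_le {K : Type*} (F : Finset K) {r : ℕ} {t : ℝ} (ht : 0 ≤ t)
    {f : K → List (J × ℝ) → E} (hf : ∀ k, Continuous (f k)) {M : ℝ}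
    (hM : ∀ L : List (J × ℝ), L.length = r → (∀ a ∈ L, 0 ≤ a.2 ∧ a.2 ≤ t) →
      ∑ k ∈ F, ‖f k L‖ ≤ M) :
    ∑ k ∈ F, ‖orderedIntegral r t (f k)‖ ≤ (Fintype.card J * t) ^ r / r.factorial * M := by
  induction r generalizing t f with
  | zero => simpa [orderedIntegral_zero] using hM [] rfl (by simp)
  | succ r ih =>
    have hc : ∀ k, Continuous fun s => ∑ j, orderedIntegral r s fun L => f k ((j, s) :: L) :=
      fun k => continuous_finsetSum _ fun j _ => continuous_orderedIntegral_cons (hf k) j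
    calc ∑ k ∈ F, ‖orderedIntegral (r + 1) t (f k)‖
        ≤ ∑ k ∈ F, ∫ s in (0 : ℝ)..t, ‖∑ j, orderedIntegral r s fun L => f k ((j, s) :: L)‖ :=
          Finset.sum_le_sum fun k _ => intervalIntegral.norm_integral_le_integral_norm ht
      _ = ∫ s in (0 : ℝ)..t, ∑ k ∈ F, ‖∑ j, orderedIntegral r s fun L => f k ((j, s) :: L)‖ :=
          (intervalIntegral.integral_finsetSum
            fun k _ => (hc k).norm.intervalIntegrable _ _).symm
      _ ≤ ∫ s in (0 : ℝ)..t, Fintype.card J * ((Fintype.card J * s) ^ r / r.factorial * M) := by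
          refine intervalIntegral.integral_mono_on ht
            ((continuous_finsetSum _ fun k _ => (hc k).norm).intervalIntegrable _ _)
            ((by fun_prop : Continuous fun s : ℝ => (Fintype.card J : ℝ) *
              ((Fintype.card J * s) ^ r / r.factorial * M)).intervalIntegrable _ _) fun s hs => ?_
          calc ∑ k ∈ F, ‖∑ j, orderedIntegral r s fun L => f k ((j, s) :: L)‖
              ≤ ∑ k ∈ F, ∑ j, ‖orderedIntegral r s fun L => f k ((j, s) :: L)‖ :=
                Finset.sum_le_sum fun k _ => norm_sum_le _ _
            _ = ∑ j, ∑ k ∈ F, ‖orderedIntegral r s fun L => f k ((j, s) :: L)‖ :=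
                Finset.sum_comm
            _ ≤ ∑ _j : J, ((Fintype.card J * s) ^ r / r.factorial * M) := by
                refine Finset.sum_le_sum fun j _ =>
                  ih (f := fun k L => f k ((j, s) :: L)) hs.1 (fun k => continuous_comp_cons (hf k) j s) ?_
                refine fun L hL hLs => hM _ (by simp [hL]) fun a ha => ?_
                rcases List.mem_cons.1 ha with rfl | ha
                · exact hs
                · exact ⟨(hLs a ha).1, (hLs a ha).2.trans hs.2⟩
            _ = _ := by simp
      _ = (Fintype.card J * t) ^ (r + 1) / (r + 1).factorial * M := by
          have : ∀ s : ℝ, (Fintype.card J : ℝ) * ((Fintype.card J * s) ^ r / r.factorial * M) =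
              (Fintype.card J ^ (r + 1) / r.factorial * M) * s ^ r := fun s => by ring
          simp only [this, intervalIntegral.integral_const_mul, integral_pow]
          have h1 : ((r : ℝ) + 1) ≠ 0 := by positivity
          rw [Nat.factorial_succ]
          push_cast
          field_simp
          ring

theorem norm_orderedIntegral_le {r : ℕ} {t : ℝ} (ht : 0 ≤ t)
    {f : List (J × ℝ) → E} (hf : Continuous f) {M : ℝ}
    (hM : ∀ L : List (J × ℝ), L.length = r → (∀ a ∈ L, 0 ≤ a.2 ∧ a.2 ≤ t) → ‖f L‖ ≤ M) :
    ‖orderedIntegral r t f‖ ≤ (Fintype.card J * t) ^ r / r.factorial * M := by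
  simpa using sum_norm_orderedIntegral_le (Finset.univ : Finset Unit) ht (f := fun _ => f)
    (fun _ => hf) (by simpa using hM)

/-- No summability is needed: where the series diverges, the real `tsum` and `toReal ∞` are both
`0`. -/
theorem measurable_tsum_of_summable {α K : Type*} [MeasurableSpace α] [Countable K]
    {f : K → α → ℝ} (hf : ∀ k, Measurable (f k)) (h0 : ∀ k a, 0 ≤ f k a) :
    Measurable fun a => ∑' k, f k a := by
  have : (fun a => ∑' k, f k a) = fun a => (∑' k, ENNReal.ofReal (f k a)).toReal := by
    funext a
    rw [ENNReal.tsum_toReal_eq fun k => ENNReal.ofReal_ne_top]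
    simp [ENNReal.toReal_ofReal (h0 _ a)]
  rw [this]
  exact (Measurable.tsum fun k => (hf k).ennreal_ofReal).ennreal_toReal

/-- Dominated convergence, applied to the outermost integral in an induction on the number of time
variables. -/
theorem hasSum_orderedIntegral {K : Type*} [Countable K] [CompleteSpace E] {r : ℕ} {t : ℝ}
    (ht : 0 ≤ t) {f : K → List (J × ℝ) → E} {f' : List (J × ℝ) → E}
    (hf : ∀ k, Continuous (f k)) {M : ℝ}
    (hM : ∀ L : List (J × ℝ), L.length = r → (∀ a ∈ L, 0 ≤ a.2 ∧ a.2 ≤ t) →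
      ∀ F : Finset K, ∑ k ∈ F, ‖f k L‖ ≤ M)
    (hs : ∀ L : List (J × ℝ), L.length = r → (∀ a ∈ L, 0 ≤ a.2 ∧ a.2 ≤ t) →
      HasSum (fun k => f k L) (f' L)) :
    HasSum (fun k => orderedIntegral r t (f k)) (orderedIntegral r t f') := by
  induction r generalizing t f f' with
  | zero => exact hs [] rfl (by simp)
  | succ r ih =>
    have hc : ∀ k, Continuous fun s => ∑ j, orderedIntegral r s fun L => f k ((j, s) :: L) :=
      fun k => continuous_finsetSum _ fun j _ => continuous_orderedIntegral_cons (hf k) j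
    have hbox : ∀ j : J, ∀ s, 0 ≤ s → s ≤ t → ∀ L : List (J × ℝ),
        (∀ a ∈ L, 0 ≤ a.2 ∧ a.2 ≤ s) → ∀ a ∈ (j, s) :: L, 0 ≤ a.2 ∧ a.2 ≤ t := by
      intro j s h0 hst L hLs a ha
      rcases List.mem_cons.1 ha with rfl | ha
      · exact ⟨h0, hst⟩
      · exact ⟨(hLs a ha).1, (hLs a ha).2.trans hst⟩
    -- Without letters there are no lists of length `r + 1`, and `hM` says nothing about the sign of
    -- `M`.
    have hM0 : 0 ≤ M ∨ IsEmpty J := by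
      by_cases hJ : Nonempty J
      · obtain ⟨j⟩ := hJ
        left
        exact (Finset.sum_nonneg fun k _ => norm_nonneg _).trans (hM (List.replicate (r + 1) (j, 0))
          (by simp) (by
            intro a ha
            rw [(List.mem_replicate.1 ha).2]
            exact ⟨le_rfl, ht⟩) (∅ : Finset K))
      · exact Or.inr (not_nonempty_iff.1 hJ)
    have hb : ∀ s, 0 ≤ s → s ≤ t → ∀ F : Finset K,
        ∑ k ∈ F, ‖∑ j, orderedIntegral r s fun L => f k ((j, s) :: L)‖ ≤
          Fintype.card J * ((Fintype.card J * t) ^ r / r.factorial * M) := by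
      intro s h0 hst F
      calc ∑ k ∈ F, ‖∑ j, orderedIntegral r s fun L => f k ((j, s) :: L)‖
          ≤ ∑ k ∈ F, ∑ j, ‖orderedIntegral r s fun L => f k ((j, s) :: L)‖ :=
            Finset.sum_le_sum fun k _ => norm_sum_le _ _
        _ = ∑ j, ∑ k ∈ F, ‖orderedIntegral r s fun L => f k ((j, s) :: L)‖ := Finset.sum_comm
        _ ≤ ∑ _j : J, ((Fintype.card J * t) ^ r / r.factorial * M) := by
            refine Finset.sum_le_sum fun j _ => ?_
            refine (sum_norm_orderedIntegral_le F (f := fun k L => f k ((j, s) :: L)) h0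
              (fun k => continuous_comp_cons (hf k) j s)
              fun L hL hLs => hM _ (by simp [hL]) (hbox j s h0 hst L hLs) F).trans ?_
            have : 0 ≤ M := hM0.resolve_right fun h => h.false j
            gcongr
        _ = _ := by simp
    -- Each term is dominated by its own norm; the sum of these norms is bounded on `[0, t]` by
    -- `hb`.
    refine intervalIntegral.hasSum_integral_of_dominated_convergence
      (fun k s => ‖∑ j, orderedIntegral r s fun L => f k ((j, s) :: L)‖)
      (fun k => (hc k).aestronglyMeasurable) (fun k => .of_forall fun s _ => le_rfl)
      (.of_forall fun s hs' => ?_) ?_ (.of_forall fun s hs' => ?_)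
    · rw [Set.uIoc_of_le ht] at hs'
      exact summable_of_sum_le (fun _ => norm_nonneg _) (hb s hs'.1.le hs'.2)
    · refine (intervalIntegrable_const (c := (Fintype.card J : ℝ) *
        ((Fintype.card J * t) ^ r / r.factorial * M))).mono_fun
        (measurable_tsum_of_summable (fun k => (hc k).norm.measurable)
          fun _ _ => norm_nonneg _).aestronglyMeasurable ?_
      refine (ae_restrict_iff' measurableSet_uIoc).2 (.of_forall fun s hs' => ?_)
      rw [Set.uIoc_of_le ht] at hs'
      simp only
      rw [Real.norm_of_nonneg (tsum_nonneg fun _ => norm_nonneg _)]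
      exact (Real.tsum_le_of_sum_le (fun _ => norm_nonneg _) (hb s hs'.1.le hs'.2)).trans
        (le_abs_self _)
    · rw [Set.uIoc_of_le ht] at hs'
      refine hasSum_sum fun j _ => ih (f := fun k L => f k ((j, s) :: L)) hs'.1.le
        (fun k => continuous_comp_cons (hf k) j s) ?_ ?_
      · exact fun L hL hLs => hM _ (by simp [hL]) (hbox j s hs'.1.le hs'.2 L hLs)
      · exact fun L hL hLs => hs _ (by simp [hL]) (hbox j s hs'.1.le hs'.2 L hLs)

theorem _root_.Submodule.intervalIntegral_mem [CompleteSpace E] (M : Submodule ℝ E)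
    (hM : IsClosed (M : Set E)) {f : ℝ → E} (hf : Continuous f) (h : ∀ s, f s ∈ M) (a b : ℝ) :
    ∫ s in a..b, f s ∈ M := by
  have : CompleteSpace M := hM.completeSpace_coe
  have h1 : Continuous fun s => (⟨f s, h s⟩ : M) := hf.subtype_mk h
  have h2 := M.subtypeL.intervalIntegral_comp_comm (h1.intervalIntegrable (μ := volume) a b)
  simp only [Submodule.subtypeL_apply] at h2
  rw [h2]
  exact Subtype.mem _

/-- Applied to the closed graph of the observable, this lets `A` act under the time integrals. -/
theorem orderedIntegral_mem [CompleteSpace E] (M : Submodule ℝ E) (hM : IsClosed (M : Set E))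
    {r : ℕ} {t : ℝ} {f : List (J × ℝ) → E} (hf : Continuous f) (h : ∀ L, f L ∈ M) :
    orderedIntegral r t f ∈ M := by
  induction r generalizing t f with
  | zero => exact h []
  | succ r ih =>
    refine M.intervalIntegral_mem hM (continuous_finsetSum _ fun j _ =>
      continuous_orderedIntegral_cons hf j) (fun s => Submodule.sum_mem _ fun j _ => ?_) _ _
    exact ih (continuous_comp_cons hf j s) fun L => h _

theorem intervalIntegral_swap_of_continuous {f : ℝ → ℝ → E}
    (hf : Continuous (Function.uncurry f)) (a b c d : ℝ) :
    ∫ x in a..b, ∫ y in c..d, f x y = ∫ y in c..d, ∫ x in a..b, f x y := by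
  have key : ∀ c d : ℝ, c ≤ d → ∫ x in a..b, ∫ y in c..d, f x y =
      ∫ y in c..d, ∫ x in a..b, f x y := by
    intro c d hcd
    simp only [intervalIntegral.integral_of_le hcd]
    refine intervalIntegral_integral_swap ?_
    rw [Measure.prod_restrict]
    refine (hf.continuousOn.integrableOn_compact
      ((isCompact_uIcc (a := a) (b := b)).prod (isCompact_uIcc (a := c) (b := d)))).mono_set ?_
    exact Set.prod_mono Set.uIoc_subset_uIcc
      (Set.Ioc_subset_Icc_self.trans Set.Icc_subset_uIcc)
  rcases le_total c d with h | h
  · exact key c d h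
  · rw [intervalIntegral.integral_symm d c, ← key d c h, ← intervalIntegral.integral_neg]
    exact intervalIntegral.integral_congr fun x _ => intervalIntegral.integral_symm _ _

theorem orderedIntegral_intervalIntegral {r : ℕ} {t : ℝ} {g : List (J × ℝ) → ℝ → E}
    (hg : Continuous fun p : List (J × ℝ) × ℝ => g p.1 p.2) (a b : ℝ) :
    orderedIntegral r t (fun L => ∫ v in a..b, g L v) =
      ∫ v in a..b, orderedIntegral r t fun L => g L v := by
  induction r generalizing t g with
  | zero => rfl
  | succ r ih =>
    have h1 : ∀ j : J, Continuous fun p : (ℝ × ℝ) × List (J × ℝ) =>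
        g ((j, p.1.1) :: p.2) p.1.2 := fun j =>
      hg.comp (((continuous_cons_time j).comp ((continuous_fst.comp continuous_fst).prodMk
        continuous_snd)).prodMk (continuous_snd.comp continuous_fst))
    have h2 : ∀ j : J, Continuous fun p : ℝ × ℝ =>
        orderedIntegral r p.1 fun L => g ((j, p.1) :: L) p.2 := fun j =>
      continuous_orderedIntegral (f := fun (p : ℝ × ℝ) L => g ((j, p.1) :: L) p.2) (h1 j)
        continuous_fst
    simp only [orderedIntegral_succ]
    rw [← intervalIntegral_swap_of_continuous
      (f := fun s v => ∑ j, orderedIntegral r s fun L => g ((j, s) :: L) v)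
      (continuous_finsetSum _ fun j _ => h2 j)]
    refine intervalIntegral.integral_congr fun s _ => ?_
    have h3 : ∀ j : J, Continuous fun v : ℝ => orderedIntegral r s fun L => g ((j, s) :: L) v :=
      fun j => (h2 j).comp (continuous_const.prodMk continuous_id : Continuous fun v : ℝ => (s, v))
    rw [intervalIntegral.integral_finsetSum fun j _ => (h3 j).intervalIntegrable _ _]
    exact Finset.sum_congr rfl fun j _ => ih ((h1 j).comp
      ((continuous_const.prodMk continuous_snd).prodMk continuous_fst :
        Continuous fun p : List (J × ℝ) × ℝ => (((s, p.2), p.1) : (ℝ × ℝ) × List (J × ℝ))))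

/-- Fubini for two independent simplices, exchanging one integration of the second with all of the
first at a time. -/
theorem orderedIntegral_swap {l l' : ℕ} {t u : ℝ} {F : List (J × ℝ) → List (J × ℝ) → E}
    (hF : Continuous fun p : List (J × ℝ) × List (J × ℝ) => F p.1 p.2) :
    orderedIntegral l t (fun L => orderedIntegral l' u (F L)) =
      orderedIntegral l' u fun L' => orderedIntegral l t fun L => F L L' := by
  induction l' generalizing u F with
  | zero => rfl
  | succ l' ih =>
    have h1 : ∀ j : J, Continuous fun p : (List (J × ℝ) × ℝ) × List (J × ℝ) =>
        F p.1.1 ((j, p.1.2) :: p.2) := fun j =>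
      hF.comp ((continuous_fst.comp continuous_fst).prodMk ((continuous_cons_time j).comp
        ((continuous_snd.comp continuous_fst).prodMk continuous_snd)))
    have h2 : ∀ j : J, Continuous fun p : List (J × ℝ) × ℝ =>
        orderedIntegral l' p.2 fun L' => F p.1 ((j, p.2) :: L') := fun j =>
      continuous_orderedIntegral
        (f := fun (p : List (J × ℝ) × ℝ) L' => F p.1 ((j, p.2) :: L')) (h1 j) continuous_snd
    simp only [orderedIntegral_succ]
    rw [orderedIntegral_intervalIntegral
      (g := fun L s => ∑ j, orderedIntegral l' s fun L' => F L ((j, s) :: L'))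
      (continuous_finsetSum _ fun j _ => h2 j)]
    refine intervalIntegral.integral_congr fun s _ => ?_
    have h3 : ∀ j : J, Continuous fun L : List (J × ℝ) =>
        orderedIntegral l' s fun L' => F L ((j, s) :: L') := fun j => (h2 j).comp
      (continuous_id.prodMk continuous_const : Continuous fun L : List (J × ℝ) => (L, s))
    rw [orderedIntegral_finset_sum _ fun j _ => h3 j]
    exact Finset.sum_congr rfl fun j _ => ih ((h1 j).comp
      ((continuous_fst.prodMk continuous_const).prodMk continuous_snd :
        Continuous fun p : List (J × ℝ) × List (J × ℝ) =>
          (((p.1, s), p.2) : (List (J × ℝ) × ℝ) × List (J × ℝ))))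

end OrderedIntegral

/-! ### Differentiation along the diagonal -/

section TwoVariables

variable {E : Type*} [NormedAddCommGroup E] [NormedSpace ℝ E] [CompleteSpace E]

/-- The chain rule for `s ↦ h s s` when the partial derivatives are known only in integrated form
and for nonnegative arguments. It carries the shuffle recursion, the uniqueness of weak solutions
and the recursion of the Dyson terms. -/
theorem diagonal_sub_eq_integral {h h₁ h₂ : ℝ → ℝ → E} {T : ℝ} (hT : 0 ≤ T)
    (c₁ : Continuous (Function.uncurry h₁)) (c₂ : Continuous (Function.uncurry h₂))
    (e₁ : ∀ a b v, 0 ≤ a → a ≤ b → 0 ≤ v → h b v - h a v = ∫ s in a..b, h₁ s v)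
    (e₂ : ∀ a b u, 0 ≤ a → a ≤ b → 0 ≤ u → h u b - h u a = ∫ s in a..b, h₂ u s) :
    h T T - h 0 0 = ∫ s in (0 : ℝ)..T, (h₁ s s + h₂ s s) := by
  have cd : Continuous fun s => h₁ s s + h₂ s s :=
    (c₁.comp (continuous_id.prodMk continuous_id)).add (c₂.comp (continuous_id.prodMk continuous_id))
  have hd : ∀ a b, 0 ≤ a → a ≤ b →
      h b b - h a a = (∫ s in a..b, h₁ s b) + ∫ s in a..b, h₂ a s := by
    intro a b ha hab
    rw [← e₁ a b b ha hab (ha.trans hab), ← e₂ a b a ha hab ha]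
    abel
  -- A right derivative suffices, since a continuous function whose right derivative vanishes is
  -- constant. It comes from moving one argument at a time: from `(x, x)` to `(x, y)` and on to `(y,
  -- y)`.
  have hder : ∀ x, 0 ≤ x → HasDerivWithinAt (fun s => h s s) (h₁ x x + h₂ x x) (Set.Ici x) x := by
    intro x hx
    rw [hasDerivWithinAt_iff_isLittleO, Asymptotics.isLittleO_iff]
    intro ε hε
    have n₁ := (Metric.continuousAt_iff.1 (c₁.continuousAt (x := (x, x)))) (ε / 2) (by positivity)
    have n₂ := (Metric.continuousAt_iff.1 (c₂.continuousAt (x := (x, x)))) (ε / 2) (by positivity)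
    obtain ⟨δ₁, hδ₁, n₁⟩ := n₁
    obtain ⟨δ₂, hδ₂, n₂⟩ := n₂
    have hmem : Set.Ico x (x + min δ₁ δ₂) ∈ 𝓝[Set.Ici x] x :=
      Ico_mem_nhdsGE (by linarith [lt_min hδ₁ hδ₂])
    filter_upwards [hmem] with y hy
    have hy1 : y - x < δ₁ := by linarith [hy.2, min_le_left δ₁ δ₂]
    have hy2 : y - x < δ₂ := by linarith [hy.2, min_le_right δ₁ δ₂]
    have i₁ : IntervalIntegrable (fun s => h₁ s y) volume x y :=
      (c₁.comp (continuous_id.prodMk continuous_const)).intervalIntegrable _ _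
    have i₂ : IntervalIntegrable (fun s => h₂ x s) volume x y :=
      (c₂.comp (continuous_const.prodMk continuous_id)).intervalIntegrable _ _
    have key : h y y - h x x - (y - x) • (h₁ x x + h₂ x x) =
        (∫ s in x..y, (h₁ s y - h₁ x x)) + ∫ s in x..y, (h₂ x s - h₂ x x) := by
      rw [hd x y hx hy.1, intervalIntegral.integral_sub i₁ intervalIntegrable_const,
        intervalIntegral.integral_sub i₂ intervalIntegrable_const]
      simp only [intervalIntegral.integral_const, smul_add]
      abel
    rw [key, Real.norm_of_nonneg (sub_nonneg.2 hy.1)]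
    have b₁ : ‖∫ s in x..y, (h₁ s y - h₁ x x)‖ ≤ ε / 2 * |y - x| := by
      refine intervalIntegral.norm_integral_le_of_norm_le_const fun s hs => ?_
      rw [Set.uIoc_of_le hy.1] at hs
      have := n₁ (x := (s, y)) (by
        rw [Prod.dist_eq, max_lt_iff, Real.dist_eq, Real.dist_eq, abs_of_pos (by linarith [hs.1]),
          abs_of_nonneg (by linarith [hy.1])]
        exact ⟨by linarith [hs.2], hy1⟩)
      rw [dist_eq_norm] at this
      exact this.le
    have b₂ : ‖∫ s in x..y, (h₂ x s - h₂ x x)‖ ≤ ε / 2 * |y - x| := by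
      refine intervalIntegral.norm_integral_le_of_norm_le_const fun s hs => ?_
      rw [Set.uIoc_of_le hy.1] at hs
      have := n₂ (x := (x, s)) (by
        rw [Prod.dist_eq, max_lt_iff, Real.dist_eq, Real.dist_eq, abs_of_pos (a := s - x)
          (by linarith [hs.1]), sub_self, abs_zero]
        exact ⟨hδ₂, by linarith [hs.2]⟩)
      rw [dist_eq_norm] at this
      exact this.le
    rw [abs_of_nonneg (sub_nonneg.2 hy.1)] at b₁ b₂
    calc _ ≤ _ := norm_add_le _ _
      _ ≤ ε / 2 * (y - x) + ε / 2 * (y - x) := add_le_add b₁ b₂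
      _ = ε * (y - x) := by ring
  have hprim : ∀ x, HasDerivAt (fun u => ∫ s in (0 : ℝ)..u, (h₁ s s + h₂ s s)) (h₁ x x + h₂ x x) x :=
    fun x => intervalIntegral.integral_hasDerivAt_right (cd.intervalIntegrable _ _)
      (cd.stronglyMeasurableAtFilter _ _) cd.continuousAt
  have hcont : ContinuousOn (fun s => h s s) (Set.Icc 0 T) := by
    have ci : Continuous fun p : ℝ × ℝ => (∫ s in (0 : ℝ)..p.1, h₁ s p.1) := by
      have := intervalIntegral.continuous_parametric_intervalIntegral_of_continuous (μ := volume)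
        (f := fun (p : ℝ × ℝ) s => h₁ s p.1) (a₀ := 0)
        (c₁.comp (continuous_snd.prodMk (continuous_fst.comp continuous_fst))) continuous_fst
      exact this
    have cj : Continuous fun b : ℝ => (∫ s in (0 : ℝ)..b, h₁ s b) + (∫ s in (0 : ℝ)..b, h₂ 0 s) +
        h 0 0 :=
      ((ci.comp (continuous_id.prodMk continuous_id)).add
        (intervalIntegral.continuous_primitive (fun a b => (c₂.comp (continuous_const.prodMk
          continuous_id)).intervalIntegrable _ _) 0)).add continuous_const
    refine cj.continuousOn.congr fun b hb => ?_
    simp only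
    rw [← hd 0 b le_rfl hb.1]
    abel
  have hzero := constant_of_has_deriv_right_zero
    (f := fun x => h x x - ∫ s in (0 : ℝ)..x, (h₁ s s + h₂ s s)) (a := 0) (b := T)
    (hcont.sub fun x _ => (hprim x).continuousAt.continuousWithinAt) (fun x hx => by
      have := (hder x hx.1).sub (hprim x).hasDerivWithinAt
      rwa [sub_self] at this) T ⟨hT, le_rfl⟩
  simp only [intervalIntegral.integral_same, sub_zero] at hzero
  rw [← hzero]
  abel

end TwoVariables

end MeanField

end

noncomputable section

namespace MeanField

open Filter Topology MeasureTheory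

universe u

/-! ### Topology on lists -/

section ListTopology

variable {α β Y : Type*} [TopologicalSpace α] [TopologicalSpace β] [TopologicalSpace Y]

/-- A nonempty list is locally a pair of head and tail. Continuity on lists can thus be proved by
induction on the list. -/
theorem nhds_cons_eq_map (a : α) (l : List α) :
    𝓝 (a :: l) = map (fun p : α × List α => p.1 :: p.2) (𝓝 (a, l)) := by
  rw [nhds_prod_eq]
  exact eq_of_forall_ge_iff fun f => List.tendsto_cons_iff (f := id) (b := f)

theorem continuous_list_iff {f : List α → Y} :
    Continuous f ↔ Continuous fun p : α × List α => f (p.1 :: p.2) := by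
  refine ⟨fun h => h.comp List.continuous_cons, fun h => continuous_iff_continuousAt.2 ?_⟩
  rintro (_ | ⟨a, l⟩)
  · rw [ContinuousAt, nhds_nil]
    exact tendsto_pure_nhds f []
  · rw [ContinuousAt, nhds_cons_eq_map, tendsto_map'_iff]
    exact h.continuousAt

theorem continuous_getD (d : α) (i : ℕ) : Continuous fun l : List α => l.getD i d := by
  induction i with
  | zero => exact continuous_list_iff.2 continuous_fst
  | succ i ih => exact continuous_list_iff.2 (ih.comp continuous_snd)

theorem nhds_ofFn {r : ℕ} (x : Fin r → α) : 𝓝 (List.ofFn x) = map List.ofFn (𝓝 x) := by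
  induction r with
  | zero =>
    have : 𝓝 x = pure x := by
      rw [nhds_discrete]
    rw [this, map_pure]
    simp
  | succ r ih =>
    rw [List.ofFn_succ, nhds_cons_eq_map, nhds_prod_eq, ih, ← map_id (f := 𝓝 (x 0)),
      Filter.prod_map_map_eq, map_map, ← nhds_prod_eq]
    have h₁ : Continuous (Fin.consEquiv fun _ : Fin (r + 1) => α) :=
      Continuous.finCons (A := fun _ => α) continuous_fst continuous_snd
    have h₂ : Continuous (Fin.consEquiv fun _ : Fin (r + 1) => α).symm :=
      (continuous_apply 0).prodMk (continuous_pi fun i => continuous_apply _)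
    have h := (Homeomorph.mk (Fin.consEquiv fun _ : Fin (r + 1) => α) h₁ h₂).map_nhds_eq
      (x 0, fun i => x i.succ)
    have h' : (Fin.consEquiv fun _ : Fin (r + 1) => α) (x 0, fun i => x i.succ) = x :=
      Fin.cons_self_tail x
    simp only [Homeomorph.homeomorph_mk_coe] at h
    rw [h'] at h
    rw [← h, map_map]
    congr 1
    funext p
    simp [Fin.consEquiv, List.ofFn_succ]

/-- Lists of each fixed length form a copy of `Fin r → α` that is open in the space of lists, so
continuity may be tested length by length. -/
theorem continuous_list_iff_ofFn {f : List α → Y} :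
    Continuous f ↔ ∀ r : ℕ, Continuous fun x : Fin r → α => f (List.ofFn x) := by
  refine ⟨fun h r => continuous_iff_continuousAt.2 fun x => ?_,
    fun h => continuous_iff_continuousAt.2 fun l => ?_⟩
  · have := h.continuousAt (x := List.ofFn x)
    rwa [ContinuousAt, nhds_ofFn, tendsto_map'_iff] at this
  · have := (h l.length).continuousAt (x := l.get)
    rw [ContinuousAt, ← Function.comp_def, ← tendsto_map'_iff, ← nhds_ofFn, List.ofFn_get] at this
    exact this

end ListTopology

/-! ### Multi-commutators of functions of two lists -/

/-- `[a_r, [⋯, [a_1, F] ⋯ ]]` for the list `[a_1, …, a_r]`, evaluated at the empty lists, where the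
commutator `[a, F]` is the function `(L, L') ↦ F (a :: L) L' - F L (a :: L')`. -/
def listCommutator {α : Type*} : List α → (List α → List α → ℂ) → ℂ
  | [], F => F [] []
  | a :: l, F => listCommutator l fun L L' => F (a :: L) L' - F L (a :: L')

section ListCommutator

variable {α : Type*}

/-- The commutator expands into `2 ^ l.length` terms, one for each distribution of the letters to
the left or the right entry. Up to permutation, each term uses every letter of `l` once; so the time
bounds and the letter counts of `l` carry over. -/
theorem enorm_listCommutator_le {l : List α} {F : List α → List α → ℂ} {M : ℝ≥0∞}
    (hF : ∀ L L', (L ++ L').Perm l → ‖F L L'‖ₑ ≤ M) :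
    ‖listCommutator l F‖ₑ ≤ 2 ^ l.length * M := by
  induction l generalizing F M with
  | nil => simpa [listCommutator] using hF [] [] (by simp)
  | cons a l ih =>
    rw [listCommutator, List.length_cons, pow_succ, mul_assoc, two_mul M]
    refine ih fun L L' h => ?_
    refine (enorm_sub_le).trans (add_le_add (hF _ _ ?_) (hF _ _ ?_))
    · exact h.cons a
    · exact List.perm_middle.trans (h.cons a)

theorem hasSum_listCommutator {K : Type*} {l : List α} {F : K → List α → List α → ℂ}
    {F' : List α → List α → ℂ}
    (hF : ∀ L L', (L ++ L').Perm l → HasSum (fun k => F k L L') (F' L L')) :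
    HasSum (fun k => listCommutator l (F k)) (listCommutator l F') := by
  induction l generalizing F F' with
  | nil => simpa [listCommutator] using hF [] [] (by simp)
  | cons a l ih =>
    exact ih (F := fun k L L' => F k (a :: L) L' - F k L (a :: L')) fun L L' h =>
      (hF _ _ (h.cons a)).sub (hF _ _ (List.perm_middle.trans (h.cons a)))

theorem sum_norm_listCommutator_le {K : Type*} (S : Finset K) {l : List α}
    {F : K → List α → List α → ℂ} {M : ℝ}
    (hF : ∀ L L', (L ++ L').Perm l → ∑ k ∈ S, ‖F k L L'‖ ≤ M) :
    ∑ k ∈ S, ‖listCommutator l (F k)‖ ≤ 2 ^ l.length * M := by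
  induction l generalizing F M with
  | nil => simpa [listCommutator] using hF [] [] (by simp)
  | cons a l ih =>
    simp only [listCommutator, List.length_cons]
    rw [pow_succ, mul_assoc, two_mul M]
    refine ih fun L L' h => ?_
    refine (Finset.sum_le_sum fun k _ => norm_sub_le _ _).trans ?_
    rw [Finset.sum_add_distrib]
    exact add_le_add (hF _ _ (h.cons a)) (hF _ _ (List.perm_middle.trans (h.cons a)))

/-- The parameter makes the induction work: the head of the list joins the parameter space, which
becomes `Y × α`. Both types share a universe so that this product is again admissible. -/
theorem continuous_listCommutator_param {α Y : Type u} [TopologicalSpace α] [TopologicalSpace Y]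
    {F : Y → List α → List α → ℂ}
    (hF : Continuous fun p : Y × List α × List α => F p.1 p.2.1 p.2.2) :
    Continuous fun p : Y × List α => listCommutator p.2 (F p.1) := by
  refine continuous_iff_continuousAt.2 ?_
  rintro ⟨y, l⟩
  induction l generalizing Y with
  | nil =>
    rw [ContinuousAt, nhds_prod_eq, nhds_nil, prod_pure, tendsto_map'_iff]
    exact (hF.comp (continuous_id.prodMk continuous_const :
      Continuous fun y : Y => (y, ([], []) ))).continuousAt (x := y)
  | cons a l ih =>
    have h := ih (Y := Y × α) (y := (y, a))
      (F := fun y L L' => F y.1 (y.2 :: L) L' - F y.1 L (y.2 :: L')) (by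
        have c : Continuous fun p : (Y × α) × List α × List α => p.1.2 :: p.2.1 :=
          List.continuous_cons.comp ((continuous_snd.comp continuous_fst).prodMk
            (continuous_fst.comp continuous_snd))
        have c' : Continuous fun p : (Y × α) × List α × List α => p.1.2 :: p.2.2 :=
          List.continuous_cons.comp ((continuous_snd.comp continuous_fst).prodMk
            (continuous_snd.comp continuous_snd))
        exact (hF.comp ((continuous_fst.comp continuous_fst).prodMk
            (c.prodMk (continuous_snd.comp continuous_snd)))).sub
          (hF.comp ((continuous_fst.comp continuous_fst).prodMk
            ((continuous_fst.comp continuous_snd).prodMk c'))))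
    rw [ContinuousAt, nhds_prod_eq, nhds_cons_eq_map, ← map_id (f := 𝓝 y),
      Filter.prod_map_map_eq, tendsto_map'_iff, ← nhds_prod_eq]
    have h' : Tendsto (fun p : Y × α × List α => ((p.1, p.2.1), p.2.2)) (𝓝 (y, a, l))
        (𝓝 ((y, a), l)) := by
      exact ((continuous_fst.prodMk (continuous_fst.comp continuous_snd)).prodMk
        (continuous_snd.comp continuous_snd)).tendsto (y, a, l)
    exact h.tendsto.comp h'

theorem continuous_listCommutator [TopologicalSpace α] {F : List α → List α → ℂ}
    (hF : Continuous fun p : List α × List α => F p.1 p.2) :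
    Continuous fun l : List α => listCommutator l F :=
  (continuous_listCommutator_param (Y := PUnit) (F := fun _ => F) (hF.comp continuous_snd)).comp
    (continuous_const.prodMk continuous_id : Continuous fun l : List α => (PUnit.unit, l))

end ListCommutator

/-! ### The shuffle identity -/

section Shuffle

variable {J : Type*} [Fintype J] [TopologicalSpace J]

/-- The ordered integral of a function of two lists, over both lists. -/
def doubleIntegral (l l' : ℕ) (t : ℝ) (F : List (J × ℝ) → List (J × ℝ) → ℂ) : ℂ :=
  orderedIntegral l t fun L => orderedIntegral l' t (F L)

theorem continuous_two_orderedIntegral {Y : Type*} [TopologicalSpace Y] {l l' : ℕ}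
    {F : Y → List (J × ℝ) → List (J × ℝ) → ℂ}
    (hF : Continuous fun p : Y × List (J × ℝ) × List (J × ℝ) => F p.1 p.2.1 p.2.2)
    {t u : Y → ℝ} (ht : Continuous t) (hu : Continuous u) :
    Continuous fun y => orderedIntegral l (t y) fun L => orderedIntegral l' (u y) (F y L) := by
  refine continuous_orderedIntegral (f := fun y L => orderedIntegral l' (u y) (F y L)) ?_ ht
  refine continuous_orderedIntegral (Y := Y × List (J × ℝ))
    (f := fun p L' => F p.1 p.2 L') ?_ (hu.comp continuous_fst)
  exact hF.comp ((continuous_fst.comp continuous_fst).prodMk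
    ((continuous_snd.comp continuous_fst).prodMk continuous_snd))

variable {F : List (J × ℝ) → List (J × ℝ) → ℂ}

theorem continuous_cons_left (hF : Continuous fun p : List (J × ℝ) × List (J × ℝ) => F p.1 p.2)
    {Y : Type*} [TopologicalSpace Y] {s : Y → ℝ} (hs : Continuous s) (j : J) :
    Continuous fun p : Y × List (J × ℝ) × List (J × ℝ) => F ((j, s p.1) :: p.2.1) p.2.2 :=
  hF.comp (((continuous_cons_time j).comp ((hs.comp continuous_fst).prodMk
    (continuous_fst.comp continuous_snd))).prodMk (continuous_snd.comp continuous_snd))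

theorem continuous_cons_right (hF : Continuous fun p : List (J × ℝ) × List (J × ℝ) => F p.1 p.2)
    {Y : Type*} [TopologicalSpace Y] {s : Y → ℝ} (hs : Continuous s) (j : J) :
    Continuous fun p : Y × List (J × ℝ) × List (J × ℝ) => F p.2.1 ((j, s p.1) :: p.2.2) :=
  hF.comp ((continuous_fst.comp continuous_snd).prodMk ((continuous_cons_time j).comp
    ((hs.comp continuous_fst).prodMk (continuous_snd.comp continuous_snd))))

theorem continuous_cons_left_const
    (hF : Continuous fun p : List (J × ℝ) × List (J × ℝ) => F p.1 p.2) (j : J) (s : ℝ) :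
    Continuous fun p : List (J × ℝ) × List (J × ℝ) => F ((j, s) :: p.1) p.2 :=
  (continuous_cons_left (Y := Unit) hF (continuous_const (y := s)) j).comp
    (continuous_const.prodMk continuous_id : Continuous fun p : List (J × ℝ) × List (J × ℝ) =>
      (Unit.unit, p))

theorem continuous_cons_right_const
    (hF : Continuous fun p : List (J × ℝ) × List (J × ℝ) => F p.1 p.2) (j : J) (s : ℝ) :
    Continuous fun p : List (J × ℝ) × List (J × ℝ) => F p.1 ((j, s) :: p.2) :=
  (continuous_cons_right (Y := Unit) hF (continuous_const (y := s)) j).comp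
    (continuous_const.prodMk continuous_id : Continuous fun p : List (J × ℝ) × List (J × ℝ) =>
      (Unit.unit, p))

/-- The largest of all the times belongs either to the left or to the right list. Analytically, this
is the derivative of the double integral along equal upper limits. -/
theorem doubleIntegral_succ_succ
    (hF : Continuous fun p : List (J × ℝ) × List (J × ℝ) => F p.1 p.2) (l l' : ℕ) {t : ℝ}
    (ht : 0 ≤ t) :
    doubleIntegral (l + 1) (l' + 1) t F = ∫ s in (0 : ℝ)..t,
      ((∑ j, doubleIntegral l (l' + 1) s fun L L' => F ((j, s) :: L) L') +
        ∑ j, doubleIntegral (l + 1) l' s fun L L' => F L ((j, s) :: L')) := by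
  have c₁ : Continuous fun p : ℝ × ℝ => ∑ j, orderedIntegral l p.1 fun L =>
      orderedIntegral (l' + 1) p.2 (F ((j, p.1) :: L)) :=
    continuous_finsetSum _ fun j _ => continuous_two_orderedIntegral (Y := ℝ × ℝ)
      (F := fun p L L' => F ((j, p.1) :: L) L') (continuous_cons_left hF continuous_fst j)
      continuous_fst continuous_snd
  have c₂ : Continuous fun p : ℝ × ℝ => ∑ j, orderedIntegral (l + 1) p.1 fun L =>
      orderedIntegral l' p.2 fun L' => F L ((j, p.2) :: L') :=
    continuous_finsetSum _ fun j _ => continuous_two_orderedIntegral (Y := ℝ × ℝ)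
      (F := fun p L L' => F L ((j, p.2) :: L')) (continuous_cons_right hF continuous_snd j)
      continuous_fst continuous_snd
  have key := diagonal_sub_eq_integral (T := t)
    (h := fun a b => orderedIntegral (l + 1) a fun L => orderedIntegral (l' + 1) b (F L))
    (h₁ := fun a b => ∑ j, orderedIntegral l a fun L => orderedIntegral (l' + 1) b (F ((j, a) :: L)))
    (h₂ := fun a b => ∑ j, orderedIntegral (l + 1) a fun L =>
      orderedIntegral l' b fun L' => F L ((j, b) :: L')) ht c₁ c₂ ?_ ?_
  · simp only [orderedIntegral_succ l, intervalIntegral.integral_same, sub_zero] at key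
    simp only [doubleIntegral, orderedIntegral_succ l]
    exact key
  · intro a b v _ _ _
    simp only [orderedIntegral_succ l]
    have c : Continuous fun s => ∑ j, orderedIntegral l s fun L =>
        orderedIntegral (l' + 1) v (F ((j, s) :: L)) :=
      c₁.comp (continuous_id.prodMk continuous_const : Continuous fun s : ℝ => (s, v))
    exact intervalIntegral.integral_interval_sub_left (c.intervalIntegrable _ _)
      (c.intervalIntegrable _ _)
  · intro a b u _ _ _
    have c : Continuous fun s => ∑ j, orderedIntegral (l + 1) u fun L =>
        orderedIntegral l' s fun L' => F L ((j, s) :: L') :=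
      c₂.comp (continuous_const.prodMk continuous_id : Continuous fun s : ℝ => (u, s))
    have e : ∀ b, (orderedIntegral (l + 1) u fun L => orderedIntegral (l' + 1) b (F L)) =
        ∫ s in (0 : ℝ)..b, ∑ j, orderedIntegral (l + 1) u fun L =>
          orderedIntegral l' s fun L' => F L ((j, s) :: L') := by
      intro b
      rw [orderedIntegral_swap hF, orderedIntegral_succ l']
      refine intervalIntegral.integral_congr fun s _ => Finset.sum_congr rfl fun j _ => ?_
      exact (orderedIntegral_swap (continuous_cons_right_const hF j s)).symm
    simp only [e]
    exact intervalIntegral.integral_interval_sub_left (c.intervalIntegrable _ _)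
      (c.intervalIntegrable _ _)

/-- The shuffle identity. Both sides obey the same recursion when the largest time is removed: on
the left it selects one of the two terms of the innermost commutator, on the right one of the two
lists. -/
theorem orderedIntegral_listCommutator
    (hF : Continuous fun p : List (J × ℝ) × List (J × ℝ) => F p.1 p.2) (r : ℕ) {t : ℝ}
    (ht : 0 ≤ t) :
    orderedIntegral r t (fun L => listCommutator L F) =
      ∑ p ∈ Finset.HasAntidiagonal.antidiagonal r, (-1) ^ p.2 * doubleIntegral p.1 p.2 t F := by
  induction r generalizing t F with
  | zero => simp [orderedIntegral_zero, doubleIntegral, listCommutator]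
  | succ r ih =>
    set a : ℕ → ℕ → ℝ → ℂ := fun l l' s =>
      ∑ j, doubleIntegral l l' s fun L L' => F ((j, s) :: L) L' with ha
    set b : ℕ → ℕ → ℝ → ℂ := fun l l' s =>
      ∑ j, doubleIntegral l l' s fun L L' => F L ((j, s) :: L') with hb
    have ca : ∀ l l', Continuous (a l l') := fun l l' => continuous_finsetSum _ fun j _ =>
      continuous_two_orderedIntegral (F := fun s L L' => F ((j, s) :: L) L')
        (continuous_cons_left hF continuous_id j) continuous_id continuous_id
    have cb : ∀ l l', Continuous (b l l') := fun l l' => continuous_finsetSum _ fun j _ =>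
      continuous_two_orderedIntegral (F := fun s L L' => F L ((j, s) :: L'))
        (continuous_cons_right hF continuous_id j) continuous_id continuous_id
    have e₁ : orderedIntegral (r + 1) t (fun L => listCommutator L F) =
        ∫ s in (0 : ℝ)..t, ∑ p ∈ Finset.HasAntidiagonal.antidiagonal r, (-1) ^ p.2 *
          (a p.1 p.2 s - b p.1 p.2 s) := by
      rw [orderedIntegral_succ]
      refine intervalIntegral.integral_congr fun s hs => ?_
      rw [Set.uIcc_of_le ht] at hs
      have cl : ∀ j, Continuous fun p : List (J × ℝ) × List (J × ℝ) => F ((j, s) :: p.1) p.2 :=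
        fun j => continuous_cons_left_const hF j s
      have cr : ∀ j, Continuous fun p : List (J × ℝ) × List (J × ℝ) => F p.1 ((j, s) :: p.2) :=
        fun j => continuous_cons_right_const hF j s
      have e : ∀ j l l', doubleIntegral l l' s (fun L L' => F ((j, s) :: L) L' - F L ((j, s) :: L'))
          = doubleIntegral l l' s (fun L L' => F ((j, s) :: L) L') -
            doubleIntegral l l' s (fun L L' => F L ((j, s) :: L')) := by
        intro j l l'
        have c : ∀ {F : List (J × ℝ) → List (J × ℝ) → ℂ},
            (Continuous fun p : List (J × ℝ) × List (J × ℝ) => F p.1 p.2) →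
            Continuous fun L => orderedIntegral l' s (F L) := fun h =>
          continuous_orderedIntegral h continuous_const
        simp only [doubleIntegral]
        rw [← orderedIntegral_sub (c (cl j)) (c (cr j))]
        congr 1
        funext L
        exact orderedIntegral_sub ((cl j).comp (continuous_const.prodMk continuous_id))
          ((cr j).comp (continuous_const.prodMk continuous_id))
      simp only [listCommutator]
      rw [Finset.sum_congr rfl fun j _ => ih (F := fun L L' => F ((j, s) :: L) L' -
        F L ((j, s) :: L')) ((cl j).sub (cr j)) hs.1]
      simp only [e, mul_sub, Finset.sum_sub_distrib, ha, hb, Finset.mul_sum]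
      rw [Finset.sum_comm]
      congr 1
      exact Finset.sum_comm
    have cab : ∀ p : ℕ × ℕ, Continuous fun s => (-1) ^ p.2 * (a p.1 p.2 s - b p.1 p.2 s) :=
      fun p => continuous_const.mul ((ca _ _).sub (cb _ _))
    rw [e₁, intervalIntegral.integral_finsetSum fun p _ => (cab p).intervalIntegrable _ _]
    simp only [intervalIntegral.integral_const_mul]
    rw [Finset.sum_congr rfl fun p _ => congrArg _ (intervalIntegral.integral_sub
      ((ca _ _).intervalIntegrable 0 t) ((cb _ _).intervalIntegrable 0 t))]
    -- The recursion holds also when one list is empty; the conditionals then suppress the integral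
    -- in which that list would lose a letter.
    have hD : ∀ p : ℕ × ℕ, p ∈ Finset.HasAntidiagonal.antidiagonal (r + 1) → doubleIntegral p.1 p.2 t F =
        (if p.1 = 0 then 0 else ∫ s in (0 : ℝ)..t, a (p.1 - 1) p.2 s) +
          if p.2 = 0 then 0 else ∫ s in (0 : ℝ)..t, b p.1 (p.2 - 1) s := by
      rintro ⟨_ | l, _ | l'⟩ hp
      · simp at hp
      · simp [doubleIntegral, orderedIntegral_zero, orderedIntegral_succ, hb]
      · simp [doubleIntegral, orderedIntegral_zero, orderedIntegral_succ, ha]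
      · simp only [Nat.add_eq_zero_iff, one_ne_zero, and_false, if_false, Nat.add_sub_cancel]
        rw [← intervalIntegral.integral_add ((ca _ _).intervalIntegrable _ _)
          ((cb _ _).intervalIntegrable _ _)]
        exact doubleIntegral_succ_succ hF l l' ht
    rw [Finset.sum_congr rfl fun p hp => congrArg _ (hD p hp)]
    simp only [mul_add, mul_sub, Finset.sum_add_distrib, Finset.sum_sub_distrib]
    -- The `a` sum is shifted in the first index and the `b` sum in the second; the latter shift
    -- supplies the minus sign of the commutator.
    rw [Finset.Nat.sum_antidiagonal_succ, Finset.Nat.sum_antidiagonal_succ' (n := r)]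
    simp [pow_succ, sub_eq_add_neg]

end Shuffle

/-! ### Comparison with iterated integrals of functions of the times -/

section IteratedIntegral

variable {J : Type*} [Fintype J] [TopologicalSpace J]

theorem iteratedIntegral_ofFn {r : ℕ} {t : ℝ} {f : List (J × ℝ) → ℂ} (hf : Continuous f) :
    iteratedIntegral r t (fun s => ∑ j : Fin r → J, f (List.ofFn fun i => (j i, s i))) =
      orderedIntegral r t f := by
  induction r generalizing t f with
  | zero => simp [iteratedIntegral, orderedIntegral_zero]
  | succ r ih =>
    rw [iteratedIntegral, orderedIntegral_succ]
    refine intervalIntegral.integral_congr fun s _ => ?_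
    rw [← orderedIntegral_finset_sum _ fun j _ => continuous_comp_cons hf j s,
      ← ih (continuous_finsetSum _ fun j _ => continuous_comp_cons hf j s)]
    congr 1
    funext x
    rw [← (Fin.consEquiv fun _ => J).sum_comp, Fintype.sum_prod_type, Finset.sum_comm]
    simp [Fin.consEquiv, List.ofFn_succ]

/-- With the one-letter alphabet `Unit`, iterated integrals inherit the results on ordered
integrals. The default of `getD` is never used, since only lists of length `r` occur. -/
theorem iteratedIntegral_eq_orderedIntegral {r : ℕ} {t : ℝ} (f : (Fin r → ℝ) → ℂ) :
    iteratedIntegral r t f =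
      orderedIntegral r t fun L : List (Unit × ℝ) => f fun i => (L.getD i ((), 0)).2 := by
  induction r generalizing t with
  | zero =>
    rw [iteratedIntegral, orderedIntegral_zero]
    exact congrArg f (Subsingleton.elim _ _)
  | succ r ih =>
    rw [iteratedIntegral, orderedIntegral_succ]
    refine intervalIntegral.integral_congr fun s _ => ?_
    simp only [ih, Finset.univ_unique, Finset.sum_singleton]
    congr 1
    funext L
    congr 1
    funext i
    refine Fin.cases ?_ (fun _ => ?_) i <;> simp

theorem continuous_times (r : ℕ) : Continuous fun (L : List (Unit × ℝ)) (i : Fin r) =>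
    (L.getD i ((), 0)).2 :=
  continuous_pi fun _ => continuous_snd.comp (continuous_getD _ _)

theorem times_mem {r : ℕ} {t : ℝ} {L : List (Unit × ℝ)} (hL : L.length = r)
    (h : ∀ a ∈ L, 0 ≤ a.2 ∧ a.2 ≤ t) (i : Fin r) :
    0 ≤ (L.getD i ((), 0)).2 ∧ (L.getD i ((), 0)).2 ≤ t := by
  have hi : (i : ℕ) < L.length := hL ▸ i.2
  rw [List.getD_eq_getElem _ _ hi]
  exact h _ (List.getElem_mem hi)

theorem iteratedIntegral_congr {r : ℕ} {t : ℝ} (ht : 0 ≤ t) {f f' : (Fin r → ℝ) → ℂ}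
    (h : ∀ s, (∀ i, 0 ≤ s i ∧ s i ≤ t) → f s = f' s) :
    iteratedIntegral r t f = iteratedIntegral r t f' := by
  rw [iteratedIntegral_eq_orderedIntegral, iteratedIntegral_eq_orderedIntegral]
  exact orderedIntegral_congr ht fun L hL hLs => h _ fun i => times_mem hL hLs i

theorem iteratedIntegral_finset_sum {K : Type*} (F : Finset K) {r : ℕ} {t : ℝ}
    {f : K → (Fin r → ℝ) → ℂ} (hf : ∀ k ∈ F, Continuous (f k)) :
    iteratedIntegral r t (fun s => ∑ k ∈ F, f k s) = ∑ k ∈ F, iteratedIntegral r t (f k) := by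
  simp only [iteratedIntegral_eq_orderedIntegral]
  exact orderedIntegral_finset_sum F fun k hk => (hf k hk).comp (continuous_times r)

theorem hasSum_iteratedIntegral {K : Type*} [Countable K] {r : ℕ} {t : ℝ} (ht : 0 ≤ t)
    {f : K → (Fin r → ℝ) → ℂ} {f' : (Fin r → ℝ) → ℂ} (hf : ∀ k, Continuous (f k)) {M : ℝ}
    (hM : ∀ s, (∀ i, 0 ≤ s i ∧ s i ≤ t) → ∀ F : Finset K, ∑ k ∈ F, ‖f k s‖ ≤ M)
    (hs : ∀ s, (∀ i, 0 ≤ s i ∧ s i ≤ t) → HasSum (fun k => f k s) (f' s)) :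
    HasSum (fun k => iteratedIntegral r t (f k)) (iteratedIntegral r t f') := by
  simp only [iteratedIntegral_eq_orderedIntegral]
  exact hasSum_orderedIntegral ht (fun k => (hf k).comp (continuous_times r))
    (fun L hL hLs => hM _ (times_mem hL hLs)) (fun L hL hLs => hs _ (times_mem hL hLs))

theorem norm_iteratedIntegral_le {r : ℕ} {t : ℝ} (ht : 0 ≤ t) {f : (Fin r → ℝ) → ℂ} {M : ℝ}
    (hM : ∀ s, (∀ i, 0 ≤ s i ∧ s i ≤ t) → ‖f s‖ ≤ M) :
    ‖iteratedIntegral r t f‖ ≤ t ^ r / r.factorial * M := by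
  induction r generalizing t with
  | zero => simpa [iteratedIntegral] using hM Fin.elim0 nofun
  | succ r ih =>
    rw [iteratedIntegral]
    refine (intervalIntegral.norm_integral_le_of_norm_le (g := fun s => s ^ r / r.factorial * M) ht
      (.of_forall fun s hs => ih hs.1.le fun x hx => hM _ fun i => ?_)
      ((by fun_prop : Continuous fun s : ℝ => s ^ r / r.factorial * M).intervalIntegrable _ _)).trans
        (le_of_eq ?_)
    · refine Fin.cases ?_ (fun i => ?_) i
      · exact ⟨hs.1.le, hs.2⟩
      · exact ⟨(hx i).1, (hx i).2.trans hs.2⟩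
    · have : ∀ s : ℝ, s ^ r / r.factorial * M = (M / r.factorial) * s ^ r := fun s => by ring
      simp only [this, intervalIntegral.integral_const_mul, integral_pow]
      have h1 : ((r : ℝ) + 1) ≠ 0 := by positivity
      rw [Nat.factorial_succ]
      push_cast
      field_simp
      ring

theorem enorm_iteratedIntegral_le {r : ℕ} {t : ℝ} (ht : 0 ≤ t) {f : (Fin r → ℝ) → ℂ} {M : ℝ≥0∞}
    (hM : ∀ s, (∀ i, 0 ≤ s i ∧ s i ≤ t) → ‖f s‖ₑ ≤ M) :
    ‖iteratedIntegral r t f‖ₑ ≤ ENNReal.ofReal (t ^ r / r.factorial) * M := by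
  -- An infinite bound has content only if the simplex has volume zero. This happens for `t = 0` and
  -- `r ≠ 0`, where the integral vanishes in accordance with `0 * ∞ = 0`.
  by_cases hM' : M = ∞
  · by_cases h0 : t ^ r / r.factorial = 0
    · have ht0 : t = 0 ∧ r ≠ 0 := by
        rw [div_eq_zero_iff] at h0
        rcases h0 with h0 | h0
        · exact pow_eq_zero_iff'.1 h0
        · exact absurd h0 (by positivity)
      obtain ⟨rfl, hr⟩ := ht0
      obtain ⟨r, rfl⟩ := Nat.exists_eq_succ_of_ne_zero hr
      simp [iteratedIntegral]
    · rw [hM', ENNReal.mul_top]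
      · exact le_top
      · simpa using lt_of_le_of_ne (by positivity) (Ne.symm h0)
  · lift M to NNReal using hM'
    have h := norm_iteratedIntegral_le ht (f := f) (M := M) fun s hs => by
      have := hM s hs
      rwa [enorm_le_coe] at this
    rw [← ofReal_norm, ← ENNReal.ofReal_coe_nnreal,
      ← ENNReal.ofReal_mul (by positivity)]
    exact ENNReal.ofReal_le_ofReal h

end IteratedIntegral

end MeanField

end

noncomputable section

namespace MeanField

open Filter Topology MeasureTheory

universe u v w

/-! ### Sums over product index sets -/

theorem summable_norm_pi_prod {α : Type*} [Fintype α] {κ : α → Type*} {f : ∀ a, κ a → ℂ}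
    (hf : ∀ a, Summable fun i => ‖f a i‖) :
    Summable fun c : (∀ a, κ a) => ‖∏ a, f a (c a)‖ := by
  simp only [norm_prod]
  exact summable_prod_pi (fun a i => ‖f a i‖) (fun _ _ => norm_nonneg _) hf

theorem hasSum_pi_prod {α : Type*} [Fintype α] {κ : α → Type*} {f : ∀ a, κ a → ℂ}
    (hf : ∀ a, Summable fun i => ‖f a i‖) :
    HasSum (fun c : (∀ a, κ a) => ∏ a, f a (c a)) (∏ a, ∑' i, f a i) := by
  classical
  have hs := (summable_norm_pi_prod hf).of_norm.hasSum
  -- The sum exists by absolute convergence, so its value may be computed along finite boxes, on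
  -- which it factorizes.
  have h1 : Tendsto (fun F : ∀ a, Finset (κ a) => Fintype.piFinset F) atTop atTop := by
    refine tendsto_atTop_finset_of_monotone (fun F F' h => Fintype.piFinset_subset _ _ h)
      fun c => ⟨fun a => {c a}, ?_⟩
    simp
  have h2 := hs.comp h1
  have h3 : Tendsto (fun F : ∀ a, Finset (κ a) => ∏ a, ∑ i ∈ F a, f a i) atTop
      (𝓝 (∏ a, ∑' i, f a i)) := by
    refine tendsto_finsetProd _ fun a _ => ?_
    refine (hf a).of_norm.hasSum.comp ?_
    refine tendsto_atTop.2 fun b => ?_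
    filter_upwards [eventually_ge_atTop (Function.update (fun a => (∅ : Finset (κ a))) a b)]
      with F hF
    simpa using hF a
  have h4 : ((fun s : Finset (∀ a, κ a) => ∑ c ∈ s, ∏ a, f a (c a)) ∘
      fun F : ∀ a, Finset (κ a) => Fintype.piFinset F) = fun F => ∏ a, ∑ i ∈ F a, f a i := by
    funext F
    exact (Finset.prod_univ_sum _ _).symm
  have h5 := tendsto_nhds_unique (h4 ▸ h2) h3
  rwa [h5] at hs

/-- Splitting a dependent function on `Fin N` into its restrictions to the first `n` arguments and
to the remaining arguments. -/
def piSplit (κ : ℕ → Type*) {n N : ℕ} (h : n ≤ N) :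
    (∀ j : Fin N, κ j) ≃ (∀ i : Fin n, κ i) × (∀ j : {j : Fin N // n ≤ (j : ℕ)}, κ j) where
  toFun c := (fun i => c (Fin.castLE h i), fun j => c j)
  invFun p := fun j => if hj : (j : ℕ) < n then p.1 ⟨j, hj⟩ else p.2 ⟨j, not_lt.1 hj⟩
  left_inv c := by
    funext j
    by_cases hj : (j : ℕ) < n
    · simp only [hj, dif_pos]
      rfl
    · simp [hj]
  right_inv p := by
    refine Prod.ext ?_ ?_
    · funext i
      simp
    · funext j
      have hj : ¬ ((j : Fin N) : ℕ) < n := not_lt.2 j.2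
      simp [hj]

/-- The indices below `n` in `Fin N`. -/
def finLtEquiv {n N : ℕ} (h : n ≤ N) : Fin n ≃ {j : Fin N // ¬ n ≤ (j : ℕ)} where
  toFun i := ⟨Fin.castLE h i, not_le.2 i.2⟩
  invFun j := ⟨j.1.1, not_le.1 j.2⟩
  left_inv _ := rfl
  right_inv _ := rfl

theorem prod_split {M : Type*} [CommMonoid M] {n N : ℕ} (h : n ≤ N) (f : Fin N → M) :
    ∏ j, f j = (∏ i : Fin n, f (Fin.castLE h i)) * ∏ j : {j : Fin N // n ≤ (j : ℕ)}, f j := by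
  have h1 := Fintype.prod_subtype_mul_prod_subtype (fun j : Fin N => n ≤ (j : ℕ)) f
  rw [← h1, mul_comm]
  congr 1
  exact (Equiv.prod_comp (finLtEquiv h) fun j => f j).symm

/-- Unlike the other particles, the first `n` may be entangled by `A_S`; hence a general function
`f` of their indices, in place of a product. -/
theorem hasSum_split {κ : ℕ → Type*} {n N : ℕ} (h : n ≤ N) {f : (∀ i : Fin n, κ i) → ℂ}
    (hf : Summable fun c => ‖f c‖) {φ : ∀ j : Fin N, κ j → ℂ}
    (hφ : ∀ j, Summable fun i => ‖φ j i‖) :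
    HasSum (fun c : (∀ j : Fin N, κ j) =>
      f (fun i => c (Fin.castLE h i)) * ∏ j : {j : Fin N // n ≤ (j : ℕ)}, φ j (c j))
      ((∑' c, f c) * ∏ j : {j : Fin N // n ≤ (j : ℕ)}, ∑' i, φ j i) := by
  have h1 := hasSum_pi_prod (κ := fun j : {j : Fin N // n ≤ (j : ℕ)} => κ j)
    (f := fun j => φ j) fun j => hφ j
  have h2 := summable_norm_pi_prod (κ := fun j : {j : Fin N // n ≤ (j : ℕ)} => κ j)
    (f := fun j => φ j) fun j => hφ j
  have h3 := summable_mul_of_summable_norm hf h2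
  have h4 : HasSum (fun p : (∀ i : Fin n, κ i) × (∀ j : {j : Fin N // n ≤ (j : ℕ)}, κ j) =>
      f p.1 * ∏ j : {j : Fin N // n ≤ (j : ℕ)}, φ j (p.2 j)) _ := h3.hasSum
  rw [← HasSum.mul_eq hf.of_norm.hasSum h1 h3.hasSum] at h4
  rw [← Equiv.hasSum_iff (piSplit κ h)] at h4
  exact h4

/-- Since `‖T x - T a‖ ^ 2` is a combination of inner products, the product formulas for inner
products of tensors give continuity of the tensor maps. -/
theorem continuous_of_continuous_inner {X E : Type*} [TopologicalSpace X] [NormedAddCommGroup E]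
    [InnerProductSpace ℂ E] {T : X → E}
    (h : Continuous fun p : X × X => inner ℂ (T p.1) (T p.2)) : Continuous T := by
  refine continuous_iff_continuousAt.2 fun a => tendsto_iff_norm_sub_tendsto_zero.2 ?_
  have h1 : Tendsto (fun x => ‖T x - T a‖ ^ 2) (𝓝 a) (𝓝 0) := by
    have e : ∀ x, ‖T x - T a‖ ^ 2 = (inner ℂ (T x) (T x)).re - 2 * (inner ℂ (T x) (T a)).re +
        (inner ℂ (T a) (T a)).re := fun x => by
      rw [@norm_sub_sq ℂ, ← inner_self_eq_norm_sq (𝕜 := ℂ) (T x),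
        ← inner_self_eq_norm_sq (𝕜 := ℂ) (T a)]
      rfl
    have c : Continuous fun x => ‖T x - T a‖ ^ 2 := by
      simp only [e]
      exact ((Complex.continuous_re.comp (h.comp (continuous_id.prodMk continuous_id))).sub
        (continuous_const.mul (Complex.continuous_re.comp
          (h.comp (continuous_id.prodMk continuous_const))))).add continuous_const
    simpa using c.tendsto a
  simpa using h1.sqrt

/-! ### Tensors -/

section Tensor

variable {H : ℕ → Type u} [∀ j, NormedAddCommGroup (H j)] [∀ j, InnerProductSpace ℂ (H j)]
  {ι : ℕ → Type w} {R : Type v} [NormedAddCommGroup R] [InnerProductSpace ℂ R]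
  (b : ∀ j, HilbertBasis (ι j) ℂ (H j))

theorem hasSum_lp_inner {α : Type*} {F : Type*} [NormedAddCommGroup F] [InnerProductSpace ℂ F]
    (x y : lp (fun _ : α => F) 2) : HasSum (fun c => inner ℂ (x c) (y c)) (inner ℂ x y) :=
  lp.hasSum_inner x y

theorem hasSum_repr_inner (j : ℕ) (x y : H j) :
    HasSum (fun i => inner ℂ ((b j).repr x i) ((b j).repr y i)) (inner ℂ x y) := by
  rw [← (b j).repr.inner_map_map x y]
  exact lp.hasSum_inner _ _

theorem inner_pureTensor (N : ℕ) (φ φ' : ∀ j : Fin N, H j) :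
    inner ℂ (pureTensor b N φ) (pureTensor b N φ') = ∏ j, inner ℂ (φ j) (φ' j) := by
  have h := hasSum_pi_prod (κ := fun j : Fin N => ι j)
    (f := fun (j : Fin N) i => inner ℂ ((b j).repr (φ j) i) ((b j).repr (φ' j) i))
    fun j => (hasSum_repr_inner b j _ _).summable.norm
  simp only [(hasSum_repr_inner b _ _ _).tsum_eq] at h
  refine (hasSum_lp_inner _ _).unique ?_
  refine h.congr_fun fun c => ?_
  simp [pureTensor, map_prod, Finset.prod_mul_distrib]

theorem pureTensor_eq_appendTensor {n N : ℕ} (h : n ≤ N) (φ : ∀ j : Fin N, H j) :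
    pureTensor b N φ =
      appendTensor b h (pureTensor b n fun i => φ (Fin.castLE h i)) φ := by
  ext c
  exact prod_split h fun j => (b j).repr (φ j) (c j)

theorem inner_tensorRes_appendTensor {n N : ℕ} (h : n ≤ N) (x x' : PSpace ι n)
    (φ φ' : ∀ j : Fin N, H j) (χ χ' : R) :
    inner ℂ (tensorRes (appendTensor b h x φ) χ) (tensorRes (appendTensor b h x' φ') χ') =
      inner ℂ x x' * (∏ j : {j : Fin N // n ≤ (j : ℕ)}, inner ℂ (φ j) (φ' j)) * inner ℂ χ χ' := by
  have h1 := (hasSum_split (κ := ι) h (f := fun c => inner ℂ (x c) (x' c))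
    (hasSum_lp_inner x x').summable.norm
    (φ := fun j i => inner ℂ ((b j).repr (φ j) i) ((b j).repr (φ' j) i))
    fun j => (hasSum_repr_inner b j _ _).summable.norm).mul_right (inner ℂ χ χ')
  simp only [(hasSum_repr_inner b _ _ _).tsum_eq, (hasSum_lp_inner x x').tsum_eq] at h1
  refine (hasSum_lp_inner _ _).unique (h1.congr_fun fun c => ?_)
  simp only [tensorRes, appendTensor, inner_smul_left, inner_smul_right, map_mul, map_prod,
    RCLike.inner_apply, Finset.prod_mul_distrib]
  ring

theorem norm_tensorRes_appendTensor {n N : ℕ} (h : n ≤ N) (x : PSpace ι n)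
    (φ : ∀ j : Fin N, H j) (χ : R) :
    ‖tensorRes (appendTensor b h x φ) χ‖ =
      ‖x‖ * (∏ j : {j : Fin N // n ≤ (j : ℕ)}, ‖φ j‖) * ‖χ‖ := by
  have h1 := inner_tensorRes_appendTensor b h x x φ φ χ χ
  simp only [inner_self_eq_norm_sq_to_K] at h1
  have h2 : ‖tensorRes (appendTensor b h x φ) χ‖ ^ 2 =
      (‖x‖ * (∏ j : {j : Fin N // n ≤ (j : ℕ)}, ‖φ j‖) * ‖χ‖) ^ 2 := by
    rw [mul_pow, mul_pow, ← Finset.prod_pow]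
    exact_mod_cast h1
  exact (sq_eq_sq₀ (norm_nonneg _) (by positivity)).1 h2

theorem norm_pureTensor (N : ℕ) (φ : ∀ j : Fin N, H j) : ‖pureTensor b N φ‖ = ∏ j, ‖φ j‖ := by
  have h1 := inner_pureTensor b N φ φ
  simp only [inner_self_eq_norm_sq_to_K] at h1
  have h2 : ‖pureTensor b N φ‖ ^ 2 = (∏ j, ‖φ j‖) ^ 2 := by
    rw [← Finset.prod_pow]
    exact_mod_cast h1
  exact (sq_eq_sq₀ (norm_nonneg _) (by positivity)).1 h2

theorem continuous_pureTensor (N : ℕ) : Continuous (pureTensor b N) := by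
  refine continuous_of_continuous_inner ?_
  simp only [inner_pureTensor]
  fun_prop

theorem continuous_tensorRes_appendTensor {n N : ℕ} (h : n ≤ N) :
    Continuous fun p : PSpace ι n × (∀ j : Fin N, H j) × R =>
      tensorRes (appendTensor b h p.1 p.2.1) p.2.2 := by
  refine continuous_of_continuous_inner ?_
  simp only [inner_tensorRes_appendTensor]
  fun_prop

end Tensor

namespace Model

variable {H : ℕ → Type u} [∀ j, NormedAddCommGroup (H j)] [∀ j, InnerProductSpace ℂ (H j)]
  [∀ j, CompleteSpace (H j)] {ι : ℕ → Type w}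
  {R : Type v} [NormedAddCommGroup R] [InnerProductSpace ℂ R] [CompleteSpace R]
  (S : Model H ι R)

/-- The value of `A_S ⊗ 1 ⊗ A_R` on an elementary tensor, where `χ` is the value of `A_R`. -/
def obsVec {n N : ℕ} (h : n ≤ N) (AS : PSpace ι n →L[ℂ] PSpace ι n) (φ : ∀ j : Fin N, H j) (χ : R) :
    TSpace ι R N :=
  tensorRes (appendTensor S.basis h (AS (pureTensor S.basis n fun i => φ (Fin.castLE h i))) φ) χ

theorem tens_eq {n N : ℕ} (h : n ≤ N) (x : (∀ j : Fin N, H j) × R) :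
    S.tens x = tensorRes (appendTensor S.basis h
      (pureTensor S.basis n fun i => x.1 (Fin.castLE h i)) x.1) x.2 := by
  rw [tens, pureTensor_eq_appendTensor S.basis h]

theorem inner_tens {N : ℕ} (x y : (∀ j : Fin N, H j) × R) :
    inner ℂ (S.tens x) (S.tens y) = (∏ j, inner ℂ (x.1 j) (y.1 j)) * inner ℂ x.2 y.2 := by
  rw [S.tens_eq le_rfl x, S.tens_eq le_rfl y, inner_tensorRes_appendTensor, inner_pureTensor,
    prod_split le_rfl fun j => inner ℂ (x.1 j) (y.1 j)]

theorem norm_tens {N : ℕ} (x : (∀ j : Fin N, H j) × R) :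
    ‖S.tens x‖ = (∏ j, ‖x.1 j‖) * ‖x.2‖ := by
  rw [S.tens_eq le_rfl x, norm_tensorRes_appendTensor, norm_pureTensor,
    prod_split le_rfl fun j => ‖x.1 j‖]

theorem continuous_tens {N : ℕ} : Continuous (S.tens (N := N)) := by
  refine continuous_of_continuous_inner ?_
  simp only [inner_tens]
  fun_prop

theorem inner_tens_obsVec {n N : ℕ} (h : n ≤ N) (AS : PSpace ι n →L[ℂ] PSpace ι n)
    (x : (∀ j : Fin N, H j) × R) (φ : ∀ j : Fin N, H j) (χ : R) :
    inner ℂ (S.tens x) (S.obsVec h AS φ χ) =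
      inner ℂ (pureTensor S.basis n fun i => x.1 (Fin.castLE h i))
        (AS (pureTensor S.basis n fun i => φ (Fin.castLE h i))) *
        (∏ j : {j : Fin N // n ≤ (j : ℕ)}, inner ℂ (x.1 j) (φ j)) * inner ℂ x.2 χ := by
  rw [S.tens_eq h x, obsVec, inner_tensorRes_appendTensor]

theorem norm_obsVec_le {n N : ℕ} (h : n ≤ N) (AS : PSpace ι n →L[ℂ] PSpace ι n)
    (φ : ∀ j : Fin N, H j) (χ : R) :
    ‖S.obsVec h AS φ χ‖ ≤ ‖AS‖ * (∏ j, ‖φ j‖) * ‖χ‖ := by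
  rw [obsVec, norm_tensorRes_appendTensor, prod_split h fun j => ‖φ j‖, ← mul_assoc]
  gcongr
  rw [← norm_pureTensor S.basis n fun i => φ (Fin.castLE h i)]
  exact AS.le_opNorm _

theorem continuous_obsVec {n N : ℕ} (h : n ≤ N) (AS : PSpace ι n →L[ℂ] PSpace ι n) :
    Continuous fun p : (∀ j : Fin N, H j) × R => S.obsVec h AS p.1 p.2 := by
  refine (continuous_tensorRes_appendTensor S.basis h).comp ((AS.continuous.comp
    ((continuous_pureTensor S.basis n).comp ?_)).prodMk continuous_id)
  fun_prop

end Model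

end MeanField

end

noncomputable section

namespace MeanField

open Filter Topology MeasureTheory

universe u v w

/-- The real-linear functional `x ↦ ⟪x, w⟫`. -/
def innerLeft {E : Type*} [NormedAddCommGroup E] [InnerProductSpace ℂ E] (w : E) : E →L[ℝ] ℂ :=
  (Complex.conjCLE : ℂ →L[ℝ] ℂ).comp ((innerSL ℂ w).restrictScalars ℝ)

theorem innerLeft_apply {E : Type*} [NormedAddCommGroup E] [InnerProductSpace ℂ E] (w x : E) :
    innerLeft w x = inner ℂ x w :=
  inner_conj_symm x w

theorem intervalIntegral_inner_left {E : Type*} [NormedAddCommGroup E] [InnerProductSpace ℂ E]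
    [CompleteSpace E] {f : ℝ → E} (hf : Continuous f) (w : E) (a b : ℝ) :
    ∫ s in a..b, inner ℂ (f s) w = inner ℂ (∫ s in a..b, f s) w := by
  have h := (innerLeft w).intervalIntegral_comp_comm (hf.intervalIntegrable (μ := volume) a b)
  simpa only [innerLeft_apply] using h

/-! ### Unitary groups and their generators -/

namespace UnitaryGroup

variable {E : Type*} [NormedAddCommGroup E] [InnerProductSpace ℂ E] (U : UnitaryGroup E)

theorem map_neg_apply (t : ℝ) (x : E) : U (-t) (U t x) = x := by
  have h := U.map_add' (-t) t x
  rw [neg_add_cancel, U.map_zero'] at h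
  exact h.symm

theorem apply_map_neg (t : ℝ) (x : E) : U t (U (-t) x) = x := by
  have h := U.map_neg_apply (-t) x
  rwa [neg_neg] at h

theorem inner_apply_left (t : ℝ) (x y : E) : inner ℂ (U t x) y = inner ℂ x (U (-t) y) := by
  rw [← (U (-t)).inner_map_map, map_neg_apply]

/-- Strong continuity upgrades to joint continuity because the maps are isometries. -/
theorem continuous_uncurry : Continuous fun p : ℝ × E => U p.1 p.2 := by
  refine continuous_iff_continuousAt.2 fun p => tendsto_iff_norm_sub_tendsto_zero.2 ?_
  have h1 : Tendsto (fun q : ℝ × E => ‖q.2 - p.2‖ + ‖U q.1 p.2 - U p.1 p.2‖) (𝓝 p) (𝓝 0) := by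
    have c : Continuous fun q : ℝ × E => ‖q.2 - p.2‖ + ‖U q.1 p.2 - U p.1 p.2‖ :=
      (continuous_snd.sub continuous_const).norm.add
        (((U.continuous' p.2).comp continuous_fst).sub continuous_const).norm
    simpa using c.tendsto p
  refine squeeze_zero (fun _ => norm_nonneg _) (fun q => ?_) h1
  calc ‖U q.1 q.2 - U p.1 p.2‖ = ‖U q.1 (q.2 - p.2) + (U q.1 p.2 - U p.1 p.2)‖ := by
        rw [map_sub]; abel_nf
    _ ≤ _ := (norm_add_le _ _).trans (by rw [LinearIsometryEquiv.norm_map])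

theorem hasDerivAt_of_mem {p : E × E} (hp : p ∈ U.generatorGraph) (t : ℝ) :
    HasDerivAt (fun s : ℝ => U s p.1) (-(I • U t p.2)) t := by
  have h1 : HasDerivAt (fun s : ℝ => U s p.1) (-(I • p.2)) (t - t) := by
    rw [sub_self]; exact hp
  have h2 := ((U t).toContinuousLinearEquiv.toContinuousLinearMap.restrictScalars ℝ).hasFDerivAt
    |>.comp_hasDerivAt t (h1.comp_sub_const t t)
  have h3 : (fun s : ℝ => U s p.1) = fun s => U t (U (s - t) p.1) := by
    funext s
    rw [← U.map_add', add_sub_cancel]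
  rw [h3]
  convert h2 using 1
  · rfl
  · exact (by simp : -(I • U t p.2) = U t (-(I • p.2)))

theorem apply_mem {p : E × E} (hp : p ∈ U.generatorGraph) (t : ℝ) :
    (U t p.1, U t p.2) ∈ U.generatorGraph := by
  have h := U.hasDerivAt_of_mem hp (0 + t)
  have h2 := h.comp_add_const 0 t
  simp only [U.map_add'] at h2
  change HasDerivAt (fun s : ℝ => U s (U t p.1)) (-(I • U t p.2)) 0
  simpa [U.map_zero'] using h2

/-- Time averages of orbits lie in the domain of the generator: by the group law, the evolution
merely shifts the interval of integration. -/
theorem mem_graph_integral [CompleteSpace E] (x : E) (h : ℝ) :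
    (∫ s in (0 : ℝ)..h, U s x, I • (U h x - x)) ∈ U.generatorGraph := by
  have e : ∀ t : ℝ, U t (∫ s in (0 : ℝ)..h, U s x) =
      (∫ s in (0 : ℝ)..(t + h), U s x) - ∫ s in (0 : ℝ)..t, U s x := by
    intro t
    have h1 := ((U t).toContinuousLinearEquiv.toContinuousLinearMap).intervalIntegral_comp_comm
      ((U.continuous' x).intervalIntegrable (μ := volume) 0 h)
    have h2 : U t (∫ s in (0 : ℝ)..h, U s x) = ∫ s in (0 : ℝ)..h, U (s + t) x := by
      refine Eq.trans h1.symm (intervalIntegral.integral_congr fun s _ => ?_)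
      rw [add_comm]
      exact (U.map_add' t s x).symm
    rw [h2, intervalIntegral.integral_comp_add_right (fun s => U s x), zero_add, add_comm h t,
      intervalIntegral.integral_interval_sub_left ((U.continuous' x).intervalIntegrable _ _)
        ((U.continuous' x).intervalIntegrable _ _)]
  have hd : ∀ t : ℝ, HasDerivAt (fun t => ∫ s in (0 : ℝ)..t, U s x) (U t x) t := fun t =>
    intervalIntegral.integral_hasDerivAt_right ((U.continuous' x).intervalIntegrable _ _)
      ((U.continuous' x).stronglyMeasurableAtFilter _ _) (U.continuous' x).continuousAt
  change HasDerivAt (fun t : ℝ => U t (∫ s in (0 : ℝ)..h, U s x)) _ 0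
  simp only [e]
  have h3 := ((hd (0 + h)).comp_add_const 0 h).sub (hd 0)
  convert h3 using 1
  · rfl
  · rw [smul_smul, Complex.I_mul_I, zero_add, U.map_zero']
    simp

/-- The domain is dense. A vector orthogonal to it is orthogonal to its own time averages, hence to
itself by differentiation at time `0`. -/
theorem eq_zero_of_inner_eq_zero [CompleteSpace E] {z : E}
    (h : ∀ p ∈ U.generatorGraph, inner ℂ z p.1 = 0) : z = 0 := by
  have h1 : ∀ t : ℝ, ∫ s in (0 : ℝ)..t, inner ℂ z (U s z) = 0 := by
    intro t
    have h2 := (innerSL ℂ z).intervalIntegral_comp_comm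
      ((U.continuous' z).intervalIntegrable (μ := volume) 0 t)
    exact h2.trans (h _ (U.mem_graph_integral z t))
  have hc : Continuous fun s => inner ℂ z (U s z) :=
    (innerSL ℂ z).continuous.comp (U.continuous' z)
  have h3 : HasDerivAt (fun t => ∫ s in (0 : ℝ)..t, inner ℂ z (U s z)) (inner ℂ z (U 0 z)) 0 :=
    intervalIntegral.integral_hasDerivAt_right (hc.intervalIntegrable _ _)
      (hc.stronglyMeasurableAtFilter _ _) hc.continuousAt
  simp only [h1] at h3
  have h4 := h3.unique (hasDerivAt_const 0 (0 : ℂ))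
  rw [U.map_zero'] at h4
  exact inner_self_eq_zero.1 h4

/-- A continuous weak solution of the Schrödinger equation is given by the unitary group. -/
theorem eq_apply_of_weak_solution [CompleteSpace E] {ψ : ℝ → E} (hψ : Continuous ψ)
    (h : ∀ p ∈ U.generatorGraph, ∀ t, 0 ≤ t →
      inner ℂ (ψ t - ψ 0) p.1 = I * inner ℂ (∫ s in (0 : ℝ)..t, ψ s) p.2) {t : ℝ} (ht : 0 ≤ t) :
    U t (ψ 0) = ψ t := by
  -- The pairing of `ψ s` with `U s p.1` is constant in `s`, as the derivatives from its two entries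
  -- cancel.
  have key : ∀ p ∈ U.generatorGraph, inner ℂ (ψ t) (U t p.1) = inner ℂ (ψ 0) p.1 := by
    intro p hp
    have c : Continuous fun q : ℝ × ℝ => inner ℂ (ψ q.2) (U q.1 p.2) :=
      (hψ.comp continuous_snd).inner ((U.continuous' p.2).comp continuous_fst)
    have h1 := diagonal_sub_eq_integral (T := t) (h := fun a b => inner ℂ (ψ b) (U a p.1))
      (h₁ := fun a b => -(I * inner ℂ (ψ b) (U a p.2)))
      (h₂ := fun a b => I * inner ℂ (ψ b) (U a p.2)) ht (continuous_const.mul c).neg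
      (continuous_const.mul c) ?_ ?_
    · simp only [neg_add_cancel, intervalIntegral.integral_zero] at h1
      simpa [U.map_zero', sub_eq_zero] using h1
    · intro a b v _ _ _
      have hd : ∀ s : ℝ, HasDerivAt (fun s => inner ℂ (ψ v) (U s p.1))
          (-(I * inner ℂ (ψ v) (U s p.2))) s := by
        intro s
        have := ((innerSL ℂ (ψ v)).restrictScalars ℝ).hasFDerivAt.comp_hasDerivAt s
          (U.hasDerivAt_of_mem hp s)
        simpa [inner_neg_right, inner_smul_right, Function.comp_def] using this
      refine (intervalIntegral.integral_eq_sub_of_hasDerivAt (fun s _ => hd s) ?_).symm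
      exact ((continuous_const.mul (c.comp (continuous_id.prodMk continuous_const :
        Continuous fun s : ℝ => (s, v)))).neg).intervalIntegrable _ _
    · intro a b u ha hab _
      have h2 : inner ℂ (ψ b - ψ a) (U u p.1) = I * inner ℂ (∫ s in a..b, ψ s) (U u p.2) := by
        have hb := h _ (U.apply_mem hp u) b (ha.trans hab)
        have ha' := h _ (U.apply_mem hp u) a ha
        have e : (∫ s in a..b, ψ s) = (∫ s in (0 : ℝ)..b, ψ s) - ∫ s in (0 : ℝ)..a, ψ s :=
          (intervalIntegral.integral_interval_sub_left (hψ.intervalIntegrable _ _)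
            (hψ.intervalIntegrable _ _)).symm
        have e' : ψ b - ψ a = (ψ b - ψ 0) - (ψ a - ψ 0) := by abel
        rw [e, e', inner_sub_left, inner_sub_left _ _ (U u p.2), hb, ha']
        ring
      rw [← inner_sub_left, h2, ← intervalIntegral_inner_left hψ, intervalIntegral.integral_const_mul]
  -- The difference is orthogonal to the dense domain.
  have h0 : U (-t) (ψ t) - ψ 0 = 0 := by
    refine U.eq_zero_of_inner_eq_zero fun p hp => ?_
    rw [inner_sub_left, inner_apply_left, neg_neg, key p hp, sub_self]
  rw [← sub_eq_zero.1 h0, apply_map_neg]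

end UnitaryGroup

/-- The identity is linear and continuous in the graph element, so it needs to be checked only on
elementary tensors. -/
theorem inner_eq_of_mem_closure_span {E : Type*} [NormedAddCommGroup E] [InnerProductSpace ℂ E]
    {X : Set (E × E)} {a b : E} (c : ℂ) (h : ∀ x ∈ X, inner ℂ a x.1 = c * inner ℂ b x.2)
    {x : E × E} (hx : x ∈ (Submodule.span ℂ X).topologicalClosure) :
    inner ℂ a x.1 = c * inner ℂ b x.2 := by
  set T : E × E →L[ℂ] ℂ := (innerSL ℂ a).comp (ContinuousLinearMap.fst ℂ E E) -
    c • (innerSL ℂ b).comp (ContinuousLinearMap.snd ℂ E E) with hT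
  have hT' : ∀ x, T x = inner ℂ a x.1 - c * inner ℂ b x.2 := fun x => by simp [hT]
  have h1 : (Submodule.span ℂ X).topologicalClosure ≤ LinearMap.ker T.toLinearMap := by
    refine Submodule.topologicalClosure_minimal _ (Submodule.span_le.2 fun y hy => ?_)
      T.isClosed_ker
    change T y = 0
    rw [hT', h y hy, sub_self]
  have h2 : T x = 0 := h1 hx
  rw [hT'] at h2
  exact sub_eq_zero.1 h2

/-! ### Matrix elements of the Hamiltonian with elementary tensors -/

namespace Model

variable {H : ℕ → Type u} [∀ j, NormedAddCommGroup (H j)] [∀ j, InnerProductSpace ℂ (H j)]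
  [∀ j, CompleteSpace (H j)] {ι : ℕ → Type w}
  {R : Type v} [NormedAddCommGroup R] [InnerProductSpace ℂ R] [CompleteSpace R]
  (S : Model H ι R)

/-- The real normed space structure of the tensor product, obtained by restriction of scalars. -/
instance (N : ℕ) : NormedSpace ℝ (TSpace ι R N) := NormedSpace.complexToReal

theorem continuous_free {N : ℕ} :
    Continuous fun p : ℝ × ((∀ j : Fin N, H j) × R) => S.free N p.1 p.2 := by
  refine (continuous_pi fun j => ?_).prodMk ?_
  · exact (S.particle j).continuous_uncurry.comp (continuous_fst.prodMk
      ((continuous_apply j).comp (continuous_fst.comp continuous_snd)))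
  · exact S.reservoir.continuous_uncurry.comp (continuous_fst.prodMk
      (continuous_snd.comp continuous_snd))

theorem hasDerivAt_inner_left {E : Type*} [NormedAddCommGroup E] [InnerProductSpace ℂ E]
    (U : UnitaryGroup E) {p : E × E} (hp : p ∈ U.generatorGraph) (y : E) (s : ℝ) :
    HasDerivAt (fun s => inner ℂ (U s y) p.1) (I * inner ℂ (U s y) p.2) s := by
  simp only [U.inner_apply_left]
  have h1 := (U.hasDerivAt_of_mem hp (-s)).scomp s (hasDerivAt_neg s)
  have h2 := ((innerSL ℂ y).restrictScalars ℝ).hasFDerivAt.comp_hasDerivAt s h1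
  simpa [inner_smul_right, Function.comp_def] using h2

theorem prod_inner_update {N : ℕ} (y φ : ∀ j : Fin N, H j) (j : Fin N) (z : H j) :
    ∏ i, inner ℂ (y i) (Function.update φ j z i) =
      (∏ i ∈ Finset.univ.erase j, inner ℂ (y i) (φ i)) * inner ℂ (y j) z := by
  rw [← Finset.prod_erase_mul _ _ (Finset.mem_univ j), Function.update_self]
  congr 1
  refine Finset.prod_congr rfl fun i hi => ?_
  rw [Function.update_of_ne (Finset.ne_of_mem_erase hi)]

/-- The tensor `y` need not lie in the domain of the free Hamiltonian. The derivatives are taken on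
the test vector, whose tensor factors do. -/
theorem inner_tens_free_sub {N : ℕ} {p : TSpace ι R N × TSpace ι R N} (hp : p ∈ S.freeGraph N)
    (y : (∀ j : Fin N, H j) × R) (a b : ℝ) :
    inner ℂ (S.tens (S.free N b y) - S.tens (S.free N a y)) p.1 =
      I * inner ℂ (∫ s in a..b, S.tens (S.free N s y)) p.2 := by
  have hc : Continuous fun s => S.tens (S.free N s y) :=
    S.continuous_tens.comp (S.continuous_free.comp (continuous_id.prodMk continuous_const))
  refine inner_eq_of_mem_closure_span I ?_ hp
  rintro _ ⟨φ, φ', χ, χ', hφ, hχ, rfl⟩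
  have hd : ∀ s : ℝ, HasDerivAt (fun s => inner ℂ (S.tens (S.free N s y)) (S.tens (φ, χ)))
      (I * inner ℂ (S.tens (S.free N s y))
        (∑ j, S.tens (Function.update φ j (φ' j), χ) + S.tens (φ, χ'))) s := by
    intro s
    simp only [inner_add_right, inner_sum, inner_tens, prod_inner_update]
    have h1 : HasDerivAt (fun s => ∏ j, inner ℂ ((S.free N s y).1 j) (φ j)) _ s :=
      HasDerivAt.fun_finsetProd fun j _ => hasDerivAt_inner_left (S.particle j) (hφ j) (y.1 j) s
    refine (h1.fun_mul (hasDerivAt_inner_left S.reservoir hχ y.2 s)).congr_deriv ?_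
    simp only [free, smul_eq_mul, Finset.mul_sum, Finset.sum_mul, mul_add]
    congr 1
    · exact Finset.sum_congr rfl fun j _ => by ring
    · ring
  rw [inner_sub_left, ← intervalIntegral_inner_left hc, ← intervalIntegral.integral_const_mul]
  exact (intervalIntegral.integral_eq_sub_of_hasDerivAt (fun s _ => hd s)
    ((continuous_const.mul (hc.inner continuous_const)).intervalIntegrable _ _)).symm

theorem extendZero_apply {T : R →ₗ.[ℂ] R} {x : R} (hx : x ∈ T.domain) :
    extendZero T x = T ⟨x, hx⟩ := by
  rw [extendZero, dif_pos hx]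

theorem inner_B {j : ℕ} {χ χ' x : R} (h : (χ, χ') ∈ (S.B j).graph) (hx : x ∈ (S.B j).domain) :
    inner ℂ (extendZero (S.B j) x) χ = inner ℂ x χ' := by
  obtain ⟨z, rfl, rfl⟩ := LinearPMap.mem_graph_iff _ |>.1 h
  have hsa := S.B_selfAdjoint j
  have h1 := LinearPMap.adjoint_isFormalAdjoint hsa.dense_domain
  rw [LinearPMap.isSelfAdjoint_def.1 hsa] at h1
  rw [extendZero_apply hx]
  exact h1 ⟨x, hx⟩ z

/-- Symmetry of `G_j` and `B_j` moves the interaction from the test vector onto the elementary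
tensor; this requires only the reservoir factor of the latter to lie in the domain of `B_j`. -/
theorem inner_tens_interaction {N : ℕ} {j : Fin N} {p : TSpace ι R N × TSpace ι R N}
    (hp : p ∈ S.interactionGraph N j) {y : (∀ j : Fin N, H j) × R} (hy : y.2 ∈ (S.B j).domain) :
    inner ℂ (S.tens (Function.update y.1 j (S.G j (y.1 j)), extendZero (S.B j) y.2)) p.1 =
      inner ℂ (S.tens y) p.2 := by
  rw [← one_mul (inner ℂ (S.tens y) p.2)]
  refine inner_eq_of_mem_closure_span 1 ?_ hp
  rintro _ ⟨φ, χ, χ', hχ, rfl⟩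
  have hG : inner ℂ (S.G j (y.1 j)) (φ j) = inner ℂ (y.1 j) (S.G j (φ j)) :=
    (ContinuousLinearMap.isSelfAdjoint_iff_isSymmetric.1 (S.G_selfAdjoint j)) _ _
  rw [inner_tens, inner_tens, one_mul, prod_inner_update, S.inner_B hχ hy,
    ← Finset.prod_erase_mul _ _ (Finset.mem_univ j)]
  simp only [Function.update_self, hG]
  congr 2
  refine Finset.prod_congr rfl fun i hi => ?_
  rw [Function.update_of_ne (Finset.ne_of_mem_erase hi)]

end Model

end MeanField

end

noncomputable section

namespace MeanField

open Filter Topology MeasureTheory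

universe u v w

theorem continuous_foldr {α Y : Type*} [TopologicalSpace α] [TopologicalSpace Y] {g : α → Y → Y}
    (hg : Continuous fun p : α × Y => g p.1 p.2) (y : Y) :
    Continuous fun l : List α => l.foldr g y := by
  refine continuous_iff_continuousAt.2 fun l => ?_
  induction l with
  | nil =>
    rw [ContinuousAt, nhds_nil]
    exact tendsto_pure_nhds _ []
  | cons a l ih =>
    rw [ContinuousAt, nhds_cons_eq_map, tendsto_map'_iff, nhds_prod_eq]
    have h1 : Tendsto (fun p : α × List α => (p.1, p.2.foldr g y)) (𝓝 a ×ˢ 𝓝 l)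
        (𝓝 (a, l.foldr g y)) := by
      rw [nhds_prod_eq]
      exact tendsto_fst.prodMk (ih.tendsto.comp tendsto_snd)
    exact hg.continuousAt.tendsto.comp h1

/-! ### Elementary tensors along a list of interactions -/

namespace Model

variable {H : ℕ → Type u} [∀ j, NormedAddCommGroup (H j)] [∀ j, InnerProductSpace ℂ (H j)]
  [∀ j, CompleteSpace (H j)] {ι : ℕ → Type w}
  {R : Type v} [NormedAddCommGroup R] [InnerProductSpace ℂ R] [CompleteSpace R]
  (S : Model H ι R)

/-- The list of letters and times, with negative times replaced by `0`. -/
def clampList {N : ℕ} (L : List (Fin N × ℝ)) : List (ℕ × ℝ) := L.map fun a => (a.1, max a.2 0)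

theorem nonneg_of_mem_clampList {N : ℕ} {L : List (Fin N × ℝ)} :
    ∀ a ∈ clampList L, 0 ≤ a.2 := by
  intro a ha
  obtain ⟨a', _, rfl⟩ := List.mem_map.1 ha
  exact le_max_right _ _

theorem length_clampList {N : ℕ} (L : List (Fin N × ℝ)) : (clampList L).length = L.length :=
  List.length_map _

theorem mem_clampList_of_mem_box {N : ℕ} {L : List (Fin N × ℝ)} {t : ℝ}
    (hL : ∀ a ∈ L, 0 ≤ a.2 ∧ a.2 ≤ t) : ∀ a ∈ clampList L, a.1 < N ∧ 0 ≤ a.2 ∧ a.2 ≤ t := by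
  intro a ha
  obtain ⟨a', ha', rfl⟩ := List.mem_map.1 ha
  have := hL a' ha'
  exact ⟨a'.1.2, le_max_right _ _, max_le this.2 (this.1.trans this.2)⟩

/-- The result of applying the operators `G_{j_1}(s_1) ⊗ B_{j_1}(s_1), …` for the list of the
`(j_i, s_i)`, with negative times replaced by `0`, to an elementary tensor. -/
def path {N : ℕ} (x : (∀ j : Fin N, H j) × R) (L : List (Fin N × ℝ)) : (∀ j : Fin N, H j) × R :=
  L.foldr (fun a y => S.GB N a.1 (max a.2 0) y) x

theorem path_cons {N : ℕ} (x : (∀ j : Fin N, H j) × R) (a : Fin N × ℝ) (L : List (Fin N × ℝ)) :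
    S.path x (a :: L) = S.GB N a.1 (max a.2 0) (S.path x L) := rfl

theorem path_snd {N : ℕ} (x : (∀ j : Fin N, H j) × R) (L : List (Fin N × ℝ)) :
    (S.path x L).2 = S.word (clampList L) x.2 := by
  induction L with
  | nil => rfl
  | cons a L ih =>
    rw [path_cons, GB, ih]
    rfl

theorem path_fst {N : ℕ} (x : (∀ j : Fin N, H j) × R) (L : List (Fin N × ℝ)) :
    (S.path x L).1 = L.foldr (fun a y => Function.update y a.1 (S.Gt a.1 (max a.2 0) (y a.1))) x.1 := by
  induction L with
  | nil => rfl
  | cons a L ih =>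
    rw [path_cons, GB, ih]
    rfl

theorem norm_G_le (j : ℕ) : ‖S.G j‖ ≤ S.g := le_ciSup S.G_bounded j

theorem g_nonneg : 0 ≤ S.g := (norm_nonneg _).trans (S.norm_G_le 0)

theorem norm_Gt_le (j : ℕ) (s : ℝ) (x : H j) : ‖S.Gt j s x‖ ≤ S.g * ‖x‖ := by
  rw [Gt, LinearIsometryEquiv.norm_map]
  refine ((S.G j).le_opNorm _).trans ?_
  rw [LinearIsometryEquiv.norm_map]
  exact mul_le_mul_of_nonneg_right (S.norm_G_le j) (norm_nonneg _)

theorem continuous_Gt (j : ℕ) : Continuous fun p : ℝ × H j => S.Gt j p.1 p.2 :=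
  (S.particle j).continuous_uncurry.comp (continuous_fst.neg.prodMk
    ((S.G j).continuous.comp (S.particle j).continuous_uncurry))

theorem prod_norm_path_le {N : ℕ} (x : (∀ j : Fin N, H j) × R) (L : List (Fin N × ℝ)) :
    ∏ j, ‖(S.path x L).1 j‖ ≤ S.g ^ L.length * ∏ j, ‖x.1 j‖ := by
  induction L with
  | nil => simp [path]
  | cons a L ih =>
    set y := S.path x L with hy
    have h1 : ∏ j, ‖(S.path x (a :: L)).1 j‖ ≤ S.g * ∏ j, ‖y.1 j‖ := by
      have h2 : ∏ j ∈ Finset.univ.erase a.1,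
          ‖Function.update y.1 a.1 (S.Gt a.1 (max a.2 0) (y.1 a.1)) j‖ =
          ∏ j ∈ Finset.univ.erase a.1, ‖y.1 j‖ := Finset.prod_congr rfl fun i hi => by
        rw [Function.update_of_ne (Finset.ne_of_mem_erase hi)]
      rw [path_cons, ← Finset.prod_erase_mul _ _ (Finset.mem_univ a.1),
        ← Finset.prod_erase_mul Finset.univ (fun j => ‖y.1 j‖) (Finset.mem_univ a.1)]
      simp only [GB, ← hy]
      rw [h2, Function.update_self]
      calc _ ≤ (∏ j ∈ Finset.univ.erase a.1, ‖y.1 j‖) * (S.g * ‖y.1 a.1‖) :=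
            mul_le_mul_of_nonneg_left (S.norm_Gt_le _ _ _)
              (Finset.prod_nonneg fun _ _ => norm_nonneg _)
        _ = _ := by ring
    refine h1.trans ?_
    rw [List.length_cons, pow_succ', mul_assoc]
    exact mul_le_mul_of_nonneg_left ih S.g_nonneg

theorem continuous_path_fst {N : ℕ} (x : (∀ j : Fin N, H j) × R) :
    Continuous fun L : List (Fin N × ℝ) => (S.path x L).1 := by
  simp only [path_fst]
  refine continuous_foldr (Y := ∀ j : Fin N, H j)
    (g := fun (a : Fin N × ℝ) y => Function.update y a.1 (S.Gt a.1 (max a.2 0) (y a.1))) ?_ x.1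
  have h : ∀ j : Fin N, Continuous fun p : ℝ × (∀ j : Fin N, H j) =>
      Function.update p.2 j (S.Gt j (max p.1 0) (p.2 j)) := fun j =>
    continuous_snd.update j ((S.continuous_Gt j).comp ((continuous_fst.max continuous_const).prodMk
      ((continuous_apply j).comp continuous_snd)))
  refine (Homeomorph.prodAssoc (Fin N) ℝ (∀ j : Fin N, H j)).symm.comp_continuous_iff'.1 ?_
  exact continuous_prod_of_discrete_left.2 h

/-- Regularity gives continuity only for nonnegative times. Clamping extends the functions
continuously to all times without changing them where they are integrated. -/
theorem continuous_list_of_continuousOn {E : Type*} [TopologicalSpace E] {N : ℕ}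
    {f : List (ℕ × ℝ) → E}
    (h : ∀ (r : ℕ) (j : Fin r → ℕ), ContinuousOn (fun s : Fin r → ℝ =>
      f (List.ofFn fun i => (j i, s i))) {s | ∀ i, 0 ≤ s i}) :
    Continuous fun L : List (Fin N × ℝ) => f (clampList L) := by
  refine continuous_list_iff_ofFn.2 fun r => ?_
  have h1 : ∀ j : Fin r → Fin N, Continuous fun s : Fin r → ℝ =>
      f (List.ofFn fun i => ((j i : ℕ), max (s i) 0)) := by
    intro j
    refine (h r fun i => j i).comp_continuous (f := fun (s : Fin r → ℝ) i => max (s i) 0) ?_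
      fun s i => le_max_right _ _
    fun_prop
  have h2 : Continuous fun p : (Fin r → Fin N) × (Fin r → ℝ) =>
      f (List.ofFn fun i => ((p.1 i : ℕ), max (p.2 i) 0)) := continuous_prod_of_discrete_left.2 h1
  have h3 := h2.comp (by fun_prop : Continuous fun x : Fin r → Fin N × ℝ =>
    ((fun i => (x i).1, fun i => (x i).2) : (Fin r → Fin N) × (Fin r → ℝ)))
  simpa only [clampList, List.map_ofFn, Function.comp_def] using h3

variable {S}

theorem continuous_path {AR : R →ₗ.[ℂ] R} (hreg : S.Regular AR) {N : ℕ} (φ : ∀ j : Fin N, H j)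
    (k : ℕ) : Continuous fun L : List (Fin N × ℝ) => S.path (φ, S.Ω k) L := by
  have h : Continuous fun L : List (Fin N × ℝ) => (S.path (φ, S.Ω k) L).2 := by
    simp only [path_snd]
    exact continuous_list_of_continuousOn (f := fun L => S.word L (S.Ω k))
      fun r j => hreg.continuous_B r j k
  exact (S.continuous_path_fst _).prodMk h

theorem continuous_extendZero_path {AR : R →ₗ.[ℂ] R} (hreg : S.Regular AR) {N : ℕ}
    (φ : ∀ j : Fin N, H j) (k : ℕ) {t : ℝ} (ht : 0 ≤ t) :
    Continuous fun L : List (Fin N × ℝ) =>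
      extendZero AR (S.reservoir t (S.path (φ, S.Ω k) L).2) := by
  have h : Continuous fun L : List (Fin N × ℝ) => S.reservoir t
      (S.ARt AR t (S.word (clampList L) (S.Ω k))) :=
    (S.reservoir t).continuous.comp (continuous_list_of_continuousOn
      (f := fun L => S.ARt AR t (S.word L (S.Ω k))) fun r j => hreg.continuous_A r j k t ht)
  simpa only [path_snd, ARt, UnitaryGroup.apply_map_neg] using h

theorem path_mem_domain_B {AR : R →ₗ.[ℂ] R} (hreg : S.Regular AR) {N : ℕ}
    (φ : ∀ j : Fin N, H j) (k : ℕ) (L : List (Fin N × ℝ)) (j : ℕ) {s : ℝ} (hs : 0 ≤ s) :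
    S.reservoir s (S.path (φ, S.Ω k) L).2 ∈ (S.B j).domain := by
  rw [path_snd]
  exact hreg.mem_B _ nonneg_of_mem_clampList j s hs k

theorem path_mem_domain_A {AR : R →ₗ.[ℂ] R} (hreg : S.Regular AR) {N : ℕ}
    (φ : ∀ j : Fin N, H j) (k : ℕ) (L : List (Fin N × ℝ)) {s : ℝ} (hs : 0 ≤ s) :
    S.reservoir s (S.path (φ, S.Ω k) L).2 ∈ AR.domain := by
  rw [path_snd]
  exact hreg.mem_A _ nonneg_of_mem_clampList s hs k

theorem sum_norm_sq_le_of_tsum_enorm_sq_le {K E : Type*} [NormedAddCommGroup E] {f : K → E} {C : ℝ}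
    (h : ∑' k, ‖f k‖ₑ ^ 2 ≤ ENNReal.ofReal (C ^ 2)) (F : Finset K) :
    ∑ k ∈ F, ‖f k‖ ^ 2 ≤ C ^ 2 := by
  have h1 : ENNReal.ofReal (∑ k ∈ F, ‖f k‖ ^ 2) ≤ ENNReal.ofReal (C ^ 2) := by
    rw [ENNReal.ofReal_sum_of_nonneg fun _ _ => by positivity]
    refine le_trans (le_of_eq (Finset.sum_congr rfl fun k _ => ?_)) ((ENNReal.sum_le_tsum F).trans h)
    rw [ENNReal.ofReal_pow (norm_nonneg _), ofReal_norm]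
  exact (ENNReal.ofReal_le_ofReal_iff (by positivity)).1 h1

theorem exists_sum_norm_path_le {AR : R →ₗ.[ℂ] R} (hreg : S.Regular AR) (N : ℕ) (T : ℝ) {ε : ℝ}
    (hε : 0 < ε) : ∃ C : ℝ, 0 ≤ C ∧ ∀ L : List (Fin N × ℝ), (∀ a ∈ L, 0 ≤ a.2 ∧ a.2 ≤ T) →
      ∀ (φ : ∀ j : Fin N, H j) (F : Finset ℕ), ∑ k ∈ F, ‖(S.path (φ, S.Ω k) L).2‖ ^ 2 ≤
        (C * ε ^ L.length * L.length.factorial) ^ 2 := by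
  obtain ⟨C, hC⟩ := hreg.growth_B N T ε hε
  refine ⟨|C|, abs_nonneg C, fun L hL φ F => ?_⟩
  have h := hC (clampList L) (mem_clampList_of_mem_box hL)
  have h2 := sum_norm_sq_le_of_tsum_enorm_sq_le h F
  simp only [path_snd]
  rw [length_clampList] at h2
  refine h2.trans (le_of_eq ?_)
  simp only [mul_pow, sq_abs]

theorem exists_sum_norm_extendZero_path_le {AR : R →ₗ.[ℂ] R} (hreg : S.Regular AR) (N : ℕ) (T : ℝ)
    {ε : ℝ} (hε : 0 < ε) : ∃ C : ℝ, 0 ≤ C ∧ ∀ L : List (Fin N × ℝ),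
      (∀ a ∈ L, 0 ≤ a.2 ∧ a.2 ≤ T) → ∀ t, 0 ≤ t → t ≤ T →
      ∀ (φ : ∀ j : Fin N, H j) (F : Finset ℕ),
        ∑ k ∈ F, ‖extendZero AR (S.reservoir t (S.path (φ, S.Ω k) L).2)‖ ^ 2 ≤
          (C * ε ^ L.length * L.length.factorial) ^ 2 := by
  obtain ⟨C, hC⟩ := hreg.growth_A N T ε hε
  refine ⟨|C|, abs_nonneg C, fun L hL t ht htT φ F => ?_⟩
  have h := hC (clampList L) (mem_clampList_of_mem_box hL) t ht htT
  have h2 := sum_norm_sq_le_of_tsum_enorm_sq_le h F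
  rw [length_clampList] at h2
  refine le_trans (le_of_eq (Finset.sum_congr rfl fun k _ => ?_)) (h2.trans (le_of_eq ?_))
  · rw [path_snd, ARt, LinearIsometryEquiv.norm_map]
  · simp only [mul_pow, sq_abs]

end Model

end MeanField

end

noncomputable section

namespace MeanField

open Filter Topology MeasureTheory

universe u v w

/-! ### The Dyson series -/

namespace Model

variable {H : ℕ → Type u} [∀ j, NormedAddCommGroup (H j)] [∀ j, InnerProductSpace ℂ (H j)]
  [∀ j, CompleteSpace (H j)] {ι : ℕ → Type w}
  {R : Type v} [NormedAddCommGroup R] [InnerProductSpace ℂ R] [CompleteSpace R]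
  (S : Model H ι R)

/-- The term of order `r` of the Dyson series, without powers of the coupling constant. -/
def dyson {N : ℕ} (x : (∀ j : Fin N, H j) × R) (r : ℕ) (t : ℝ) : TSpace ι R N :=
  orderedIntegral r t fun L => S.tens (S.free N t (S.path x L))

theorem continuous_tens_free : ∀ {N : ℕ},
    Continuous fun p : ℝ × ((∀ j : Fin N, H j) × R) => S.tens (S.free N p.1 p.2) :=
  S.continuous_tens.comp S.continuous_free

theorem norm_tens_free {N : ℕ} (t : ℝ) (y : (∀ j : Fin N, H j) × R) :
    ‖S.tens (S.free N t y)‖ = (∏ j, ‖y.1 j‖) * ‖y.2‖ := by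
  rw [norm_tens]
  simp only [free, LinearIsometryEquiv.norm_map]

variable {S}

section

variable {N : ℕ} {x : (∀ j : Fin N, H j) × R}

theorem continuous_tens_free_path (hx : Continuous fun L => S.path x L) {Y : Type*}
    [TopologicalSpace Y] {u : Y → ℝ} (hu : Continuous u) {l : Y → List (Fin N × ℝ)}
    (hl : Continuous l) : Continuous fun y => S.tens (S.free N (u y) (S.path x (l y))) := by
  have h : Continuous fun y => (u y, S.path x (l y)) := hu.prodMk (hx.comp hl)
  exact Continuous.comp (g := fun p => S.tens (S.free N p.1 p.2))
    (f := fun y => (u y, S.path x (l y))) S.continuous_tens_free h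

theorem continuous_dyson (hx : Continuous fun L => S.path x L) (r : ℕ) :
    Continuous fun t => S.dyson x r t :=
  continuous_orderedIntegral (continuous_tens_free_path hx continuous_fst continuous_snd) continuous_id

theorem inner_orderedIntegral_left {E : Type*} [NormedAddCommGroup E] [InnerProductSpace ℂ E]
    [CompleteSpace E] {r : ℕ} {t : ℝ} {f : List (Fin N × ℝ) → E} (hf : Continuous f) (w : E) :
    inner ℂ (orderedIntegral r t f) w = orderedIntegral r t fun L => inner ℂ (f L) w := by
  have h := ContinuousLinearMap.map_orderedIntegral (innerLeft w) (r := r) (t := t) hf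
  simpa only [innerLeft_apply] using h

theorem inner_orderedIntegral_right {E : Type*} [NormedAddCommGroup E] [InnerProductSpace ℂ E]
    [CompleteSpace E] {r : ℕ} {t : ℝ} {f : List (Fin N × ℝ) → E} (hf : Continuous f) (w : E) :
    inner ℂ w (orderedIntegral r t f) = orderedIntegral r t fun L => inner ℂ w (f L) :=
  ContinuousLinearMap.map_orderedIntegral ((innerSL ℂ w).restrictScalars ℝ) hf

theorem inner_dyson_zero_sub {p w₀ : TSpace ι R N}
    (h₀ : (p, w₀) ∈ S.freeGraph N) (T : ℝ) :
    inner ℂ (S.dyson x 0 T - S.dyson x 0 0) p =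
      I * inner ℂ (∫ s in (0 : ℝ)..T, S.dyson x 0 s) w₀ :=
  S.inner_tens_free_sub h₀ x 0 T

/-- At coinciding times the free evolution turns the evolved operators back into `G_j` and `B_j`,
the form in which the interaction appears in `H_N`. -/
theorem free_GB (s : ℝ) (j : Fin N) (y : (∀ j : Fin N, H j) × R) :
    S.free N s (S.GB N j s y) =
      (Function.update (S.free N s y).1 j (S.G j ((S.free N s y).1 j)),
        extendZero (S.B j) (S.free N s y).2) := by
  refine Prod.ext (funext fun i => ?_) (S.reservoir.apply_map_neg s _)
  by_cases hi : i = j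
  · subst hi
    simp only [free, GB, Function.update_self, Gt]
    exact (S.particle i).apply_map_neg s _
  · simp only [free, GB, Function.update_of_ne hi]

/-- The weak form of the recursion `i D_{r+1}' = H_0 D_{r+1} + ∑ G_j ⊗ B_j D_r`, where `D_r` is the
Dyson term without coupling constants, up to the power of `-i` that `hasSum_dyson` restores. -/
theorem inner_dyson_succ (hx : Continuous fun L => S.path x L)
    (hd : ∀ L (j : Fin N) (s : ℝ), 0 ≤ s → S.reservoir s (S.path x L).2 ∈ (S.B j).domain)
    {p w₀ : TSpace ι R N} {w : Fin N → TSpace ι R N}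
    (h₀ : (p, w₀) ∈ S.freeGraph N) (h : ∀ j, (p, w j) ∈ S.interactionGraph N j) (r : ℕ) {T : ℝ}
    (hT : 0 ≤ T) :
    inner ℂ (S.dyson x (r + 1) T) p =
      ∑ j, inner ℂ (∫ s in (0 : ℝ)..T, S.dyson x r s) (w j) +
        I * inner ℂ (∫ s in (0 : ℝ)..T, S.dyson x (r + 1) s) w₀ := by
  have ccons : ∀ j : Fin N, Continuous fun q : (ℝ × ℝ) × List (Fin N × ℝ) =>
      S.tens (S.free N q.1.2 (S.path x ((j, q.1.1) :: q.2))) := fun j =>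
    continuous_tens_free_path hx (continuous_snd.comp continuous_fst) ((continuous_cons_time j).comp
      ((continuous_fst.comp continuous_fst).prodMk continuous_snd))
  have cI : ∀ j : Fin N, Continuous fun q : ℝ × ℝ => orderedIntegral r q.1 fun L =>
      S.tens (S.free N q.2 (S.path x ((j, q.1) :: L))) := fun j =>
    continuous_orderedIntegral (Y := ℝ × ℝ)
      (f := fun q L => S.tens (S.free N q.2 (S.path x ((j, q.1) :: L)))) (ccons j) continuous_fst
  have cS : Continuous fun q : ℝ × ℝ => orderedIntegral (r + 1) q.1 fun L =>
      S.tens (S.free N q.2 (S.path x L)) :=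
    continuous_orderedIntegral (Y := ℝ × ℝ)
      (f := fun q L => S.tens (S.free N q.2 (S.path x L)))
      (continuous_tens_free_path hx (continuous_snd.comp continuous_fst) continuous_snd)
      continuous_fst
  have cR : ∀ v : ℝ, Continuous fun L : List (Fin N × ℝ) => S.tens (S.free N v (S.path x L)) :=
    fun v => continuous_tens_free_path hx continuous_const continuous_id
  -- The time enters twice, as the upper limit of the simplex (`a`) and in the free evolution (`b`).
  -- The derivative in `a` releases one interaction, the one in `b` the free Hamiltonian.
  have key := diagonal_sub_eq_integral (T := T)
    (h := fun a b => inner ℂ (orderedIntegral (r + 1) a fun L =>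
      S.tens (S.free N b (S.path x L))) p)
    (h₁ := fun s v => inner ℂ (∑ j, orderedIntegral r s fun L =>
      S.tens (S.free N v (S.path x ((j, s) :: L)))) p)
    (h₂ := fun u s => I * inner ℂ (orderedIntegral (r + 1) u fun L =>
      S.tens (S.free N s (S.path x L))) w₀) hT
    ((continuous_finsetSum _ fun j _ => cI j).inner continuous_const)
    (continuous_const.mul (cS.inner continuous_const)) ?_ ?_
  · have h2 : inner ℂ (S.dyson x (r + 1) 0) p = 0 := by
      rw [dyson, orderedIntegral_succ, intervalIntegral.integral_same, inner_zero_left]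
    have h3 : ∀ s, 0 ≤ s → inner ℂ (∑ j, orderedIntegral r s fun L =>
        S.tens (S.free N s (S.path x ((j, s) :: L)))) p = ∑ j, inner ℂ (S.dyson x r s) (w j) := by
      intro s hs
      rw [sum_inner]
      refine Finset.sum_congr rfl fun j _ => ?_
      rw [inner_orderedIntegral_left (continuous_comp_cons (cR s) j s), dyson,
        inner_orderedIntegral_left (cR s)]
      congr 1
      funext L
      rw [path_cons, max_eq_left hs, free_GB]
      exact S.inner_tens_interaction (h j) (hd L j s hs)
    have cD : ∀ r, Continuous fun t => S.dyson x r t := continuous_dyson hx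
    change inner ℂ (S.dyson x (r + 1) T) p - inner ℂ (S.dyson x (r + 1) 0) p = _ at key
    rw [h2, sub_zero] at key
    rw [key]
    calc _ = ∫ s in (0 : ℝ)..T, (∑ j, inner ℂ (S.dyson x r s) (w j) +
          I * inner ℂ (S.dyson x (r + 1) s) w₀) := by
          refine intervalIntegral.integral_congr fun s hs => ?_
          rw [Set.uIcc_of_le hT] at hs
          exact congrArg₂ (· + ·) (h3 s hs.1) rfl
      _ = _ := by
          rw [intervalIntegral.integral_add, intervalIntegral.integral_finsetSum,
            intervalIntegral.integral_const_mul, intervalIntegral_inner_left (cD (r + 1))]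
          · congr 1
            exact Finset.sum_congr rfl fun j _ => intervalIntegral_inner_left (cD r) _ _ _
          · exact fun j _ => ((cD r).inner continuous_const).intervalIntegrable _ _
          · exact (continuous_finsetSum _ fun j _ =>
              (cD r).inner continuous_const).intervalIntegrable _ _
          · exact (continuous_const.mul
              ((cD (r + 1)).inner continuous_const)).intervalIntegrable _ _
  · intro a b v _ _ _
    have c1 : Continuous fun s => ∑ j, orderedIntegral r s fun L =>
        S.tens (S.free N v (S.path x ((j, s) :: L))) :=
      continuous_finsetSum _ fun j _ => continuous_orderedIntegral_cons (cR v) j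
    rw [← inner_sub_left, orderedIntegral_succ, orderedIntegral_succ,
      intervalIntegral.integral_interval_sub_left (c1.intervalIntegrable _ _)
        (c1.intervalIntegrable _ _), intervalIntegral_inner_left c1]
  · intro a b u _ _ _
    have c2 : Continuous fun s => orderedIntegral (r + 1) u fun L =>
        S.tens (S.free N s (S.path x L)) := 
      continuous_orderedIntegral (f := fun s L => S.tens (S.free N s (S.path x L)))
        (continuous_tens_free_path hx continuous_fst continuous_snd) continuous_const
    have c3 : Continuous fun q : List (Fin N × ℝ) × ℝ => S.tens (S.free N q.2 (S.path x q.1)) :=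
      continuous_tens_free_path hx continuous_snd continuous_fst
    have c4 : Continuous fun L => ∫ s in a..b, S.tens (S.free N s (S.path x L)) :=
      intervalIntegral.continuous_parametric_intervalIntegral_of_continuous'
        (f := fun L s => S.tens (S.free N s (S.path x L))) c3 a b
    have c5 : Continuous fun L : List (Fin N × ℝ) =>
        S.tens (S.free N b (S.path x L)) - S.tens (S.free N a (S.path x L)) := (cR b).sub (cR a)
    rw [← inner_sub_left, ← orderedIntegral_sub (cR b) (cR a), inner_orderedIntegral_left c5,
      intervalIntegral.integral_const_mul, intervalIntegral_inner_left c2,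
      ← orderedIntegral_intervalIntegral c3, inner_orderedIntegral_left c4]
    simp only [S.inner_tens_free_sub h₀]
    have h5 := ContinuousLinearMap.map_orderedIntegral
      ((ContinuousLinearMap.mul ℂ ℂ I).restrictScalars ℝ) (r := r + 1) (t := u)
      (f := fun L => inner ℂ (∫ s in a..b, S.tens (S.free N s (S.path x L))) w₀)
      (c4.inner continuous_const)
    exact h5.symm

end

end Model

end MeanField

end

noncomputable section

namespace MeanField

open Filter Topology MeasureTheory

universe u v w

/-! ### Convergence of the Dyson series to the interacting evolution -/

namespace Model

variable {H : ℕ → Type u} [∀ j, NormedAddCommGroup (H j)] [∀ j, InnerProductSpace ℂ (H j)]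
  [∀ j, CompleteSpace (H j)] {ι : ℕ → Type w}
  {R : Type v} [NormedAddCommGroup R] [InnerProductSpace ℂ R] [CompleteSpace R]
  {S : Model H ι R}

/-- Regularity is used with `ε = δ / (N T g + 1)`, so that words, simplex volume and `g ^ r`
together cost at most `δ ^ r`. The summand `1` guards against a zero denominator. -/
theorem time_factor_le {N r : ℕ} {t T g δ : ℝ} (ht : 0 ≤ t) (htT : t ≤ T) (hg : 0 ≤ g)
    (hδ : 0 < δ) : (N * t) ^ r / r.factorial * (g ^ r * ((δ / (N * T * g + 1)) ^ r * r.factorial)) ≤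
      δ ^ r := by
  have hT : 0 ≤ T := ht.trans htT
  have h1 : (N * t) ^ r / r.factorial * (g ^ r * ((δ / (N * T * g + 1)) ^ r * r.factorial)) =
      (N * t * g * (δ / (N * T * g + 1))) ^ r := by
    have : (r.factorial : ℝ) ≠ 0 := by positivity
    simp only [mul_pow]
    field_simp
  rw [h1]
  refine pow_le_pow_left₀ (by positivity) ?_ r
  have h2 : N * t * g ≤ N * T * g + 1 := by
    have : N * t * g ≤ N * T * g := by gcongr
    linarith
  rw [mul_div_assoc', div_le_iff₀ (by positivity), mul_comm]
  gcongr

theorem norm_le_of_sum_sq_le {f : ℕ → R} {C : ℝ} (hC : 0 ≤ C)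
    (h : ∀ F : Finset ℕ, ∑ k ∈ F, ‖f k‖ ^ 2 ≤ C ^ 2) (k : ℕ) : ‖f k‖ ≤ C :=
  (sq_le_sq₀ (norm_nonneg _) hC).1 (by simpa using h {k})

theorem exists_norm_dyson_le {AR : R →ₗ.[ℂ] R} (hreg : S.Regular AR) (N : ℕ) (T : ℝ) {δ : ℝ}
    (hT : 0 ≤ T) (hδ : 0 < δ) : ∃ C : ℝ, 0 ≤ C ∧ ∀ (φ : ∀ j : Fin N, H j) (k r : ℕ) (t : ℝ), 0 ≤ t →
      t ≤ T → ‖S.dyson (φ, S.Ω k) r t‖ ≤ C * (∏ j, ‖φ j‖) * δ ^ r := by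
  have hg := S.g_nonneg
  have hε : 0 < δ / (N * T * S.g + 1) := by positivity
  obtain ⟨C, hC, h⟩ := exists_sum_norm_path_le hreg N T hε
  refine ⟨C, hC, fun φ k r t ht htT => ?_⟩
  have h1 := norm_orderedIntegral_le (r := r) (t := t) ht (continuous_tens_free_path
    (continuous_path hreg φ k) (continuous_const (y := t)) continuous_id)
    (M := (S.g ^ r * ∏ j, ‖φ j‖) * (C * (δ / (N * T * S.g + 1)) ^ r * r.factorial)) ?_
  · refine h1.trans ?_
    rw [Fintype.card_fin]
    calc _ = C * (∏ j, ‖φ j‖) * ((N * t) ^ r / r.factorial *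
          (S.g ^ r * ((δ / (N * T * S.g + 1)) ^ r * r.factorial))) := by ring
      _ ≤ _ := mul_le_mul_of_nonneg_left (time_factor_le ht htT hg hδ)
          (mul_nonneg hC (Finset.prod_nonneg fun _ _ => norm_nonneg _))
  · rintro L rfl hL
    rw [norm_tens_free]
    exact mul_le_mul (S.prod_norm_path_le _ _) (norm_le_of_sum_sq_le (by positivity)
      (h L (fun a ha => ⟨(hL a ha).1, (hL a ha).2.trans htT⟩) φ) k) (norm_nonneg _)
      (mul_nonneg (pow_nonneg hg _) (Finset.prod_nonneg fun _ _ => norm_nonneg _))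

theorem exists_summable_dyson {AR : R →ₗ.[ℂ] R} (hreg : S.Regular AR) {N : ℕ} (T : ℝ) (hT : 0 ≤ T)
    (φ : ∀ j : Fin N, H j) (k : ℕ) (c : ℂ) : ∃ u : ℕ → ℝ, Summable u ∧ ∀ r t, 0 ≤ t → t ≤ T →
      ‖c ^ r • S.dyson (φ, S.Ω k) r t‖ ≤ u r := by
  -- This choice gives `‖c‖ * δ ≤ 1 / 2`, hence a geometric majorant.
  obtain ⟨C, hC, h⟩ := exists_norm_dyson_le hreg N T (δ := 1 / (2 * (‖c‖ + 1))) hT (by positivity)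
  refine ⟨fun r => C * (∏ j, ‖φ j‖) * (1 / 2) ^ r,
    (summable_geometric_of_lt_one (by norm_num) (by norm_num)).mul_left _, fun r t ht htT => ?_⟩
  have hP : 0 ≤ C * ∏ j, ‖φ j‖ := mul_nonneg hC (Finset.prod_nonneg fun _ _ => norm_nonneg _)
  rw [norm_smul, norm_pow]
  calc ‖c‖ ^ r * ‖S.dyson (φ, S.Ω k) r t‖
      ≤ ‖c‖ ^ r * (C * (∏ j, ‖φ j‖) * (1 / (2 * (‖c‖ + 1))) ^ r) :=
        mul_le_mul_of_nonneg_left (h φ k r t ht htT) (by positivity)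
    _ = C * (∏ j, ‖φ j‖) * (‖c‖ * (1 / (2 * (‖c‖ + 1)))) ^ r := by rw [mul_pow]; ring
    _ ≤ _ := by
        refine mul_le_mul_of_nonneg_left (pow_le_pow_left₀ (by positivity) ?_ r) hP
        rw [mul_one_div, div_le_div_iff₀ (by positivity) (by norm_num)]
        linarith

theorem dyson_succ_zero {N : ℕ} (x : (∀ j : Fin N, H j) × R) (r : ℕ) : S.dyson x (r + 1) 0 = 0 := by
  rw [dyson, orderedIntegral_succ, intervalIntegral.integral_same]

theorem dyson_zero_zero {N : ℕ} (x : (∀ j : Fin N, H j) × R) : S.dyson x 0 0 = S.tens x := by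
  rw [dyson, orderedIntegral_zero]
  simp only [path, List.foldr_nil, free, UnitaryGroup.map_zero']

/-- The Dyson series converges to the interacting evolution. -/
theorem hasSum_dyson {AR : R →ₗ.[ℂ] R} (hreg : S.Regular AR) {N : ℕ} {lam : ℝ}
    {W : UnitaryGroup (TSpace ι R N)} (hW : S.IsPropagator lam N W) (φ : ∀ j : Fin N, H j) (k : ℕ)
    {t : ℝ} (ht : 0 ≤ t) :
    HasSum (fun r => (-(I * ((lam / Real.sqrt N : ℝ) : ℂ))) ^ r • S.dyson (φ, S.Ω k) r t)
      (W t (S.tens (φ, S.Ω k))) := by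
  set c : ℂ := -(I * ((lam / Real.sqrt N : ℝ) : ℂ)) with hc
  set x : (∀ j : Fin N, H j) × R := (φ, S.Ω k) with hx
  have hpath := continuous_path hreg φ k
  -- Clamping the time at `0` makes the candidate solution `ψ` continuous on the whole line.
  set u : ℕ → ℝ → TSpace ι R N := fun r s => c ^ r • S.dyson x r (max s 0) with hu
  set ψ : ℝ → TSpace ι R N := fun s => ∑' r, u r s with hψ
  have cD := continuous_dyson hpath
  have cu : ∀ r, Continuous (u r) := fun r =>
    ((cD r).comp (continuous_id.max continuous_const)).const_smul (c ^ r)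
  have hs : ∀ s, HasSum (fun r => u r s) (ψ s) := by
    intro s
    obtain ⟨v, hv, hle⟩ := exists_summable_dyson hreg (max s 0) (le_max_right _ _) φ k c
    exact (hv.of_norm_bounded fun r => hle r _ (le_max_right _ _) le_rfl).hasSum
  have cψ : Continuous ψ := by
    refine continuous_iff_continuousAt.2 fun s => ?_
    obtain ⟨v, hv, hle⟩ := exists_summable_dyson hreg (max (s + 1) 0) (le_max_right _ _) φ k c
    have h1 : ContinuousOn ψ (Set.Iio (s + 1)) :=
      continuousOn_tsum (fun r => (cu r).continuousOn) hv fun r s' hs' =>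
        hle r _ (le_max_right _ _) (max_le_max (le_of_lt hs') le_rfl)
    exact h1.continuousAt (Iio_mem_nhds (by linarith))
  have hint : ∀ T, 0 ≤ T → HasSum (fun r => ∫ s in (0 : ℝ)..T, u r s) (∫ s in (0 : ℝ)..T, ψ s) := by
    intro T hT
    obtain ⟨v, hv, hle⟩ := exists_summable_dyson hreg T hT φ k c
    refine intervalIntegral.hasSum_integral_of_dominated_convergence (fun r _ => v r)
      (fun r => (cu r).aestronglyMeasurable) (fun r => .of_forall fun s hs' => ?_)
      (.of_forall fun _ _ => hv) (by simp) (.of_forall fun s _ => hs s)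
    rw [Set.uIoc_of_le hT] at hs'
    exact hle r _ (le_max_right _ _) (max_le hs'.2 hT)
  have hui : ∀ r T, 0 ≤ T → ∫ s in (0 : ℝ)..T, u r s = c ^ r • ∫ s in (0 : ℝ)..T, S.dyson x r s := by
    intro r T hT
    have h1 := intervalIntegral.integral_smul (a := 0) (b := T) (μ := volume) (c ^ r)
      fun s => S.dyson x r s
    rw [← h1]
    refine intervalIntegral.integral_congr fun s hs' => ?_
    rw [Set.uIcc_of_le hT] at hs'
    simp only [hu, max_eq_left hs'.1]
  have hψ0 : ψ 0 = S.tens x := by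
    have h1 : HasSum (fun r => u r 0) (u 0 0) := hasSum_single 0 fun r hr => by
      obtain ⟨r, rfl⟩ := Nat.exists_eq_succ_of_ne_zero hr
      simp only [hu, max_self, Nat.succ_eq_add_one, dyson_succ_zero, smul_zero]
    rw [(hs 0).unique h1]
    simp only [hu, max_self, pow_zero, one_smul, dyson_zero_zero]
  have hweak : ∀ p ∈ W.generatorGraph, ∀ T, 0 ≤ T →
      inner ℂ (ψ T - ψ 0) p.1 = I * inner ℂ (∫ s in (0 : ℝ)..T, ψ s) p.2 := by
    intro p hp T hT
    rw [IsPropagator] at hW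
    rw [hW] at hp
    have hcl : IsClosed {p : TSpace ι R N × TSpace ι R N |
        inner ℂ (ψ T - ψ 0) p.1 = I * inner ℂ (∫ s in (0 : ℝ)..T, ψ s) p.2} :=
      isClosed_eq (continuous_const.inner continuous_fst)
        (continuous_const.mul (continuous_const.inner continuous_snd))
    -- The weak equation is a closed condition on the graph element, so the natural domain of `H_N`
    -- suffices.
    refine closure_minimal (fun q hq => ?_) hcl hp
    obtain ⟨w₀, w, h₀, h, hq2⟩ := hq
    have inner_hasSum : ∀ {f : ℕ → TSpace ι R N} {a : TSpace ι R N} (z : TSpace ι R N),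
        HasSum f a → HasSum (fun r => inner ℂ (f r) z) (inner ℂ a z) := by
      intro f a z hf
      have := hf.mapL (innerLeft z)
      simpa only [innerLeft_apply] using this
    have h1 : HasSum (fun r => inner ℂ (u r T - u r 0) q.1 -
        I * inner ℂ (∫ s in (0 : ℝ)..T, u r s) w₀)
        (inner ℂ (ψ T - ψ 0) q.1 - I * inner ℂ (∫ s in (0 : ℝ)..T, ψ s) w₀) :=
      (inner_hasSum _ ((hs T).sub (hs 0))).sub ((inner_hasSum w₀ (hint T hT)).mul_left I)
    have h2 : HasSum (fun r => (starRingEnd ℂ) c * ∑ j, inner ℂ (∫ s in (0 : ℝ)..T, u r s) (w j))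
        ((starRingEnd ℂ) c * ∑ j, inner ℂ (∫ s in (0 : ℝ)..T, ψ s) (w j)) :=
      (hasSum_sum fun j _ => inner_hasSum (w j) (hint T hT)).mul_left _
    have h3 := (hasSum_nat_add_iff' 1).2 h1
    -- The free equation fails at order `r + 1` exactly by the interaction applied at order `r`;
    -- summation over `r` yields the full equation.
    have h4 : (fun r => inner ℂ (u (r + 1) T - u (r + 1) 0) q.1 -
        I * inner ℂ (∫ s in (0 : ℝ)..T, u (r + 1) s) w₀) =
        fun r => (starRingEnd ℂ) c * ∑ j, inner ℂ (∫ s in (0 : ℝ)..T, u r s) (w j) := by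
      funext r
      have h5 := inner_dyson_succ hpath (fun L j s hs => path_mem_domain_B hreg φ k L j hs)
        h₀ h r hT
      rw [hui _ _ hT, hui _ _ hT]
      simp only [hu, max_self, max_eq_left hT, dyson_succ_zero, smul_zero, sub_zero,
        inner_smul_left, map_pow]
      rw [h5, ← Finset.mul_sum, pow_succ]
      ring
    rw [h4] at h3
    have h6 := h3.unique h2
    have h7 : inner ℂ (u 0 T - u 0 0) q.1 - I * inner ℂ (∫ s in (0 : ℝ)..T, u 0 s) w₀ = 0 := by
      have h8 := inner_dyson_zero_sub (x := x) h₀ T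
      rw [hui _ _ hT]
      simp only [hu, max_self, max_eq_left hT, pow_zero, one_smul]
      rw [h8, sub_self]
    rw [Finset.sum_range_one, h7, sub_zero] at h6
    have h9 : (starRingEnd ℂ) c = I * ((lam / Real.sqrt N : ℝ) : ℂ) := by
      rw [hc, map_neg, map_mul, Complex.conj_I, Complex.conj_ofReal]
      ring
    change inner ℂ (ψ T - ψ 0) q.1 = I * inner ℂ (∫ s in (0 : ℝ)..T, ψ s) q.2
    rw [hq2, inner_add_right, inner_smul_right, inner_sum, sub_eq_iff_eq_add.1 h6, h9]
    ring
  have h := W.eq_apply_of_weak_solution cψ hweak ht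
  rw [hψ0] at h
  rw [h]
  have h2 := hs t
  simp only [hu, max_eq_left ht] at h2
  exact h2

end Model

end MeanField

end

noncomputable section

namespace MeanField

open Filter Topology MeasureTheory

universe u v w

/-! ### The observable along the Dyson series -/

namespace Model

variable {H : ℕ → Type u} [∀ j, NormedAddCommGroup (H j)] [∀ j, InnerProductSpace ℂ (H j)]
  [∀ j, CompleteSpace (H j)] {ι : ℕ → Type w}
  {R : Type v} [NormedAddCommGroup R] [InnerProductSpace ℂ R] [CompleteSpace R]
  (S : Model H ι R)

/-- The observable applied to the free evolution of an elementary tensor. -/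
def obsFree {n N : ℕ} (h : n ≤ N) (AS : PSpace ι n →L[ℂ] PSpace ι n) (AR : R →ₗ.[ℂ] R) (t : ℝ)
    (y : (∀ j : Fin N, H j) × R) : TSpace ι R N :=
  S.obsVec h AS (S.free N t y).1 (extendZero AR (S.free N t y).2)

/-- The image under the observable of the term of order `r` of the Dyson series. -/
def obsDyson {n N : ℕ} (h : n ≤ N) (AS : PSpace ι n →L[ℂ] PSpace ι n) (AR : R →ₗ.[ℂ] R)
    (x : (∀ j : Fin N, H j) × R) (r : ℕ) (t : ℝ) : TSpace ι R N :=
  orderedIntegral r t fun L => S.obsFree h AS AR t (S.path x L)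

/-- The form of the free evolution of the observable on the vectors along two lists of
interactions. -/
def pathForm {n N : ℕ} (h : n ≤ N) (AS : PSpace ι n →L[ℂ] PSpace ι n) (AR : R →ₗ.[ℂ] R) (t : ℝ)
    (x : (∀ j : Fin N, H j) × R) (L L' : List (Fin N × ℝ)) : ℂ :=
  S.obsForm h AS AR t (S.path x L) (S.path x L')

theorem obsForm_eq_inner {n N : ℕ} (h : n ≤ N) (AS : PSpace ι n →L[ℂ] PSpace ι n)
    (AR : R →ₗ.[ℂ] R) (t : ℝ) (x y : (∀ j : Fin N, H j) × R) :
    S.obsForm h AS AR t x y = inner ℂ (S.tens (S.free N t x)) (S.obsFree h AS AR t y) := rfl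

theorem norm_obsFree_le {n N : ℕ} (h : n ≤ N) (AS : PSpace ι n →L[ℂ] PSpace ι n)
    (AR : R →ₗ.[ℂ] R) (t : ℝ) (y : (∀ j : Fin N, H j) × R) :
    ‖S.obsFree h AS AR t y‖ ≤
      ‖AS‖ * (∏ j, ‖y.1 j‖) * ‖extendZero AR (S.reservoir t y.2)‖ := by
  refine (S.norm_obsVec_le h AS _ _).trans ?_
  simp only [free, LinearIsometryEquiv.norm_map, le_refl]

theorem tens_obsFree_mem {n N : ℕ} (h : n ≤ N) (AS : PSpace ι n →L[ℂ] PSpace ι n)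
    (AR : R →ₗ.[ℂ] R) (t : ℝ) {y : (∀ j : Fin N, H j) × R} (hy : S.reservoir t y.2 ∈ AR.domain) :
    (S.tens (S.free N t y), S.obsFree h AS AR t y) ∈ S.observableGraph h AS AR := by
  refine Submodule.le_topologicalClosure _ (Submodule.subset_span ⟨_, (S.free N t y).1,
    (S.free N t y).2, extendZero AR (S.free N t y).2, ?_, Prod.ext (S.tens_eq h _) rfl⟩)
  rw [extendZero_apply (show (S.free N t y).2 ∈ AR.domain from hy)]
  exact LinearPMap.mem_graph AR ⟨_, hy⟩

theorem multiCommutator_eq_listCommutator {N r : ℕ} (j : Fin r → Fin N) {s : Fin r → ℝ}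
    (hs : ∀ i, 0 ≤ s i) (q : (∀ j : Fin N, H j) × R → (∀ j : Fin N, H j) × R → ℂ)
    (x : (∀ j : Fin N, H j) × R) :
    multiCommutator r (fun i => S.GB N (j i) (s i)) q x x =
      listCommutator (List.ofFn fun i => (j i, s i))
        (fun L L' => q (S.path x L) (S.path x L')) := by
  induction r generalizing q with
  | zero => rfl
  | succ r ih =>
    rw [multiCommutator, ih (fun i => j i.succ) fun i => hs i.succ, List.ofFn_succ, listCommutator]
    simp only [path_cons, max_eq_left (hs 0), formCommutator]

variable {S}

theorem continuous_obsFree_path {AR : R →ₗ.[ℂ] R} (hreg : S.Regular AR) {n N : ℕ} (h : n ≤ N)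
    (AS : PSpace ι n →L[ℂ] PSpace ι n) {t : ℝ} (ht : 0 ≤ t) (φ : ∀ j : Fin N, H j) (k : ℕ) :
    Continuous fun L : List (Fin N × ℝ) => S.obsFree h AS AR t (S.path (φ, S.Ω k) L) := by
  have h1 : Continuous fun L : List (Fin N × ℝ) => S.free N t (S.path (φ, S.Ω k) L) :=
    S.continuous_free.comp (continuous_const.prodMk (continuous_path hreg φ k))
  have h2 : Continuous fun L : List (Fin N × ℝ) => ((S.free N t (S.path (φ, S.Ω k) L)).1,
      extendZero AR (S.reservoir t (S.path (φ, S.Ω k) L).2)) :=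
    (continuous_fst.comp h1).prodMk (continuous_extendZero_path hreg φ k ht)
  exact Continuous.comp (g := fun p : (∀ j : Fin N, H j) × R => S.obsVec h AS p.1 p.2)
    (f := fun L : List (Fin N × ℝ) => ((S.free N t (S.path (φ, S.Ω k) L)).1,
      extendZero AR (S.reservoir t (S.path (φ, S.Ω k) L).2))) (S.continuous_obsVec h AS) h2

theorem continuous_pathForm {AR : R →ₗ.[ℂ] R} (hreg : S.Regular AR) {n N : ℕ} (h : n ≤ N)
    (AS : PSpace ι n →L[ℂ] PSpace ι n) {t : ℝ} (ht : 0 ≤ t) (φ : ∀ j : Fin N, H j) (k : ℕ) :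
    Continuous fun p : List (Fin N × ℝ) × List (Fin N × ℝ) =>
      S.pathForm h AS AR t (φ, S.Ω k) p.1 p.2 := by
  have h1 : Continuous fun p : List (Fin N × ℝ) × List (Fin N × ℝ) =>
      S.tens (S.free N t (S.path (φ, S.Ω k) p.1)) :=
    continuous_tens_free_path (continuous_path hreg φ k) continuous_const continuous_fst
  have h2 : Continuous fun p : List (Fin N × ℝ) × List (Fin N × ℝ) =>
      S.obsFree h AS AR t (S.path (φ, S.Ω k) p.2) :=
    Continuous.comp (g := fun L => S.obsFree h AS AR t (S.path (φ, S.Ω k) L)) (f := Prod.snd)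
      (continuous_obsFree_path hreg h AS ht φ k) continuous_snd
  exact h1.inner h2

theorem inner_dyson_obsDyson {AR : R →ₗ.[ℂ] R} (hreg : S.Regular AR) {n N : ℕ} (h : n ≤ N)
    (AS : PSpace ι n →L[ℂ] PSpace ι n) {t : ℝ} (ht : 0 ≤ t) (φ : ∀ j : Fin N, H j) (k : ℕ)
    (l l' : ℕ) :
    inner ℂ (S.dyson (φ, S.Ω k) l t) (S.obsDyson h AS AR (φ, S.Ω k) l' t) =
      doubleIntegral l l' t (S.pathForm h AS AR t (φ, S.Ω k)) := by
  have c1 : Continuous fun L : List (Fin N × ℝ) => S.tens (S.free N t (S.path (φ, S.Ω k) L)) :=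
    continuous_tens_free_path (continuous_path hreg φ k) continuous_const continuous_id
  rw [dyson, inner_orderedIntegral_left c1, doubleIntegral]
  congr 1
  funext L
  exact inner_orderedIntegral_right (continuous_obsFree_path hreg h AS ht φ k) _

/-- The integrands lie in the closed graph of the observable, which is a subspace; hence so do their
integrals. -/
theorem dyson_obsDyson_mem {AR : R →ₗ.[ℂ] R} (hreg : S.Regular AR) {n N : ℕ} (h : n ≤ N)
    (AS : PSpace ι n →L[ℂ] PSpace ι n) {t : ℝ} (ht : 0 ≤ t) (φ : ∀ j : Fin N, H j) (k r : ℕ) :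
    (S.dyson (φ, S.Ω k) r t, S.obsDyson h AS AR (φ, S.Ω k) r t) ∈ S.observableGraph h AS AR := by
  have c1 : Continuous fun L : List (Fin N × ℝ) => S.tens (S.free N t (S.path (φ, S.Ω k) L)) :=
    continuous_tens_free_path (continuous_path hreg φ k) continuous_const continuous_id
  have c2 := continuous_obsFree_path hreg h AS ht φ k
  have c3 : Continuous fun L : List (Fin N × ℝ) => (S.tens (S.free N t (S.path (φ, S.Ω k) L)),
    S.obsFree h AS AR t (S.path (φ, S.Ω k) L)) := c1.prodMk c2
  have h1 := orderedIntegral_mem (r := r) (t := t)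
    ((S.observableGraph h AS AR).restrictScalars ℝ)
    (Submodule.isClosed_topologicalClosure _) c3 fun L =>
      S.tens_obsFree_mem h AS AR t (path_mem_domain_A hreg φ k L ht)
  have h2 := ContinuousLinearMap.map_orderedIntegral (r := r) (t := t)
    (ContinuousLinearMap.fst ℝ (TSpace ι R N) (TSpace ι R N)) c3
  have h3 := ContinuousLinearMap.map_orderedIntegral (r := r) (t := t)
    (ContinuousLinearMap.snd ℝ (TSpace ι R N) (TSpace ι R N)) c3
  have h4 : (S.dyson (φ, S.Ω k) r t, S.obsDyson h AS AR (φ, S.Ω k) r t) =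
      orderedIntegral r t fun L : List (Fin N × ℝ) =>
        (S.tens (S.free N t (S.path (φ, S.Ω k) L)), S.obsFree h AS AR t (S.path (φ, S.Ω k) L)) :=
    Prod.ext h2.symm h3.symm
  rw [h4]
  exact h1

theorem exists_summable_obsDyson {AR : R →ₗ.[ℂ] R} (hreg : S.Regular AR) {n N : ℕ} (h : n ≤ N)
    (AS : PSpace ι n →L[ℂ] PSpace ι n) {t : ℝ} (ht : 0 ≤ t) (φ : ∀ j : Fin N, H j) (k : ℕ) (c : ℂ) :
    Summable fun r => c ^ r • S.obsDyson h AS AR (φ, S.Ω k) r t := by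
  have hg := S.g_nonneg
  set δ : ℝ := 1 / (2 * (‖c‖ + 1)) with hδ
  have hδ0 : 0 < δ := by positivity
  have hε : 0 < δ / (N * t * S.g + 1) := by positivity
  obtain ⟨C, hC, hC'⟩ := exists_sum_norm_extendZero_path_le hreg N t hε
  set P : ℝ := ‖AS‖ * ∏ j, ‖φ j‖ with hP
  have hP0 : 0 ≤ P := mul_nonneg (norm_nonneg _) (Finset.prod_nonneg fun _ _ => norm_nonneg _)
  have hb : ∀ r, ‖S.obsDyson h AS AR (φ, S.Ω k) r t‖ ≤ C * P * δ ^ r := by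
    intro r
    have h1 := norm_orderedIntegral_le (r := r) (t := t) ht (continuous_obsFree_path hreg h AS ht φ k)
      (M := (S.g ^ r * P) * (C * (δ / (N * t * S.g + 1)) ^ r * r.factorial)) ?_
    · refine h1.trans ?_
      rw [Fintype.card_fin]
      calc _ = C * P * ((N * t) ^ r / r.factorial *
            (S.g ^ r * ((δ / (N * t * S.g + 1)) ^ r * r.factorial))) := by ring
        _ ≤ _ := mul_le_mul_of_nonneg_left (time_factor_le ht le_rfl hg hδ0) (mul_nonneg hC hP0)
    · rintro L rfl hL
      refine (S.norm_obsFree_le h AS AR t _).trans ?_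
      refine mul_le_mul ?_ (norm_le_of_sum_sq_le (by positivity) (hC' L hL t ht le_rfl φ) k)
        (norm_nonneg _) (mul_nonneg (pow_nonneg hg _) hP0)
      calc _ ≤ ‖AS‖ * (S.g ^ L.length * ∏ j, ‖φ j‖) :=
            mul_le_mul_of_nonneg_left (S.prod_norm_path_le _ L) (norm_nonneg _)
        _ = _ := by rw [hP]; ring
  refine Summable.of_norm_bounded
    ((summable_geometric_of_lt_one (r := (1 / 2 : ℝ)) (by norm_num) (by norm_num)).mul_left (C * P))
    fun r => ?_
  rw [norm_smul, norm_pow]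
  calc ‖c‖ ^ r * _ ≤ ‖c‖ ^ r * (C * P * δ ^ r) := mul_le_mul_of_nonneg_left (hb r) (by positivity)
    _ = C * P * (‖c‖ * δ) ^ r := by rw [mul_pow]; ring
    _ ≤ _ := by
        refine mul_le_mul_of_nonneg_left (pow_le_pow_left₀ (by positivity) ?_ r) (mul_nonneg hC hP0)
        rw [hδ, mul_one_div, div_le_div_iff₀ (by positivity) (by norm_num)]
        linarith

theorem sum_prod_norm_sq_le {N : ℕ} (F : Finset (Fin N → ℕ)) :
    ∑ c ∈ F, (∏ j : Fin N, ‖S.ξ j (c j)‖) ^ 2 ≤ 1 := by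
  have h1 := hasSum_pi_prod (f := fun (j : Fin N) k => ((‖S.ξ j k‖ ^ 2 : ℝ) : ℂ)) fun j => by
    simpa using (S.ξ_trace j).summable
  have h2 : ∀ j : ℕ, ∑' k, ((‖S.ξ j k‖ ^ 2 : ℝ) : ℂ) = 1 := fun j => by
    rw [← Complex.ofReal_tsum, (S.ξ_trace j).tsum_eq, Complex.ofReal_one]
  simp only [h2, Finset.prod_const_one, ← Complex.ofReal_prod] at h1
  have h3 : HasSum (fun c : Fin N → ℕ => ∏ j : Fin N, ‖S.ξ j (c j)‖ ^ 2) 1 := by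
    rw [← Complex.ofReal_one] at h1
    exact Complex.hasSum_ofReal.1 h1
  simp only [← Finset.prod_pow]
  exact sum_le_hasSum F (fun c _ => Finset.prod_nonneg fun _ _ => sq_nonneg _) h3

/-- The sum over the vectors of the initial state of the absolute values of the matrix elements of
the observable, along two lists of interactions. -/
theorem exists_sum_norm_pathForm_le {AR : R →ₗ.[ℂ] R} (hreg : S.Regular AR) {n N : ℕ} (h : n ≤ N)
    (AS : PSpace ι n →L[ℂ] PSpace ι n) {t : ℝ} (ht : 0 ≤ t) {ε : ℝ} (hε : 0 < ε) :
    ∃ C : ℝ, 0 ≤ C ∧ ∀ L L' : List (Fin N × ℝ), (∀ a ∈ L, 0 ≤ a.2 ∧ a.2 ≤ t) →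
      (∀ a ∈ L', 0 ≤ a.2 ∧ a.2 ≤ t) → ∀ F : Finset ((Fin N → ℕ) × ℕ),
      ∑ k ∈ F, ‖S.pathForm h AS AR t (S.stateVec N k) L L'‖ ≤
        C * (S.g ^ L.length * (ε ^ L.length * L.length.factorial)) *
          (S.g ^ L'.length * (ε ^ L'.length * L'.length.factorial)) := by
  classical
  have hg := S.g_nonneg
  obtain ⟨C₁, hC₁, h₁⟩ := exists_sum_norm_path_le hreg N t hε
  obtain ⟨C₂, hC₂, h₂⟩ := exists_sum_norm_extendZero_path_le hreg N t hε
  refine ⟨‖AS‖ * C₁ * C₂, by positivity, fun L L' hL hL' F => ?_⟩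
  set φ₀ : ∀ j : Fin N, H j := fun _ => 0 with hφ₀
  -- The reservoir component does not depend on the particle vectors, which are replaced by the
  -- dummy `φ₀` in the sums over the reservoir index.
  have hsnd : ∀ (φ : ∀ j : Fin N, H j) k L, (S.path (φ, S.Ω k) L).2 = (S.path (φ₀, S.Ω k) L).2 := by
    intro φ k L
    rw [path_snd, path_snd]
  set a : ℕ → ℝ := fun k => ‖(S.path (φ₀, S.Ω k) L).2‖ with ha
  set b : ℕ → ℝ := fun k => ‖extendZero AR (S.reservoir t (S.path (φ₀, S.Ω k) L').2)‖ with hb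
  have hterm : ∀ k, ‖S.pathForm h AS AR t (S.stateVec N k) L L'‖ ≤
      ‖AS‖ * S.g ^ L.length * S.g ^ L'.length * ((∏ j : Fin N, ‖S.ξ j (k.1 j)‖) ^ 2 * (a k.2 * b k.2)) := by
    intro k
    rw [pathForm, obsForm_eq_inner]
    refine (norm_inner_le_norm _ _).trans ?_
    rw [norm_tens_free]
    have e1 := S.prod_norm_path_le (S.stateVec N k) L
    have e2 := S.prod_norm_path_le (S.stateVec N k) L'
    have e3 := S.norm_obsFree_le h AS AR t (S.path (S.stateVec N k) L')
    have p0 : 0 ≤ ∏ j, ‖(S.stateVec N k).1 j‖ := Finset.prod_nonneg fun _ _ => norm_nonneg _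
    have p1 : 0 ≤ ∏ j, ‖(S.path (S.stateVec N k) L').1 j‖ :=
      Finset.prod_nonneg fun _ _ => norm_nonneg _
    simp only [stateVec] at e1 e2 e3 p0 p1 ⊢
    rw [hsnd] at e3
    rw [hsnd]
    calc _ ≤ (S.g ^ L.length * ∏ j : Fin N, ‖S.ξ j (k.1 j)‖) * a k.2 *
          (‖AS‖ * (S.g ^ L'.length * ∏ j : Fin N, ‖S.ξ j (k.1 j)‖) * b k.2) := by
          refine mul_le_mul (mul_le_mul_of_nonneg_right e1 (norm_nonneg _)) (e3.trans ?_)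
            (norm_nonneg _) (by positivity)
          exact mul_le_mul_of_nonneg_right (mul_le_mul_of_nonneg_left e2 (norm_nonneg _))
            (norm_nonneg _)
      _ = _ := by ring
  -- Cauchy–Schwarz over the reservoir index, since regularity controls the two families of vectors
  -- only in the square-summable sense.
  have hab : ∑ k ∈ F.image Prod.snd, a k * b k ≤
      (C₁ * ε ^ L.length * L.length.factorial) * (C₂ * ε ^ L'.length * L'.length.factorial) := by
    refine abs_le_of_sq_le_sq' ?_ (by positivity) |>.2
    refine (Finset.sum_mul_sq_le_sq_mul_sq _ a b).trans ?_
    rw [mul_pow]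
    exact mul_le_mul (h₁ L hL φ₀ _) (h₂ L' hL' t ht le_rfl φ₀ _)
      (Finset.sum_nonneg fun _ _ => sq_nonneg _) (sq_nonneg _)
  calc ∑ k ∈ F, ‖S.pathForm h AS AR t (S.stateVec N k) L L'‖
      ≤ ∑ k ∈ F, ‖AS‖ * S.g ^ L.length * S.g ^ L'.length *
          ((∏ j : Fin N, ‖S.ξ j (k.1 j)‖) ^ 2 * (a k.2 * b k.2)) :=
        Finset.sum_le_sum fun k _ => hterm k
    -- Enlarging the index set to a rectangle separates the particle sum, at most `1`, from the
    -- reservoir sum.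
    _ ≤ ∑ k ∈ F.image Prod.fst ×ˢ F.image Prod.snd, ‖AS‖ * S.g ^ L.length * S.g ^ L'.length *
          ((∏ j : Fin N, ‖S.ξ j (k.1 j)‖) ^ 2 * (a k.2 * b k.2)) := by
        refine Finset.sum_le_sum_of_subset_of_nonneg (fun k hk => Finset.mem_product.2
          ⟨Finset.mem_image_of_mem _ hk, Finset.mem_image_of_mem _ hk⟩) fun _ _ _ => by positivity
    _ = ‖AS‖ * S.g ^ L.length * S.g ^ L'.length *
          ((∑ c ∈ F.image Prod.fst, (∏ j : Fin N, ‖S.ξ j (c j)‖) ^ 2) *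
            ∑ k ∈ F.image Prod.snd, a k * b k) := by
        rw [Finset.sum_mul_sum, ← Finset.mul_sum, Finset.sum_product]
    _ ≤ ‖AS‖ * S.g ^ L.length * S.g ^ L'.length * (1 *
          ((C₁ * ε ^ L.length * L.length.factorial) *
            (C₂ * ε ^ L'.length * L'.length.factorial))) := by
        refine mul_le_mul_of_nonneg_left (mul_le_mul (sum_prod_norm_sq_le _) hab
          (Finset.sum_nonneg fun _ _ => by positivity) zero_le_one) (by positivity)
    _ = _ := by ring

end Model

end MeanField

end

noncomputable section

namespace MeanField

open Filter Topology MeasureTheory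

universe u v w

/-! ### The perturbation series of the average -/

namespace Model

variable {H : ℕ → Type u} [∀ j, NormedAddCommGroup (H j)] [∀ j, InnerProductSpace ℂ (H j)]
  [∀ j, CompleteSpace (H j)] {ι : ℕ → Type w}
  {R : Type v} [NormedAddCommGroup R] [InnerProductSpace ℂ R] [CompleteSpace R]
  {S : Model H ι R} {AR : R →ₗ.[ℂ] R} {n N : ℕ}

theorem exists_sum_norm_doubleIntegral_le (hreg : S.Regular AR) (h : n ≤ N)
    (AS : PSpace ι n →L[ℂ] PSpace ι n) {t : ℝ} (ht : 0 ≤ t) {δ : ℝ} (hδ : 0 < δ) :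
    ∃ C : ℝ, 0 ≤ C ∧ ∀ (l l' : ℕ) (F : Finset ((Fin N → ℕ) × ℕ)),
      ∑ k ∈ F, ‖doubleIntegral l l' t (S.pathForm h AS AR t (S.stateVec N k))‖ ≤
        C * δ ^ l * δ ^ l' := by
  have hg := S.g_nonneg
  have hε : 0 < δ / (N * t * S.g + 1) := by positivity
  obtain ⟨C, hC, hC'⟩ := exists_sum_norm_pathForm_le hreg h AS ht hε
  set ε := δ / (N * t * S.g + 1) with hε'
  have hc : ∀ k, Continuous fun p : List (Fin N × ℝ) × List (Fin N × ℝ) =>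
      S.pathForm h AS AR t (S.stateVec N k) p.1 p.2 := fun k =>
    continuous_pathForm hreg h AS ht (fun j => S.ξ j (k.1 j)) k.2
  refine ⟨C, hC, fun l l' F => ?_⟩
  have h1 : ∀ L : List (Fin N × ℝ), L.length = l → (∀ a ∈ L, 0 ≤ a.2 ∧ a.2 ≤ t) →
      ∑ k ∈ F, ‖orderedIntegral l' t (S.pathForm h AS AR t (S.stateVec N k) L)‖ ≤
        (N * t) ^ l' / l'.factorial * (C * (S.g ^ l * (ε ^ l * l.factorial)) *
          (S.g ^ l' * (ε ^ l' * l'.factorial))) := by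
    rintro L rfl hL
    have h2 := sum_norm_orderedIntegral_le F (r := l') ht
      (f := fun k => S.pathForm h AS AR t (S.stateVec N k) L)
      (fun k => Continuous.comp
        (g := fun p : List (Fin N × ℝ) × List (Fin N × ℝ) =>
          S.pathForm h AS AR t (S.stateVec N k) p.1 p.2) (f := fun L' => (L, L')) (hc k)
        (continuous_const.prodMk continuous_id)) (M := C *
        (S.g ^ L.length * (ε ^ L.length * L.length.factorial)) *
          (S.g ^ l' * (ε ^ l' * l'.factorial))) (by
        rintro L' rfl hL'
        exact hC' L L' hL hL' F)
    rwa [Fintype.card_fin] at h2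
  have h3 := sum_norm_orderedIntegral_le F (r := l) ht
    (f := fun k L => orderedIntegral l' t (S.pathForm h AS AR t (S.stateVec N k) L))
    (fun k => continuous_orderedIntegral (hc k) continuous_const) h1
  rw [Fintype.card_fin] at h3
  refine h3.trans ?_
  have e1 := time_factor_le (N := N) (r := l) ht le_rfl hg hδ
  have e2 := time_factor_le (N := N) (r := l') ht le_rfl hg hδ
  calc _ = C * (((N * t) ^ l / l.factorial * (S.g ^ l * (ε ^ l * l.factorial))) *
        ((N * t) ^ l' / l'.factorial * (S.g ^ l' * (ε ^ l' * l'.factorial)))) := by ring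
    _ ≤ C * (δ ^ l * δ ^ l') :=
        mul_le_mul_of_nonneg_left (mul_le_mul e1 e2 (by positivity) (by positivity)) hC
    _ = _ := by ring

theorem exists_sum_norm_listCommutator_le (hreg : S.Regular AR) (h : n ≤ N)
    (AS : PSpace ι n →L[ℂ] PSpace ι n) {t : ℝ} (ht : 0 ≤ t) (r : ℕ) :
    ∃ M : ℝ, ∀ l : List (Fin N × ℝ), l.length = r → (∀ a ∈ l, 0 ≤ a.2 ∧ a.2 ≤ t) →
      ∀ F : Finset ((Fin N → ℕ) × ℕ),
        ∑ k ∈ F, ‖listCommutator l (S.pathForm h AS AR t (S.stateVec N k))‖ ≤ M := by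
  have hg := S.g_nonneg
  -- The choice of `ε` ensures `g * ε ≤ 1`. At fixed order a crude bound is enough.
  obtain ⟨C, hC, hC'⟩ := exists_sum_norm_pathForm_le hreg h AS ht
    (ε := 1 / (S.g + 1)) (by positivity)
  refine ⟨2 ^ r * (C * r.factorial * r.factorial), ?_⟩
  rintro l rfl hl F
  refine sum_norm_listCommutator_le F fun L L' hp => ?_
  have hlen : L.length + L'.length = l.length := by
    rw [← List.length_append]; exact hp.length_eq
  have hb : ∀ a ≤ l.length, S.g ^ a * ((1 / (S.g + 1)) ^ a * a.factorial) ≤ l.length.factorial := by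
    intro a ha
    rw [← mul_assoc, ← mul_pow]
    have h1 : (S.g * (1 / (S.g + 1))) ^ a ≤ 1 := by
      refine pow_le_one₀ (by positivity) ?_
      rw [mul_one_div, div_le_one (by positivity)]
      linarith
    calc _ ≤ 1 * (a.factorial : ℝ) := mul_le_mul_of_nonneg_right h1 (by positivity)
      _ ≤ _ := by
        rw [one_mul]
        exact_mod_cast Nat.factorial_le ha
  refine (hC' L L' (fun a ha => hl a (hp.subset (List.mem_append_left _ ha)))
    (fun a ha => hl a (hp.subset (List.mem_append_right _ ha))) F).trans ?_
  exact mul_le_mul (mul_le_mul_of_nonneg_left (hb _ (by omega)) hC) (hb _ (by omega))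
    (by positivity) (by positivity)

theorem hasSum_omegaT (hreg : S.Regular AR) (h : n ≤ N) (AS : PSpace ι n →L[ℂ] PSpace ι n) {t : ℝ}
    (ht : 0 ≤ t) {r : ℕ} (j : Fin r → Fin N) {s : Fin r → ℝ} (hs : ∀ i, 0 ≤ s i ∧ s i ≤ t) :
    HasSum (fun k => listCommutator (List.ofFn fun i => (j i, s i))
      (S.pathForm h AS AR t (S.stateVec N k))) (S.omegaT h AS AR t j s) := by
  obtain ⟨M, hM⟩ := exists_sum_norm_listCommutator_le hreg h AS ht r
  have h1 : Summable fun k => ‖listCommutator (List.ofFn fun i => (j i, s i))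
      (S.pathForm h AS AR t (S.stateVec N k))‖ :=
    summable_of_sum_le (fun _ => norm_nonneg _) (hM (List.ofFn fun i => (j i, s i))
      (List.length_ofFn) (by simpa [List.mem_ofFn] using hs))
  have h2 := h1.of_norm.hasSum
  have h3 : S.omegaT h AS AR t j s = ∑' k, listCommutator (List.ofFn fun i => (j i, s i))
      (S.pathForm h AS AR t (S.stateVec N k)) := by
    rw [omegaT, omega]
    exact tsum_congr fun k => S.multiCommutator_eq_listCommutator j (fun i => (hs i).1) _ _
  rw [h3]
  exact h2

theorem continuous_listCommutator_ofFn (hreg : S.Regular AR) (h : n ≤ N)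
    (AS : PSpace ι n →L[ℂ] PSpace ι n) {t : ℝ} (ht : 0 ≤ t) (k : (Fin N → ℕ) × ℕ) :
    Continuous fun L : List (Fin N × ℝ) =>
      listCommutator L (S.pathForm h AS AR t (S.stateVec N k)) :=
  continuous_listCommutator
    (continuous_pathForm hreg h AS ht (fun j => S.ξ j (k.1 j)) k.2)

theorem continuous_listCommutator_times (hreg : S.Regular AR) (h : n ≤ N)
    (AS : PSpace ι n →L[ℂ] PSpace ι n) {t : ℝ} (ht : 0 ≤ t) (k : (Fin N → ℕ) × ℕ) {r : ℕ}
    (j : Fin r → Fin N) : Continuous fun s : Fin r → ℝ =>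
      listCommutator (List.ofFn fun i => (j i, s i)) (S.pathForm h AS AR t (S.stateVec N k)) := by
  have h1 := (continuous_list_iff_ofFn.1 (continuous_listCommutator_ofFn hreg h AS ht k)) r
  exact h1.comp (by fun_prop : Continuous fun (s : Fin r → ℝ) i => (j i, s i))

theorem hasSum_iteratedIntegral_omegaT (hreg : S.Regular AR) (h : n ≤ N)
    (AS : PSpace ι n →L[ℂ] PSpace ι n) {t : ℝ} (ht : 0 ≤ t) {r : ℕ} (J : Finset (Fin r → Fin N)) :
    HasSum (fun k => iteratedIntegral r t fun s => ∑ j ∈ J,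
      listCommutator (List.ofFn fun i => (j i, s i)) (S.pathForm h AS AR t (S.stateVec N k)))
      (iteratedIntegral r t fun s => ∑ j ∈ J, S.omegaT h AS AR t j s) := by
  obtain ⟨M, hM⟩ := exists_sum_norm_listCommutator_le hreg h AS ht r
  refine hasSum_iteratedIntegral (M := ∑ _ ∈ J, M) ht (fun k => continuous_finsetSum _ fun j _ =>
    continuous_listCommutator_times hreg h AS ht k j) (fun s hs F => ?_)
    fun s hs => hasSum_sum fun j _ => hasSum_omegaT hreg h AS ht j hs
  calc _ ≤ ∑ k ∈ F, ∑ j ∈ J, ‖listCommutator (List.ofFn fun i => (j i, s i))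
        (S.pathForm h AS AR t (S.stateVec N k))‖ := Finset.sum_le_sum fun k _ => norm_sum_le _ _
    _ = ∑ j ∈ J, ∑ k ∈ F, ‖listCommutator (List.ofFn fun i => (j i, s i))
        (S.pathForm h AS AR t (S.stateVec N k))‖ := Finset.sum_comm
    _ ≤ _ := Finset.sum_le_sum fun j _ => hM (List.ofFn fun i => (j i, s i))
        (List.length_ofFn) (by simpa [List.mem_ofFn] using hs) F

/-- Additivity is obtained through the sum over the density matrix, whose individual terms are
continuous in the times. -/
theorem iteratedIntegral_sum_omegaT (hreg : S.Regular AR) (h : n ≤ N)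
    (AS : PSpace ι n →L[ℂ] PSpace ι n) {t : ℝ} (ht : 0 ≤ t) {r : ℕ} (J : Finset (Fin r → Fin N)) :
    (iteratedIntegral r t fun s => ∑ j ∈ J, S.omegaT h AS AR t j s) =
      ∑ j ∈ J, iteratedIntegral r t (S.omegaT h AS AR t j) := by
  refine (hasSum_iteratedIntegral_omegaT hreg h AS ht J).unique ?_
  have h1 : HasSum _ (∑ j ∈ J, iteratedIntegral r t (S.omegaT h AS AR t j)) :=
    hasSum_sum fun j _ => by simpa using hasSum_iteratedIntegral_omegaT hreg h AS ht {j}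
  refine HasSum.congr_fun h1 fun k => ?_
  exact iteratedIntegral_finset_sum J fun j _ => continuous_listCommutator_times hreg h AS ht k j

/-- The average of the observable in the interacting evolution is the sum of its perturbation
series. -/
theorem exists_hasAverage (hreg : S.Regular AR) (h : n ≤ N) (AS : PSpace ι n →L[ℂ] PSpace ι n)
    {lam : ℝ} {W : UnitaryGroup (TSpace ι R N)} (hW : S.IsPropagator lam N W) {t : ℝ} (ht : 0 ≤ t) :
    ∃ z, S.HasAverage h AS AR W t z ∧
      HasSum (fun r => (I * ((lam / Real.sqrt N : ℝ) : ℂ)) ^ r *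
        ∑ j : Fin r → Fin N, iteratedIntegral r t (S.omegaT h AS AR t j)) z := by
  set κ : ℂ := I * ((lam / Real.sqrt N : ℝ) : ℂ) with hκ
  set K := (Fin N → ℕ) × ℕ
  set F : K → List (Fin N × ℝ) → List (Fin N × ℝ) → ℂ := fun k =>
    S.pathForm h AS AR t (S.stateVec N k) with hF
  have hcκ : (starRingEnd ℂ) (-κ) = κ := by
    rw [hκ, map_neg, map_mul, Complex.conj_I, Complex.conj_ofReal]
    ring
  set w : K → TSpace ι R N := fun k =>
    ∑' r, (-κ) ^ r • S.obsDyson h AS AR (S.stateVec N k) r t with hw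
  have hψ : ∀ k : K, HasSum (fun r => (-κ) ^ r • S.dyson (S.stateVec N k) r t)
      (W t (S.tens (S.stateVec N k))) := fun k =>
    hasSum_dyson hreg hW (fun j => S.ξ j (k.1 j)) k.2 ht
  have hwk : ∀ k : K, HasSum (fun r => (-κ) ^ r • S.obsDyson h AS AR (S.stateVec N k) r t) (w k) :=
    fun k => (exists_summable_obsDyson hreg h AS ht (fun j => S.ξ j (k.1 j)) k.2 (-κ)).hasSum
  -- All contributions, indexed by the vector of the density matrix and the two Dyson orders. Since
  -- `κ` is imaginary, conjugation in the left entry turns `-κ` into `κ`.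
  set f : K × ℕ × ℕ → ℂ := fun q =>
    κ ^ q.2.1 * (-κ) ^ q.2.2 * doubleIntegral q.2.1 q.2.2 t (F q.1) with hf
  have hfin : ∀ k l l', inner ℂ ((-κ) ^ l • S.dyson (S.stateVec N k) l t)
      ((-κ) ^ l' • S.obsDyson h AS AR (S.stateVec N k) l' t) = f (k, l, l') := by
    intro k l l'
    have h1 := inner_dyson_obsDyson hreg h AS ht (fun j => S.ξ j (k.1 j)) k.2 l l'
    rw [inner_smul_left, inner_smul_right, map_pow, hcκ]
    simp only [hf, hF]
    rw [← mul_assoc]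
    exact congrArg _ h1
  have hfs : Summable f := by
    set δ : ℝ := 1 / (2 * (‖κ‖ + 1)) with hδ
    obtain ⟨C, hC, hle⟩ := exists_sum_norm_doubleIntegral_le hreg h AS ht
      (δ := δ) (by positivity)
    have hκδ : ‖κ‖ * δ ≤ 1 / 2 := by
      rw [hδ, mul_one_div, div_le_div_iff₀ (by positivity) (by norm_num)]
      linarith
    have hgeo : Summable fun l : ℕ => (1 / 2 : ℝ) ^ l :=
      summable_geometric_of_lt_one (by norm_num) (by norm_num)
    have hprod : Summable fun p : ℕ × ℕ => C * ((1 / 2 : ℝ) ^ p.1 * (1 / 2) ^ p.2) :=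
      (hgeo.mul_of_nonneg hgeo (fun _ => by positivity) (fun _ => by positivity)).mul_left C
    have hk : ∀ (p : ℕ × ℕ) (F' : Finset K), ∑ k ∈ F', ‖f (k, p)‖ ≤
        C * ((1 / 2 : ℝ) ^ p.1 * (1 / 2) ^ p.2) := by
      intro p F'
      simp only [hf, norm_mul, norm_pow, norm_neg]
      rw [← Finset.mul_sum]
      calc _ ≤ ‖κ‖ ^ p.1 * ‖κ‖ ^ p.2 * (C * δ ^ p.1 * δ ^ p.2) :=
            mul_le_mul_of_nonneg_left (hle p.1 p.2 F') (by positivity)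
        _ = C * ((‖κ‖ * δ) ^ p.1 * (‖κ‖ * δ) ^ p.2) := by rw [mul_pow, mul_pow]; ring
        _ ≤ _ := by
            have hκδ0 : 0 ≤ ‖κ‖ * δ := by positivity
            refine mul_le_mul_of_nonneg_left (mul_le_mul (pow_le_pow_left₀ hκδ0 hκδ _)
              (pow_le_pow_left₀ hκδ0 hκδ _) (by positivity) (by positivity)) hC
    -- The available bounds are sums over the density matrix at fixed orders, so that sum is taken
    -- innermost.
    have hsw : Summable fun q : (ℕ × ℕ) × K => ‖f (q.2, q.1)‖ := by
      refine (summable_prod_of_nonneg fun _ => norm_nonneg _).2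
        ⟨fun p => summable_of_sum_le (fun _ => norm_nonneg _) (hk p), ?_⟩
      exact Summable.of_nonneg_of_le (fun p => tsum_nonneg fun _ => norm_nonneg _)
        (fun p => Real.tsum_le_of_sum_le (fun _ => norm_nonneg _) (hk p)) hprod
    exact ((Equiv.prodComm (ℕ × ℕ) K).summable_iff (f := fun q => ‖f q‖)).1 hsw |>.of_norm
  obtain ⟨z, hz⟩ := hfs
  refine ⟨z, ⟨w, fun k => ?_, ?_⟩, ?_⟩
  · have h1 := (hψ k).prodMk (hwk k)
    refine (Submodule.isClosed_topologicalClosure _).mem_of_tendsto h1 (.of_forall fun s => ?_)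
    refine Submodule.sum_mem (S.observableGraph h AS AR) fun r _ => ?_
    exact Submodule.smul_mem _ _ (dyson_obsDyson_mem hreg h AS ht (fun j => S.ξ j (k.1 j)) k.2 r)
  -- Grouped by `k`, the total is the average in the evolved state.
  · refine hz.prod_fiberwise fun k => ?_
    have h1 : Summable fun p : ℕ × ℕ => f (k, p) :=
      hz.summable.comp_injective (Prod.mk_right_injective k)
    have h2 : ∀ l, HasSum (fun l' => f (k, l, l'))
        (inner ℂ ((-κ) ^ l • S.dyson (S.stateVec N k) l t) (w k)) := by
      intro l
      have h3 := (hwk k).mapL (innerSL ℂ ((-κ) ^ l • S.dyson (S.stateVec N k) l t))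
      refine HasSum.congr_fun h3 fun l' => ?_
      exact (hfin k l l').symm
    have h4 : HasSum (fun l => inner ℂ ((-κ) ^ l • S.dyson (S.stateVec N k) l t) (w k))
        (inner ℂ (W t (S.tens (S.stateVec N k))) (w k)) := by
      have h5 := (hψ k).mapL (innerLeft (w k))
      simpa only [innerLeft_apply] using h5
    have h6 := h1.hasSum.prod_fiberwise h2
    rw [← h6.unique h4]
    exact h1.hasSum
  -- Grouped by the total order `l + l'`, the same total is the perturbation series.
  · have hz' : HasSum (fun q : (ℕ × ℕ) × K => f (q.2, q.1)) z :=
      (Equiv.prodComm (ℕ × ℕ) K).hasSum_iff.2 hz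
    have hp : ∀ p : ℕ × ℕ, HasSum (fun k => f (k, p)) (∑' k, f (k, p)) := fun p =>
      (hz'.summable.comp_injective (Prod.mk_right_injective p)).hasSum
    have h1 := hz'.prod_fiberwise hp
    have h2 := (Finset.HasAntidiagonal.sigmaAntidiagonalEquivProd (A := ℕ)).hasSum_iff.2 h1
    refine h2.sigma fun r => ?_
    have h3 : HasSum (fun k => ∑ p ∈ Finset.HasAntidiagonal.antidiagonal r, f (k, p))
        (∑ p ∈ Finset.HasAntidiagonal.antidiagonal r, ∑' k, f (k, p)) :=
      hasSum_sum fun p _ => hp p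
    have h4 : HasSum (fun k => ∑ p ∈ Finset.HasAntidiagonal.antidiagonal r, f (k, p))
        (κ ^ r * ∑ j : Fin r → Fin N, iteratedIntegral r t (S.omegaT h AS AR t j)) := by
      rw [← iteratedIntegral_sum_omegaT hreg h AS ht]
      refine HasSum.congr_fun ((hasSum_iteratedIntegral_omegaT hreg h AS ht
        Finset.univ).mul_left (κ ^ r)) fun k => ?_
      have h5 := iteratedIntegral_ofFn (r := r) (t := t)
        (continuous_listCommutator_ofFn hreg h AS ht k)
      have h6 : (orderedIntegral r t fun L => listCommutator L (F k)) =
          ∑ p ∈ Finset.HasAntidiagonal.antidiagonal r,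
            (-1) ^ p.2 * doubleIntegral p.1 p.2 t (F k) :=
        orderedIntegral_listCommutator
          (continuous_pathForm hreg h AS ht (fun j => S.ξ j (k.1 j)) k.2) r ht
      rw [h5, h6, Finset.mul_sum]
      refine Finset.sum_congr rfl fun p hp => ?_
      rw [← Finset.HasAntidiagonal.mem_antidiagonal.1 hp]
      simp only [hf]
      -- The sign `(-1) ^ l'` from the right Dyson factor is the one in the shuffle identity.
      rw [neg_pow κ, pow_add]
      ring
    rw [← h3.unique h4, ← Finset.sum_coe_sort]
    exact hasSum_fintype _

end Model

end MeanField

end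

noncomputable section

namespace MeanField

open Filter Topology MeasureTheory

universe u v w

/-! ### Factorization over the particles -/

namespace Model

variable {H : ℕ → Type u} [∀ j, NormedAddCommGroup (H j)] [∀ j, InnerProductSpace ℂ (H j)]
  [∀ j, CompleteSpace (H j)] {ι : ℕ → Type w}
  {R : Type v} [NormedAddCommGroup R] [InnerProductSpace ℂ R] [CompleteSpace R]
  (S : Model H ι R) {AR : R →ₗ.[ℂ] R} {n N : ℕ}

/-- The times at which a list of interactions involves the particle `j`. -/
def timesOf (j : Fin N) (L : List (Fin N × ℝ)) : List ℝ :=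
  (L.filter fun a => a.1 = j).map fun a => max a.2 0

theorem count_ofFn {α : Type*} [DecidableEq α] {r : ℕ} (j : Fin r → α) (i : α) :
    (List.ofFn j).count i = (Finset.univ.filter fun a => j a = i).card := by
  rw [List.ofFn_eq_map, List.count, List.countP_map, List.countP_eq_length_filter, Fin.univ_def]
  simp only [Finset.filter, Finset.card, Multiset.filter_coe, Multiset.coe_card]
  exact congrArg List.length (List.filter_congr fun a _ => by simp [beq_eq_decide])

theorem length_timesOf (j : Fin N) (L : List (Fin N × ℝ)) :
    (timesOf j L).length = (L.map Prod.fst).count j := by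
  rw [timesOf, List.length_map, ← List.countP_eq_length_filter, List.count, List.countP_map]
  exact List.countP_congr fun a _ => by simp

theorem mem_timesOf {j : Fin N} {L : List (Fin N × ℝ)} {t : ℝ}
    (hL : ∀ a ∈ L, 0 ≤ a.2 ∧ a.2 ≤ t) : ∀ s ∈ timesOf j L, 0 ≤ s ∧ s ≤ t := by
  intro s hs
  obtain ⟨a, ha, rfl⟩ := List.mem_map.1 hs
  have := hL a (List.mem_of_mem_filter ha)
  exact ⟨le_max_right _ _, max_le this.2 (this.1.trans this.2)⟩

theorem path_fst_apply (x : (∀ j : Fin N, H j) × R) (L : List (Fin N × ℝ)) (j : Fin N) :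
    (S.path x L).1 j = S.wordG j (timesOf j L) (x.1 j) := by
  induction L with
  | nil => rfl
  | cons a L ih =>
    rw [path_cons]
    simp only [GB]
    by_cases hj : a.1 = j
    · subst hj
      rw [Function.update_self, ih, timesOf, timesOf, List.filter_cons_of_pos (by simp)]
      rfl
    · rw [Function.update_of_ne (Ne.symm hj), ih, timesOf, timesOf,
        List.filter_cons_of_neg (by simpa using hj)]

theorem norm_wordG_le (j : ℕ) (l : List ℝ) (x : H j) :
    ‖S.wordG j l x‖ ≤ S.g ^ l.length * ‖x‖ := by
  induction l with
  | nil => simp [wordG]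
  | cons s l ih =>
    rw [List.length_cons, pow_succ', mul_assoc]
    exact (S.norm_Gt_le j s _).trans (mul_le_mul_of_nonneg_left ih S.g_nonneg)

theorem inner_Gt_left (j : ℕ) (s : ℝ) (x y : H j) :
    inner ℂ (S.Gt j s x) y = inner ℂ x (S.Gt j s y) := by
  have h := (ContinuousLinearMap.isSelfAdjoint_iff_isSymmetric.1 (S.G_selfAdjoint j))
    (S.particle j s x) (S.particle j s y)
  rw [Gt, UnitaryGroup.inner_apply_left, neg_neg]
  refine Eq.trans h ?_
  rw [UnitaryGroup.inner_apply_left]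
  rfl

theorem inner_wordG_wordG (j : ℕ) (l l' : List ℝ) (x y : H j) :
    inner ℂ (S.wordG j l x) (S.wordG j l' y) = inner ℂ x (S.wordG j (l.reverse ++ l') y) := by
  induction l generalizing l' with
  | nil => rfl
  | cons s l ih =>
    have h1 : S.wordG j (s :: l) x = S.Gt j s (S.wordG j l x) := rfl
    rw [h1, inner_Gt_left]
    have h2 := ih (s :: l')
    rw [List.reverse_cons, List.append_assoc]
    exact h2

theorem summable_norm_inner_wordG (j : ℕ) (l l' : List ℝ) :
    Summable fun k => ‖inner ℂ (S.wordG j l (S.ξ j k)) (S.wordG j l' (S.ξ j k))‖ := by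
  refine Summable.of_nonneg_of_le (fun _ => norm_nonneg _) (fun k => ?_)
    ((S.ξ_trace j).summable.mul_left (S.g ^ l.length * S.g ^ l'.length))
  refine (norm_inner_le_norm _ _).trans ((mul_le_mul (S.norm_wordG_le j l _)
    (S.norm_wordG_le j l' _) (norm_nonneg _)
    (mul_nonneg (pow_nonneg S.g_nonneg _) (norm_nonneg _))).trans (le_of_eq ?_))
  ring

/-- The contribution of the first `n` particles to the matrix elements of the observable. -/
def headForm (h : n ≤ N) (AS : PSpace ι n →L[ℂ] PSpace ι n) (t : ℝ) (L L' : List (Fin N × ℝ))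
    (c : Fin n → ℕ) : ℂ :=
  inner ℂ
    (pureTensor S.basis n fun i =>
      S.particle i t (S.wordG i (timesOf (Fin.castLE h i) L) (S.ξ i (c i))))
    (AS (pureTensor S.basis n fun i =>
      S.particle i t (S.wordG i (timesOf (Fin.castLE h i) L') (S.ξ i (c i)))))

/-- The contribution of the reservoir to the matrix elements of the observable. -/
def resForm (AR : R →ₗ.[ℂ] R) (t : ℝ) (L L' : List (Fin N × ℝ)) (k : ℕ) : ℂ :=
  inner ℂ (S.word (clampList L) (S.Ω k)) (S.ARt AR t (S.word (clampList L') (S.Ω k)))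

/-- The contribution of the particles to the matrix elements of the observable. -/
def particleForm (h : n ≤ N) (AS : PSpace ι n →L[ℂ] PSpace ι n) (t : ℝ) (L L' : List (Fin N × ℝ))
    (c : Fin N → ℕ) : ℂ :=
  S.headForm h AS t L L' (fun i => c (Fin.castLE h i)) *
    ∏ j : {j : Fin N // n ≤ (j : ℕ)}, inner ℂ (S.wordG j (timesOf j.1 L) (S.ξ j (c j)))
      (S.wordG j (timesOf j.1 L') (S.ξ j (c j)))

/-- For product states and interactions of the form `G_j ⊗ B_j`, matrix elements factorize; only the
first `n` particles remain coupled, through `A_S`. The free evolution drops out for the others by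
unitarity. -/
theorem pathForm_stateVec (h : n ≤ N) (AS : PSpace ι n →L[ℂ] PSpace ι n) (t : ℝ)
    (L L' : List (Fin N × ℝ)) (k : (Fin N → ℕ) × ℕ) :
    S.pathForm h AS AR t (S.stateVec N k) L L' =
      S.particleForm h AS t L L' k.1 * S.resForm AR t L L' k.2 := by
  rw [pathForm, obsForm_eq_inner, obsFree, inner_tens_obsVec]
  simp only [free, LinearIsometryEquiv.inner_map_map, path_fst_apply, path_snd, stateVec,
    particleForm, headForm, resForm, ARt]
  rw [UnitaryGroup.inner_apply_left]
  rfl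

theorem norm_headForm_le (h : n ≤ N) (AS : PSpace ι n →L[ℂ] PSpace ι n) (t : ℝ)
    (L L' : List (Fin N × ℝ)) (c : Fin n → ℕ) :
    ‖S.headForm h AS t L L' c‖ ≤ ‖AS‖ * ∏ i : Fin n,
      (‖S.wordG i (timesOf (Fin.castLE h i) L) (S.ξ i (c i))‖ *
        ‖S.wordG i (timesOf (Fin.castLE h i) L') (S.ξ i (c i))‖) := by
  refine (norm_inner_le_norm _ _).trans ?_
  refine (mul_le_mul_of_nonneg_left (AS.le_opNorm _) (norm_nonneg _)).trans (le_of_eq ?_)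
  rw [norm_pureTensor, norm_pureTensor, Finset.prod_mul_distrib]
  simp only [LinearIsometryEquiv.norm_map]
  ring

theorem norm_particleForm_le (h : n ≤ N) (AS : PSpace ι n →L[ℂ] PSpace ι n) (t : ℝ)
    (L L' : List (Fin N × ℝ)) (c : Fin N → ℕ) :
    ‖S.particleForm h AS t L L' c‖ ≤
      ‖AS‖ * S.g ^ (L.length + L'.length) * (∏ j : Fin N, ‖S.ξ j (c j)‖) ^ 2 := by
  have h1 : ‖S.particleForm h AS t L L' c‖ ≤ ‖AS‖ * ∏ j : Fin N,
      (‖S.wordG j (timesOf j L) (S.ξ j (c j))‖ * ‖S.wordG j (timesOf j L') (S.ξ j (c j))‖) := by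
    rw [particleForm, norm_mul, norm_prod, prod_split h, ← mul_assoc]
    exact mul_le_mul (S.norm_headForm_le h AS t L L' _)
      (Finset.prod_le_prod (fun _ _ => norm_nonneg _) fun _ _ => norm_inner_le_norm _ _)
      (Finset.prod_nonneg fun _ _ => norm_nonneg _)
      (mul_nonneg (norm_nonneg _) (Finset.prod_nonneg fun _ _ => by positivity))
  refine h1.trans ?_
  rw [Finset.prod_mul_distrib, mul_assoc]
  refine mul_le_mul_of_nonneg_left ?_ (norm_nonneg _)
  have h2 := S.prod_norm_path_le (fun j : Fin N => S.ξ j (c j), (0 : R)) L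
  have h3 := S.prod_norm_path_le (fun j : Fin N => S.ξ j (c j), (0 : R)) L'
  simp only [path_fst_apply] at h2 h3
  refine (mul_le_mul h2 h3 (Finset.prod_nonneg fun _ _ => norm_nonneg _)
    (mul_nonneg (pow_nonneg S.g_nonneg _) (Finset.prod_nonneg fun _ _ => norm_nonneg _))).trans
    (le_of_eq ?_)
  rw [pow_add]
  ring

theorem summable_prod_norm_sq : Summable fun c : Fin N → ℕ => (∏ j : Fin N, ‖S.ξ j (c j)‖) ^ 2 :=
  summable_of_sum_le (fun _ => sq_nonneg _) sum_prod_norm_sq_le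

theorem summable_norm_particleForm (h : n ≤ N) (AS : PSpace ι n →L[ℂ] PSpace ι n) (t : ℝ)
    (L L' : List (Fin N × ℝ)) : Summable fun c => ‖S.particleForm h AS t L L' c‖ :=
  Summable.of_nonneg_of_le (fun _ => norm_nonneg _) (S.norm_particleForm_le h AS t L L')
    (S.summable_prod_norm_sq.mul_left _)

theorem norm_tsum_particleForm_le (h : n ≤ N) (AS : PSpace ι n →L[ℂ] PSpace ι n) (t : ℝ)
    (L L' : List (Fin N × ℝ)) :
    ‖∑' c, S.particleForm h AS t L L' c‖ ≤ ‖AS‖ * S.g ^ (L.length + L'.length) := by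
  refine (norm_tsum_le_tsum_norm (S.summable_norm_particleForm h AS t L L')).trans ?_
  have hP : 0 ≤ ‖AS‖ * S.g ^ (L.length + L'.length) :=
    mul_nonneg (norm_nonneg _) (pow_nonneg S.g_nonneg _)
  refine Real.tsum_le_of_sum_le (fun _ => norm_nonneg _) fun F => ?_
  refine (Finset.sum_le_sum fun c _ => S.norm_particleForm_le h AS t L L' c).trans ?_
  rw [← Finset.mul_sum]
  exact mul_le_of_le_one_right hP (sum_prod_norm_sq_le F)

theorem summable_norm_headForm (h : n ≤ N) (AS : PSpace ι n →L[ℂ] PSpace ι n) (t : ℝ)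
    (L L' : List (Fin N × ℝ)) : Summable fun c => ‖S.headForm h AS t L L' c‖ := by
  refine Summable.of_nonneg_of_le (fun _ => norm_nonneg _) (S.norm_headForm_le h AS t L L')
    ((summable_prod_pi (κ := fun _ : Fin n => ℕ) (fun (i : Fin n) k =>
      ‖S.wordG i (timesOf (Fin.castLE h i) L) (S.ξ i k)‖ *
        ‖S.wordG i (timesOf (Fin.castLE h i) L') (S.ξ i k)‖) (fun _ _ => by positivity)
      fun i => ?_).mul_left _)
  refine Summable.of_nonneg_of_le (fun _ => by positivity) (fun k => ?_)
    ((S.ξ_trace i).summable.mul_left (S.g ^ (timesOf (Fin.castLE h i) L).length *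
      S.g ^ (timesOf (Fin.castLE h i) L').length))
  refine (mul_le_mul (S.norm_wordG_le i _ _) (S.norm_wordG_le i _ _) (norm_nonneg _)
    (mul_nonneg (pow_nonneg S.g_nonneg _) (norm_nonneg _))).trans (le_of_eq ?_)
  ring

theorem tsum_particleForm (h : n ≤ N) (AS : PSpace ι n →L[ℂ] PSpace ι n) (t : ℝ)
    (L L' : List (Fin N × ℝ)) :
    ∑' c, S.particleForm h AS t L L' c = (∑' c, S.headForm h AS t L L' c) *
      ∏ j : {j : Fin N // n ≤ (j : ℕ)}, ∑' k, inner ℂ (S.wordG j (timesOf j.1 L) (S.ξ j k))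
        (S.wordG j (timesOf j.1 L') (S.ξ j k)) :=
  (hasSum_split (κ := fun _ => ℕ) h (S.summable_norm_headForm h AS t L L')
    (φ := fun j k => inner ℂ (S.wordG j (timesOf j L) (S.ξ j k))
      (S.wordG j (timesOf j L') (S.ξ j k)))
    fun j => S.summable_norm_inner_wordG j _ _).tsum_eq

/-- A particle not touched by `A_S` contributes the moment of all its `G_j` factors, from both lists
together; an odd moment vanishes. -/
theorem tsum_particleForm_eq_zero (h : n ≤ N) (AS : PSpace ι n →L[ℂ] PSpace ι n) {t : ℝ}
    (hodd : S.OddMomentsVanish t) {L L' : List (Fin N × ℝ)} (hL : ∀ a ∈ L, 0 ≤ a.2 ∧ a.2 ≤ t)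
    (hL' : ∀ a ∈ L', 0 ≤ a.2 ∧ a.2 ≤ t) {j : Fin N} (hj : n ≤ (j : ℕ))
    (hcount : Odd (((L ++ L').map Prod.fst).count j)) :
    ∑' c, S.particleForm h AS t L L' c = 0 := by
  rw [tsum_particleForm]
  refine mul_eq_zero_of_right _ (Finset.prod_eq_zero (Finset.mem_univ ⟨j, hj⟩) ?_)
  simp only [inner_wordG_wordG]
  refine hodd j _ ?_ ?_
  · rw [List.length_append, List.length_reverse, length_timesOf, length_timesOf,
      ← List.count_append, ← List.map_append]
    exact hcount
  · intro s hs
    rcases List.mem_append.1 hs with hs | hs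
    · exact mem_timesOf hL s (List.mem_reverse.1 hs)
    · exact mem_timesOf hL' s hs

/-- The reversal accounts for the definition of `beta`, where the factors left of `A_R(t)` are
listed in operator order and reversed by passing to the left entry. -/
theorem enorm_tsum_resForm_le {t : ℝ} {L L' : List (Fin N × ℝ)} {r : ℕ}
    (hr : L.length + L'.length = r) (hL : ∀ a ∈ L, 0 ≤ a.2 ∧ a.2 ≤ t)
    (hL' : ∀ a ∈ L', 0 ≤ a.2 ∧ a.2 ≤ t) : ‖∑' k, S.resForm AR t L L' k‖ₑ ≤ S.beta AR t r := by
  have h1 : (clampList L).reverse.length + (clampList L').length = r := by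
    rw [List.length_reverse, length_clampList, length_clampList, hr]
  have h2 : ∀ a ∈ (clampList L).reverse ++ clampList L', 0 ≤ a.2 ∧ a.2 ≤ t := by
    intro a ha
    rcases List.mem_append.1 ha with ha | ha
    · exact (mem_clampList_of_mem_box hL a (List.mem_reverse.1 ha)).2
    · exact (mem_clampList_of_mem_box hL' a ha).2
  have h3 := le_iSup₂_of_le (f := fun (M M' : List (ℕ × ℝ)) =>
    ⨆ (_ : M.length + M'.length = r) (_ : ∀ a ∈ M ++ M', 0 ≤ a.2 ∧ a.2 ≤ t),
    ‖∑' k, inner ℂ (S.word M.reverse (S.Ω k)) (S.ARt AR t (S.word M' (S.Ω k)))‖ₑ)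
    (clampList L).reverse (clampList L') (le_iSup₂_of_le h1 h2 le_rfl)
  rwa [List.reverse_reverse] at h3

variable {S}

theorem tsum_pathForm (hreg : S.Regular AR) (h : n ≤ N) (AS : PSpace ι n →L[ℂ] PSpace ι n) {t : ℝ}
    (ht : 0 ≤ t) {L L' : List (Fin N × ℝ)} (hL : ∀ a ∈ L, 0 ≤ a.2 ∧ a.2 ≤ t)
    (hL' : ∀ a ∈ L', 0 ≤ a.2 ∧ a.2 ≤ t) :
    HasSum (fun k => S.pathForm h AS AR t (S.stateVec N k) L L')
      ((∑' c, S.particleForm h AS t L L' c) * ∑' k, S.resForm AR t L L' k) := by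
  have h1 : Summable fun k => ‖S.resForm AR t L L' k‖ := by
    obtain ⟨C₁, hC₁, h₁⟩ := exists_sum_norm_path_le hreg N t one_pos
    obtain ⟨C₂, hC₂, h₂⟩ := exists_sum_norm_extendZero_path_le hreg N t one_pos
    set φ₀ : ∀ j : Fin N, H j := fun _ => 0
    have s1 : Summable fun k => ‖(S.path (φ₀, S.Ω k) L).2‖ ^ 2 :=
      summable_of_sum_le (fun _ => sq_nonneg _) (h₁ L hL φ₀)
    have s2 : Summable fun k => ‖extendZero AR (S.reservoir t (S.path (φ₀, S.Ω k) L').2)‖ ^ 2 :=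
      summable_of_sum_le (fun _ => sq_nonneg _) (h₂ L' hL' t ht le_rfl φ₀)
    refine Summable.of_nonneg_of_le (fun _ => norm_nonneg _) (fun k => ?_) (s1.add s2)
    rw [resForm]
    refine (norm_inner_le_norm _ _).trans ?_
    rw [ARt, LinearIsometryEquiv.norm_map, path_snd, path_snd]
    nlinarith [two_mul_le_add_sq ‖S.word (clampList L) (S.Ω k)‖
      ‖extendZero AR (S.reservoir t (S.word (clampList L') (S.Ω k)))‖,
      sq_nonneg ‖S.word (clampList L) (S.Ω k)‖,
      sq_nonneg ‖extendZero AR (S.reservoir t (S.word (clampList L') (S.Ω k)))‖]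
  have h2 := S.summable_norm_particleForm h AS t L L'
  have h3 := summable_mul_of_summable_norm h2 h1
  simp only [pathForm_stateVec]
  rw [HasSum.mul_eq h2.of_norm.hasSum h1.of_norm.hasSum h3.hasSum]
  exact h3.hasSum

/-- The sum over the density matrix is taken inside the commutator before estimating, because `beta`
bounds the summed reservoir expectation, not its separate terms. -/
theorem enorm_omegaT_le (hreg : S.Regular AR) (h : n ≤ N) (AS : PSpace ι n →L[ℂ] PSpace ι n) {t : ℝ}
    (ht : 0 ≤ t) {r : ℕ} (j : Fin r → Fin N) {s : Fin r → ℝ} (hs : ∀ i, 0 ≤ s i ∧ s i ≤ t) :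
    ‖S.omegaT h AS AR t j s‖ₑ ≤ 2 ^ r * (ENNReal.ofReal (‖AS‖ * S.g ^ r) * S.beta AR t r) := by
  set l := List.ofFn fun i => (j i, s i) with hl
  have hlen : l.length = r := List.length_ofFn
  have hbox : ∀ a ∈ l, 0 ≤ a.2 ∧ a.2 ≤ t := by simpa [hl, List.mem_ofFn] using hs
  have h1 : HasSum (fun k => listCommutator l (S.pathForm h AS AR t (S.stateVec N k)))
      (listCommutator l fun L L' => (∑' c, S.particleForm h AS t L L' c) *
        ∑' k, S.resForm AR t L L' k) :=
    hasSum_listCommutator fun L L' hp => tsum_pathForm hreg h AS ht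
      (fun a ha => hbox a (hp.subset (List.mem_append_left _ ha)))
      (fun a ha => hbox a (hp.subset (List.mem_append_right _ ha)))
  rw [(hasSum_omegaT hreg h AS ht j hs).unique h1]
  have h2 := enorm_listCommutator_le (l := l)
    (F := fun L L' => (∑' c, S.particleForm h AS t L L' c) * ∑' k, S.resForm AR t L L' k)
    (M := ENNReal.ofReal (‖AS‖ * S.g ^ r) * S.beta AR t r) fun L L' hp => by
      have hlen' : L.length + L'.length = r := by
        rw [← List.length_append, hp.length_eq, hlen]
      have hL : ∀ a ∈ L, 0 ≤ a.2 ∧ a.2 ≤ t :=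
        fun a ha => hbox a (hp.subset (List.mem_append_left _ ha))
      have hL' : ∀ a ∈ L', 0 ≤ a.2 ∧ a.2 ≤ t :=
        fun a ha => hbox a (hp.subset (List.mem_append_right _ ha))
      rw [enorm_mul]
      refine mul_le_mul' ?_ (S.enorm_tsum_resForm_le hlen' hL hL')
      rw [← ofReal_norm, ← hlen']
      exact ENNReal.ofReal_le_ofReal (S.norm_tsum_particleForm_le h AS t L L')
  rwa [hlen] at h2

/-- Expanding the commutators only redistributes the letters over two lists; the total number of
occurrences of `i` stays odd in every term. -/
theorem omegaT_eq_zero (hreg : S.Regular AR) (h : n ≤ N) (AS : PSpace ι n →L[ℂ] PSpace ι n) {t : ℝ}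
    (ht : 0 ≤ t) (hodd : S.OddMomentsVanish t) {r : ℕ} (j : Fin r → Fin N) {s : Fin r → ℝ}
    (hs : ∀ i, 0 ≤ s i ∧ s i ≤ t) {i : Fin N} (hi : n ≤ (i : ℕ))
    (hcount : Odd (Finset.univ.filter fun a => j a = i).card) : S.omegaT h AS AR t j s = 0 := by
  set l := List.ofFn fun i => (j i, s i) with hl
  have hbox : ∀ a ∈ l, 0 ≤ a.2 ∧ a.2 ≤ t := by simpa [hl, List.mem_ofFn] using hs
  have hcl : (l.map Prod.fst).count i = (Finset.univ.filter fun a => j a = i).card := by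
    rw [hl, List.map_ofFn]
    exact count_ofFn j i
  have h1 : HasSum (fun k => listCommutator l (S.pathForm h AS AR t (S.stateVec N k)))
      (listCommutator l fun _ _ => 0) :=
    hasSum_listCommutator fun L L' hp => by
      have hL : ∀ a ∈ L, 0 ≤ a.2 ∧ a.2 ≤ t :=
        fun a ha => hbox a (hp.subset (List.mem_append_left _ ha))
      have hL' : ∀ a ∈ L', 0 ≤ a.2 ∧ a.2 ≤ t :=
        fun a ha => hbox a (hp.subset (List.mem_append_right _ ha))
      have h2 := tsum_pathForm hreg h AS ht hL hL'
      rwa [S.tsum_particleForm_eq_zero h AS hodd hL hL' hi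
        (by rwa [(hp.map Prod.fst).count_eq, hcl]), zero_mul] at h2
  have h3 : ∀ l : List (Fin N × ℝ), listCommutator l (fun _ _ => 0) = 0 := by
    intro l
    induction l with
    | nil => rfl
    | cons a l ih => simpa [listCommutator] using ih
  rw [h3] at h1
  exact (hasSum_omegaT hreg h AS ht j hs).unique h1

/-- The average of the observable in the free evolution does not depend on the number of
particles. -/
theorem omega_obsForm_eq_freeAverage (hreg : S.Regular AR) (h : n ≤ N)
    (AS : PSpace ι n →L[ℂ] PSpace ι n) {t : ℝ} (ht : 0 ≤ t) :
    S.omega N (S.obsForm h AS AR t) = S.freeAverage AS AR t := by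
  have key : ∀ {M : ℕ} (hM : n ≤ M), S.omega M (S.obsForm hM AS AR t) =
      (∑' c, S.headForm hM AS t [] [] c) * ∑' k, S.resForm (N := M) AR t [] [] k := by
    intro M hM
    have h1 := (tsum_pathForm (L := []) (L' := []) hreg hM AS ht (by simp) (by simp)).tsum_eq
    rw [tsum_particleForm] at h1
    -- Particles beyond the first `n` contribute only the trace of their density matrix.
    have h2 : ∀ j : ℕ, ∑' k, inner ℂ (S.wordG j [] (S.ξ j k)) (S.wordG j [] (S.ξ j k)) = 1 := by
      intro j
      simp only [wordG, List.foldr_nil, inner_self_eq_norm_sq_to_K]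
      have := Complex.hasSum_ofReal.2 (S.ξ_trace j)
      simpa using this.tsum_eq
    have h3 : ∀ j : {j : Fin M // n ≤ (j : ℕ)},
        ∑' k, inner ℂ (S.wordG j (timesOf j.1 []) (S.ξ j k))
          (S.wordG j (timesOf j.1 []) (S.ξ j k)) = 1 := fun j => h2 j
    simp only [h3, Finset.prod_const_one, mul_one] at h1
    exact h1
  rw [freeAverage, key h, key le_rfl]
  rfl

end Model

end MeanField

end

noncomputable section

namespace MeanField

open Filter Topology MeasureTheory

universe u v w

/-! ### Counting words with given multiplicities -/

/-- The number of occurrences of each letter in a word. -/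
def multiplicity {α : Type*} [DecidableEq α] {r : ℕ} (j : Fin r → α) (i : α) : ℕ :=
  (Finset.univ.filter fun a => j a = i).card

section Counting

variable {α : Type*} [Fintype α] [DecidableEq α]

theorem multiplicity_cons {r : ℕ} (i₀ : α) (j : Fin r → α) (i : α) :
    multiplicity (Fin.cons i₀ j : Fin (r + 1) → α) i =
      multiplicity j i + if i₀ = i then 1 else 0 := by
  simp only [multiplicity, Finset.card_filter, Fin.sum_univ_succ, Fin.cons_zero, Fin.cons_succ]
  rw [add_comm]

theorem sum_multiplicity {r : ℕ} (j : Fin r → α) : ∑ i, multiplicity j i = r := by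
  have h := Finset.card_eq_sum_card_fiberwise (f := j) (s := Finset.univ) (t := Finset.univ)
    fun _ _ => Finset.mem_coe.2 (Finset.mem_univ _)
  rw [Finset.card_univ, Fintype.card_fin] at h
  exact h.symm

theorem card_words_mul_prod_factorial_le (r : ℕ) (p : α → ℕ) :
    (Finset.univ.filter fun j : Fin r → α => ∀ i, multiplicity j i = p i).card *
      ∏ i, (p i).factorial ≤ r.factorial := by
  induction r generalizing p with
  | zero =>
    by_cases h : ∀ i, p i = 0
    · simp only [h, Nat.factorial_zero, Finset.prod_const_one, mul_one]
      exact (Finset.card_le_univ _).trans (by simp)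
    · rw [Finset.filter_false_of_mem]
      · simp
      · intro j _ hj
        exact h fun i => (hj i).symm.trans (by simp [multiplicity])
  | succ r ih =>
    set A : α → Finset (Fin r → α) := fun i₀ => Finset.univ.filter fun j : Fin r → α =>
      ∀ i, multiplicity (Fin.cons i₀ j : Fin (r + 1) → α) i = p i with hA
    have hcard : (Finset.univ.filter fun j : Fin (r + 1) → α => ∀ i, multiplicity j i = p i).card =
        ∑ i₀, (A i₀).card := by
      simp only [hA, Finset.card_filter]
      rw [← Fintype.sum_prod_type' fun (i₀ : α) (j : Fin r → α) =>
        if ∀ i, multiplicity (Fin.cons i₀ j : Fin (r + 1) → α) i = p i then 1 else 0]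
      exact (Equiv.sum_comp (Fin.consEquiv fun _ : Fin (r + 1) => α) _).symm
    -- Fixing the first letter to be `i₀` lowers `p i₀` by one, which costs a factor `p i₀`. Summing
    -- over `i₀` gives `∑ p i = r + 1`, the new factor of the factorial.
    have hAle : ∀ i₀, (A i₀).card * ∏ i, (p i).factorial ≤ p i₀ * r.factorial := by
      intro i₀
      rcases Nat.eq_zero_or_eq_succ_pred (p i₀) with h0 | h0
      · have : A i₀ = ∅ := by
          refine Finset.filter_false_of_mem fun j _ hj => ?_
          have := hj i₀
          rw [multiplicity_cons, if_pos rfl] at this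
          omega
        simp [this]
      · set p' := Function.update p i₀ (p i₀ - 1) with hp'
        have hsub : A i₀ ⊆ Finset.univ.filter fun j : Fin r → α => ∀ i, multiplicity j i = p' i := by
          intro j hj
          refine Finset.mem_filter.2 ⟨Finset.mem_univ _, fun i => ?_⟩
          have := (Finset.mem_filter.1 hj).2 i
          rw [multiplicity_cons] at this
          by_cases hi : i = i₀
          · subst hi
            rw [if_pos rfl] at this
            rw [hp', Function.update_self]
            omega
          · rw [if_neg (Ne.symm hi)] at this
            rw [hp', Function.update_of_ne hi]
            omega
        have hprod : ∏ i, (p i).factorial = p i₀ * ∏ i, (p' i).factorial := by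
          rw [← Finset.mul_prod_erase _ _ (Finset.mem_univ i₀),
            ← Finset.mul_prod_erase _ (fun i => (p' i).factorial) (Finset.mem_univ i₀), ← mul_assoc]
          congr 1
          · rw [hp', Function.update_self]
            conv_lhs => rw [h0]
            rw [Nat.factorial_succ, ← Nat.succ_eq_add_one, ← h0, Nat.pred_eq_sub_one]
          · refine Finset.prod_congr rfl fun i hi => ?_
            rw [hp', Function.update_of_ne (Finset.ne_of_mem_erase hi)]
        rw [hprod, mul_left_comm]
        exact Nat.mul_le_mul_left _ ((Nat.mul_le_mul_right _ (Finset.card_le_card hsub)).trans (ih p'))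
    rcases Finset.eq_empty_or_nonempty
      (Finset.univ.filter fun j : Fin (r + 1) → α => ∀ i, multiplicity j i = p i) with he | ⟨j, hj⟩
    · simp [he]
    · have hsum : ∑ i, p i = r + 1 := by
        rw [← sum_multiplicity j]
        exact Finset.sum_congr rfl fun i _ => ((Finset.mem_filter.1 hj).2 i).symm
      rw [hcard, Finset.sum_mul, Nat.factorial_succ, ← hsum, Finset.sum_mul]
      exact Finset.sum_le_sum fun i _ => hAle i

/-- The multinomial theorem with all variables equal to `1`. -/
theorem sum_inv_prod_factorial (s : ℕ) :
    ∑ q ∈ Finset.piAntidiag (Finset.univ : Finset α) s, ((∏ i, (q i).factorial : ℕ) : ℝ)⁻¹ =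
      (Fintype.card α : ℝ) ^ s / s.factorial := by
  have h := Finset.sum_pow_eq_sum_piAntidiag (Finset.univ : Finset α) (fun _ => (1 : ℝ)) s
  simp only [Finset.sum_const, Finset.card_univ, nsmul_eq_mul, mul_one, one_pow,
    Finset.prod_const_one] at h
  rw [h, Finset.sum_div]
  refine Finset.sum_congr rfl fun q hq => ?_
  have h1 := Nat.multinomial_spec (Finset.univ : Finset α) q
  rw [(Finset.mem_piAntidiag.1 hq).1] at h1
  rw [← h1]
  have h2 : ((∏ i, (q i).factorial : ℕ) : ℝ) ≠ 0 := by
    exact_mod_cast (Finset.prod_pos fun i _ => Nat.factorial_pos _).ne'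
  have h3 : (Nat.multinomial Finset.univ q : ℝ) ≠ 0 := by
    exact_mod_cast (Nat.multinomial_pos _ _).ne'
  push_cast at h2 ⊢
  field_simp

end Counting

/-- The multiplicities of words of length `r` in `N` letters in which the first `n` letters occur `m`
times altogether and each other letter occurs an even number of times. -/
def evenMultiplicities (n N r m : ℕ) : Finset (Fin N → ℕ) :=
  (Finset.piAntidiag (Finset.univ : Finset (Fin N)) r).filter fun p =>
    ∑ i ∈ Finset.univ.filter (fun i : Fin N => (i : ℕ) < n), p i = m ∧
      ∀ i : Fin N, n ≤ (i : ℕ) → Even (p i)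

theorem sum_head_add_sum_tail {n N : ℕ} (p : Fin N → ℕ) :
    ∑ i ∈ Finset.univ.filter (fun i : Fin N => (i : ℕ) < n), p i +
      ∑ i ∈ Finset.univ.filter (fun i : Fin N => ¬ (i : ℕ) < n), p i = ∑ i, p i :=
  Finset.sum_filter_add_sum_filter_not _ _ _

theorem sum_head_eq {n N : ℕ} (h : n ≤ N) (p : Fin N → ℕ) :
    ∑ i ∈ Finset.univ.filter (fun i : Fin N => (i : ℕ) < n), p i = ∑ i : Fin n, p (Fin.castLE h i) := by
  symm
  refine Finset.sum_bij (fun i _ => Fin.castLE h i) (fun i _ => ?_) (fun i _ i' _ hi => ?_)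
    (fun i hi => ?_) fun _ _ => rfl
  · exact Finset.mem_filter.2 ⟨Finset.mem_univ _, i.2⟩
  · exact Fin.castLE_injective h hi
  · exact ⟨⟨i, (Finset.mem_filter.1 hi).2⟩, Finset.mem_univ _, rfl⟩

theorem exists_of_mem_evenMultiplicities {n N r m : ℕ} {p : Fin N → ℕ}
    (hp : p ∈ evenMultiplicities n N r m) :
    ∃ s, r = m + 2 * s ∧
      ∑ i : Fin N, (if (i : ℕ) < n then 0 else p i / 2) = s := by
  obtain ⟨hr, hm, he⟩ := Finset.mem_filter.1 hp
  refine ⟨_, ?_, rfl⟩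
  have h1 := sum_head_add_sum_tail (n := n) p
  rw [hm, (Finset.mem_piAntidiag.1 hr).1] at h1
  rw [← h1, Finset.mul_sum, Finset.sum_filter]
  congr 1
  refine Finset.sum_congr rfl fun i _ => ?_
  by_cases hi : (i : ℕ) < n
  · simp [hi]
  · simp only [hi, not_false_eq_true, if_true, if_false]
    exact (Nat.two_mul_div_two_of_even (he i (not_lt.1 hi))).symm

theorem sum_inv_prod_factorial_evenMultiplicities_le {n N : ℕ} (h : n ≤ N) (m s : ℕ) :
    ∑ p ∈ evenMultiplicities n N (m + 2 * s) m, ((∏ i, (p i).factorial : ℕ) : ℝ)⁻¹ ≤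
      (n : ℝ) ^ m / m.factorial * ((N : ℝ) ^ s / s.factorial) := by
  have h1 := sum_inv_prod_factorial (α := Fin n) m
  have h2 := sum_inv_prod_factorial (α := Fin N) s
  rw [Fintype.card_fin] at h1 h2
  rw [← h1, ← h2, Finset.sum_mul_sum, ← Finset.sum_product']
  -- The multiplicities are encoded by those of the first `n` letters and the halves of the others,
  -- padded by `0`. Evenness makes the encoding injective, and `(p / 2)! ≤ p!` gives the comparison.
  -- Halving yields `N ^ s` in place of `N ^ (2 s)`, the source of uniformity in `N`.
  set e : (Fin N → ℕ) → (Fin n → ℕ) × (Fin N → ℕ) := fun p =>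
    (fun i => p (Fin.castLE h i), fun i => if (i : ℕ) < n then 0 else p i / 2) with he
  have hinj : Set.InjOn e (evenMultiplicities n N (m + 2 * s) m) := by
    intro p hp p' hp' hpp
    obtain ⟨e1, e2⟩ := Prod.mk.inj hpp
    funext i
    by_cases hi : (i : ℕ) < n
    · exact congrFun e1 ⟨i, hi⟩
    · have h3 := congrFun e2 i
      simp only [hi, if_false] at h3
      have h4 := (Finset.mem_filter.1 (Finset.mem_coe.1 hp)).2.2 i (not_lt.1 hi)
      have h5 := (Finset.mem_filter.1 (Finset.mem_coe.1 hp')).2.2 i (not_lt.1 hi)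
      rw [← Nat.two_mul_div_two_of_even h4, ← Nat.two_mul_div_two_of_even h5, h3]
  have hmem : ∀ p ∈ evenMultiplicities n N (m + 2 * s) m,
      e p ∈ Finset.piAntidiag (Finset.univ : Finset (Fin n)) m ×ˢ
        Finset.piAntidiag (Finset.univ : Finset (Fin N)) s := by
    intro p hp
    obtain ⟨s', hs, hs'⟩ := exists_of_mem_evenMultiplicities hp
    obtain rfl : s = s' := by omega
    refine Finset.mem_product.2 ⟨Finset.mem_piAntidiag.2 ⟨?_, by simp⟩,
      Finset.mem_piAntidiag.2 ⟨hs', by simp⟩⟩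
    rw [← (Finset.mem_filter.1 hp).2.1]
    exact (sum_head_eq h p).symm
  have hle : ∀ p ∈ evenMultiplicities n N (m + 2 * s) m,
      ((∏ i, (p i).factorial : ℕ) : ℝ)⁻¹ ≤ ((∏ i, ((e p).1 i).factorial : ℕ) : ℝ)⁻¹ *
        ((∏ i, ((e p).2 i).factorial : ℕ) : ℝ)⁻¹ := by
    intro p _
    rw [← mul_inv, ← Nat.cast_mul]
    have hpos : 0 < (∏ i, ((e p).1 i).factorial) * ∏ i, ((e p).2 i).factorial :=
      Nat.mul_pos (Finset.prod_pos fun i _ => Nat.factorial_pos _)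
        (Finset.prod_pos fun i _ => Nat.factorial_pos _)
    refine inv_anti₀ (Nat.cast_pos.2 hpos) ?_
    rw [prod_split h fun i => (p i).factorial, prod_split h fun i => ((e p).2 i).factorial]
    have h3 : ∏ i : Fin n, ((e p).2 (Fin.castLE h i)).factorial = 1 :=
      Finset.prod_eq_one fun i _ => by simp [he]
    rw [h3, one_mul]
    refine Nat.cast_le.2 (Nat.mul_le_mul_left _ (Finset.prod_le_prod' fun j _ => ?_))
    simp only [he, not_lt.2 j.2, if_false]
    exact Nat.factorial_le (Nat.div_le_self _ _)
  refine (Finset.sum_le_sum hle).trans ?_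
  rw [← Finset.sum_image (f := fun q : (Fin n → ℕ) × (Fin N → ℕ) =>
    ((∏ i, (q.1 i).factorial : ℕ) : ℝ)⁻¹ * ((∏ i, (q.2 i).factorial : ℕ) : ℝ)⁻¹) hinj]
  exact Finset.sum_le_sum_of_subset_of_nonneg (Finset.image_subset_iff.2 hmem)
    fun _ _ _ => by positivity

theorem sum_card_words_le {n N : ℕ} (h : n ≤ N) (m s : ℕ) :
    ((∑ p ∈ evenMultiplicities n N (m + 2 * s) m,
      (Finset.univ.filter fun j : Fin (m + 2 * s) → Fin N =>
        ∀ i, multiplicity j i = p i).card : ℕ) : ℝ) ≤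
      (m + 2 * s).factorial * ((n : ℝ) ^ m / m.factorial * ((N : ℝ) ^ s / s.factorial)) := by
  refine le_trans ?_ (mul_le_mul_of_nonneg_left
    (sum_inv_prod_factorial_evenMultiplicities_le h m s) (Nat.cast_nonneg _))
  rw [Nat.cast_sum, Finset.mul_sum]
  refine Finset.sum_le_sum fun p _ => ?_
  have h1 : (Finset.univ.filter fun j : Fin (m + 2 * s) → Fin N =>
      ∀ i, multiplicity j i = p i).card * ∏ i, (p i).factorial ≤ (m + 2 * s).factorial := by
    convert card_words_mul_prod_factorial_le (m + 2 * s) p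
  have h2 : (0 : ℝ) < ((∏ i, (p i).factorial : ℕ) : ℝ) := by
    exact_mod_cast Finset.prod_pos fun i _ => Nat.factorial_pos _
  rw [← div_eq_mul_inv, le_div_iff₀ h2]
  exact_mod_cast h1

/-! ### The sum over multiplicities -/

namespace Model

variable {H : ℕ → Type u} [∀ j, NormedAddCommGroup (H j)] [∀ j, InnerProductSpace ℂ (H j)]
  [∀ j, CompleteSpace (H j)] {ι : ℕ → Type w}
  {R : Type v} [NormedAddCommGroup R] [InnerProductSpace ℂ R] [CompleteSpace R]
  {S : Model H ι R} {AR : R →ₗ.[ℂ] R} {n N : ℕ}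

theorem multiplicitySum_eq (hreg : S.Regular AR) (h : n ≤ N) (AS : PSpace ι n →L[ℂ] PSpace ι n)
    {t : ℝ} (ht : 0 ≤ t) (r m : ℕ) :
    S.multiplicitySum h AS AR t r m = ∑ p ∈ evenMultiplicities n N r m,
      ∑ j ∈ Finset.univ.filter (fun j : Fin r → Fin N => ∀ i, multiplicity j i = p i),
        iteratedIntegral r t (S.omegaT h AS AR t j) :=
  Finset.sum_congr rfl fun _ _ => iteratedIntegral_sum_omegaT hreg h AS ht _

theorem multiplicitySum_eq_zero (hreg : S.Regular AR) (h : n ≤ N)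
    (AS : PSpace ι n →L[ℂ] PSpace ι n) {t : ℝ} (ht : 0 ≤ t) {r m : ℕ}
    (hrm : ∀ s, r ≠ m + 2 * s) : S.multiplicitySum h AS AR t r m = 0 := by
  rw [multiplicitySum_eq hreg h AS ht]
  refine Finset.sum_eq_zero fun p hp => ?_
  obtain ⟨s, hs, -⟩ := exists_of_mem_evenMultiplicities hp
  exact absurd hs (hrm s)

theorem sum_range_multiplicitySum (hreg : S.Regular AR) (h : n ≤ N)
    (AS : PSpace ι n →L[ℂ] PSpace ι n) {t : ℝ} (ht : 0 ≤ t) (hodd : S.OddMomentsVanish t) (r : ℕ) :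
    ∑ m ∈ Finset.range (r + 1), S.multiplicitySum h AS AR t r m =
      ∑ j : Fin r → Fin N, iteratedIntegral r t (S.omegaT h AS AR t j) := by
  have h1 : ∀ f : (Fin N → ℕ) → ℂ, ∑ m ∈ Finset.range (r + 1),
      ∑ p ∈ evenMultiplicities n N r m, f p =
      ∑ p ∈ (Finset.piAntidiag (Finset.univ : Finset (Fin N)) r).filter
        (fun p => ∀ i : Fin N, n ≤ (i : ℕ) → Even (p i)), f p := by
    intro f
    rw [← Finset.sum_fiberwise_of_maps_to (t := Finset.range (r + 1)) (g := fun p : Fin N → ℕ =>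
      ∑ i ∈ Finset.univ.filter (fun i : Fin N => (i : ℕ) < n), p i)]
    · refine Finset.sum_congr rfl fun m _ => Finset.sum_congr ?_ fun _ _ => rfl
      rw [evenMultiplicities, Finset.filter_filter]
      exact Finset.filter_congr fun p _ => and_comm
    · intro p hp
      have h2 := (Finset.mem_piAntidiag.1 (Finset.mem_filter.1 hp).1).1
      have h3 := sum_head_add_sum_tail (n := n) p
      exact Finset.mem_range.2 (Nat.lt_succ_of_le ((Nat.le_add_right _ _).trans (h3.trans h2).le))
  have h2 : ∀ f : (Fin r → Fin N) → ℂ, ∑ p ∈ Finset.piAntidiag (Finset.univ : Finset (Fin N)) r,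
      ∑ j ∈ Finset.univ.filter (fun j : Fin r → Fin N => ∀ i, multiplicity j i = p i), f j =
      ∑ j, f j := by
    intro f
    rw [← Finset.sum_fiberwise_of_maps_to (s := Finset.univ) (g := fun j : Fin r → Fin N =>
      multiplicity j) (t := Finset.piAntidiag (Finset.univ : Finset (Fin N)) r)]
    · exact Finset.sum_congr rfl fun p _ => Finset.sum_congr
        (Finset.filter_congr fun j _ => funext_iff.symm) fun _ _ => rfl
    · intro j _
      exact Finset.mem_piAntidiag.2 ⟨sum_multiplicity j, by simp⟩
  simp only [multiplicitySum_eq hreg h AS ht]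
  rw [h1, ← h2]
  -- Multiplicities that are odd for some particle beyond the first `n` contribute zero, so they may
  -- be added.
  refine Finset.sum_subset (Finset.filter_subset _ _) fun p hp hp' => ?_
  refine Finset.sum_eq_zero fun j hj => ?_
  have h3 : ∃ i : Fin N, n ≤ (i : ℕ) ∧ ¬ Even (p i) := by
    by_contra hcon
    push Not at hcon
    exact hp' (Finset.mem_filter.2 ⟨hp, hcon⟩)
  obtain ⟨i, hi, hi'⟩ := h3
  rw [← (Finset.mem_filter.1 hj).2 i, Nat.not_even_iff_odd] at hi'
  have h4 : iteratedIntegral r t (S.omegaT h AS AR t j) = iteratedIntegral r t fun _ => 0 :=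
    iteratedIntegral_congr ht fun s hs => omegaT_eq_zero hreg h AS ht hodd j hs hi hi'
  have h5 := norm_iteratedIntegral_le (r := r) ht (f := fun _ => 0) (M := 0) (by simp)
  rw [mul_zero] at h5
  rw [h4, norm_le_zero_iff.1 h5]

/-- The `r!` in the count of words cancels the volume of the simplex. -/
theorem enorm_multiplicitySum_le (hreg : S.Regular AR) (h : n ≤ N)
    (AS : PSpace ι n →L[ℂ] PSpace ι n) {t : ℝ} (ht : 0 ≤ t) (m s : ℕ) :
    ‖S.multiplicitySum h AS AR t (m + 2 * s) m‖ₑ ≤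
      ENNReal.ofReal (‖AS‖ * ((n : ℝ) ^ m / m.factorial * ((N : ℝ) ^ s / s.factorial)) *
        (2 * S.g * t) ^ (m + 2 * s)) * S.beta AR t (m + 2 * s) := by
  have hg := S.g_nonneg
  set r := m + 2 * s with hr
  set c := ENNReal.ofReal (t ^ r / r.factorial) *
    (2 ^ r * (ENNReal.ofReal (‖AS‖ * S.g ^ r) * S.beta AR t r)) with hc
  have h1 : ∀ j : Fin r → Fin N, ‖iteratedIntegral r t (S.omegaT h AS AR t j)‖ₑ ≤ c := fun j =>
    enorm_iteratedIntegral_le ht fun s hs => enorm_omegaT_le hreg h AS ht j hs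
  have h2 : ‖S.multiplicitySum h AS AR t r m‖ₑ ≤ ((∑ p ∈ evenMultiplicities n N r m,
      (Finset.univ.filter fun j : Fin r → Fin N =>
        ∀ i, multiplicity j i = p i).card : ℕ) : ℝ≥0∞) * c := by
    rw [multiplicitySum_eq hreg h AS ht, Nat.cast_sum, Finset.sum_mul]
    refine (enorm_sum_le _ _).trans (Finset.sum_le_sum fun p _ => ?_)
    refine (enorm_sum_le _ _).trans ((Finset.sum_le_card_nsmul _ _ c fun j _ => h1 j).trans ?_)
    rw [nsmul_eq_mul]
  refine h2.trans ?_
  have h3 : (((∑ p ∈ evenMultiplicities n N r m, (Finset.univ.filter fun j : Fin r → Fin N =>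
        ∀ i, multiplicity j i = p i).card : ℕ) : ℝ≥0∞)) ≤
      ENNReal.ofReal (r.factorial * ((n : ℝ) ^ m / m.factorial * ((N : ℝ) ^ s / s.factorial))) := by
    rw [← ENNReal.ofReal_natCast]
    exact ENNReal.ofReal_le_ofReal (sum_card_words_le h m s)
  refine (mul_le_mul_left h3 c).trans (le_of_eq ?_)
  have h4 : (2 : ℝ≥0∞) ^ r = ENNReal.ofReal (2 ^ r) := by
    rw [ENNReal.ofReal_pow (by norm_num), ENNReal.ofReal_ofNat]
  rw [hc, h4, ← mul_assoc (ENNReal.ofReal (2 ^ r)), ← mul_assoc, ← mul_assoc,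
    ← ENNReal.ofReal_mul (by positivity), ← mul_assoc, ← ENNReal.ofReal_mul (by positivity),
    ← ENNReal.ofReal_mul (by positivity)]
  congr 2
  have : (r.factorial : ℝ) ≠ 0 := by positivity
  rw [mul_pow, mul_pow]
  field_simp

end Model

end MeanField

end

noncomputable section

namespace MeanField

open Filter Topology MeasureTheory

universe u v w

/-! ### Bounds that are uniform in the number of particles -/

theorem sqrt_div_pow_le_factorial (r : ℕ) :
    (Real.sqrt r / Real.sqrt (2 * Real.exp 1)) ^ r ≤ ((r / 2 + 1).factorial : ℝ) := by
  set b := Real.sqrt r / Real.sqrt (2 * Real.exp 1) with hb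
  have hb0 : 0 ≤ b := by positivity
  set k := r / 2 + 1 with hk
  -- With `k = r / 2 + 1`, raising the exponent from `r` to `2 * k` is allowed only for a base at
  -- least `1`. The bound then is `(k / e) ^ k ≤ k!`.
  rcases le_total b 1 with h1 | h1
  · exact (pow_le_one₀ hb0 h1).trans (by exact_mod_cast Nat.succ_le_of_lt (Nat.factorial_pos k))
  · have hbsq : b ^ 2 = r / (2 * Real.exp 1) := by
      rw [hb, div_pow, Real.sq_sqrt (Nat.cast_nonneg r), Real.sq_sqrt (by positivity)]
    have hrk : (r : ℝ) ≤ 2 * k := by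
      have : r ≤ 2 * k := by omega
      exact_mod_cast this
    have h2 : b ^ r ≤ ((k : ℝ) / Real.exp 1) ^ k := by
      calc b ^ r ≤ b ^ (2 * k) := pow_le_pow_right₀ h1 (by omega)
        _ = (r / (2 * Real.exp 1)) ^ k := by rw [pow_mul, hbsq]
        _ ≤ _ := by
          refine pow_le_pow_left₀ (by positivity) ?_ k
          rw [div_le_div_iff₀ (by positivity) (by positivity)]
          nlinarith [Real.exp_pos 1]
    refine h2.trans ?_
    have h3 := Real.pow_div_factorial_le_exp (k : ℝ) (Nat.cast_nonneg k) k
    rw [div_le_iff₀ (by positivity)] at h3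
    rw [div_pow, div_le_iff₀ (by positivity), ← Real.exp_nat_mul, mul_one, mul_comm]
    exact h3

/-- Combines `ν + 1 ≤ 2 ^ ν` with `ν! * ν! ≤ (2 * ν)!`. This is the factorial decay that makes the
sum over `ν` converge. -/
theorem factorial_ratio_le (ν : ℕ) : ((ν + 1).factorial : ℝ) / (2 * ν).factorial ≤
    2 ^ ν / ν.factorial := by
  have h1 : ν.factorial * ν.factorial ≤ (2 * ν).factorial := by
    rw [two_mul]
    exact Nat.le_of_dvd (Nat.factorial_pos _) (Nat.factorial_mul_factorial_dvd_factorial_add ν ν)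
  have h2 : ν + 1 ≤ 2 ^ ν := Nat.lt_two_pow_self
  have h3 : (ν + 1).factorial * ν.factorial ≤ 2 ^ ν * (2 * ν).factorial := by
    rw [Nat.factorial_succ, mul_assoc]
    exact Nat.mul_le_mul h2 h1
  rw [div_le_div_iff₀ (by positivity) (by positivity)]
  exact_mod_cast h3

/-- A bound for the terms of the expansion, with `n` the number of particles that the observable
involves and `q` the rate of convergence. -/
def termBound (a : ℝ) (n : ℕ) (q : ℝ) (p : ℕ × ℕ) : ℝ :=
  a * ((n : ℝ) ^ (2 * p.1) + (n : ℝ) ^ (2 * p.1 + 1)) *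
    (((p.1 + 1).factorial : ℝ) / (2 * p.1).factorial) *
    (((p.2 + (p.1 + 1)).choose (p.1 + 1) : ℝ) * (q ^ 2) ^ p.2)

theorem termBound_nonneg {a q : ℝ} (ha : 0 ≤ a) (n : ℕ) (p : ℕ × ℕ) : 0 ≤ termBound a n q p := by
  unfold termBound
  positivity

theorem summable_termBound {a q : ℝ} (ha : 0 ≤ a) (n : ℕ) (hq0 : 0 ≤ q) (hq1 : q < 1) :
    Summable (termBound a n q) := by
  have hx : ‖q ^ 2‖ < 1 := by
    rw [Real.norm_of_nonneg (sq_nonneg q)]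
    nlinarith
  -- The negative binomial series sums the index `s`. The power `ν + 2` of `1 / (1 - q ^ 2)` that it
  -- produces is only geometric in `ν`.
  have hs : ∀ ν, HasSum (fun s => termBound a n q (ν, s))
      (a * ((n : ℝ) ^ (2 * ν) + (n : ℝ) ^ (2 * ν + 1)) *
        (((ν + 1).factorial : ℝ) / (2 * ν).factorial) * (1 / (1 - q ^ 2) ^ (ν + 1 + 1))) := fun ν =>
    (hasSum_choose_mul_geometric_of_norm_lt_one (ν + 1) hx).mul_left _
  refine (summable_prod_of_nonneg fun p => termBound_nonneg ha n p).2
    ⟨fun ν => (hs ν).summable, ?_⟩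
  simp only [(hs _).tsum_eq]
  set y : ℝ := 1 / (1 - q ^ 2) with hy
  have hy0 : 0 ≤ y := by
    rw [Real.norm_of_nonneg (sq_nonneg q)] at hx
    exact div_nonneg zero_le_one (by linarith)
  refine Summable.of_nonneg_of_le (fun ν => ?_) (fun ν => ?_)
    ((Real.summable_pow_div_factorial (2 * (n : ℝ) ^ 2 * y)).mul_left (a * (1 + n) * y ^ 2))
  · rw [← one_div_pow]
    positivity
  · rw [← one_div_pow]
    calc _ ≤ a * ((n : ℝ) ^ (2 * ν) + (n : ℝ) ^ (2 * ν + 1)) * (2 ^ ν / ν.factorial) *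
          y ^ (ν + 1 + 1) := by
          exact mul_le_mul_of_nonneg_right (mul_le_mul_of_nonneg_left (factorial_ratio_le ν)
            (by positivity)) (by positivity)
      _ = _ := by
          rw [pow_succ (n : ℝ) (2 * ν), pow_mul (n : ℝ) 2 ν, mul_pow, mul_pow]
          ring

namespace Model

variable {H : ℕ → Type u} [∀ j, NormedAddCommGroup (H j)] [∀ j, InnerProductSpace ℂ (H j)]
  [∀ j, CompleteSpace (H j)] {ι : ℕ → Type w}
  {R : Type v} [NormedAddCommGroup R] [InnerProductSpace ℂ R] [CompleteSpace R]
  {S : Model H ι R} {AR : R →ₗ.[ℂ] R} {n N : ℕ}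

theorem exists_rate {lam : ℝ} {K : Set ℝ} (hK : ∀ t ∈ K, 0 ≤ t)
    (hsmall : S.SmallTimeUniform AR lam K) :
    ∃ q : ℝ, 0 ≤ q ∧ q < 1 ∧ ∃ r₀ : ℕ, ∀ r, r₀ ≤ r → ∀ t ∈ K,
      ENNReal.ofReal ((2 * |lam| * S.g * t) ^ r) * S.beta AR t r ≤
        ENNReal.ofReal (q ^ r * (r / 2 + 1).factorial) := by
  -- The rate `q` is any number strictly between the upper limit and `1`. Below, `r₀ + 1` ensures `r
  -- > 0`, so that the root of order `r` can be undone.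
  obtain ⟨c, hc, hc1⟩ := exists_between hsmall
  have hcT : c ≠ ∞ := (hc1.trans ENNReal.one_lt_top).ne
  obtain ⟨r₀, hr₀⟩ := eventually_atTop.1 (eventually_lt_of_limsup_lt hc)
  refine ⟨c.toReal, ENNReal.toReal_nonneg, ?_, r₀ + 1, fun r hr t ht => ?_⟩
  · rw [← ENNReal.toReal_one]
    exact (ENNReal.toReal_lt_toReal hcT ENNReal.one_ne_top).2 hc1
  have hg := S.g_nonneg
  have ht0 := hK t ht
  have hrpos : 0 < r := by omega
  have hr0 : (r : ℝ) ≠ 0 := by positivity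
  set d : ℝ := Real.sqrt (2 * Real.exp 1) with hd
  have hd0 : 0 < d := Real.sqrt_pos.2 (by positivity)
  have h1 : ENNReal.ofReal (2 * d * |lam| * S.g * t) *
      (S.beta AR t r ^ (1 / (r : ℝ)) / ENNReal.ofReal (Real.sqrt r)) ≤ c :=
    (le_iSup₂ (f := fun t (_ : t ∈ K) => ENNReal.ofReal (2 * d * |lam| * S.g * t) *
      (S.beta AR t r ^ (1 / (r : ℝ)) / ENNReal.ofReal (Real.sqrt r))) t ht).trans
      (hr₀ r (by omega)).le
  have hsq : ENNReal.ofReal (Real.sqrt r) ≠ 0 := by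
    simpa using Real.sqrt_pos.2 (by positivity : (0 : ℝ) < r)
  rw [← mul_div_assoc, ENNReal.div_le_iff hsq ENNReal.ofReal_ne_top] at h1
  have h2 := pow_le_pow_left' h1 r
  rw [mul_pow, mul_pow, one_div, ← ENNReal.rpow_mul_natCast, inv_mul_cancel₀ hr0,
    ENNReal.rpow_one, ← ENNReal.ofReal_pow (by positivity), ← ENNReal.ofReal_pow (by positivity)] at h2
  have h3 : (2 * |lam| * S.g * t) ^ r = (1 / d) ^ r * (2 * d * |lam| * S.g * t) ^ r := by
    rw [← mul_pow]
    congr 1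
    field_simp
  rw [h3, ENNReal.ofReal_mul (by positivity), mul_assoc]
  refine (mul_le_mul_right h2 _).trans ?_
  have h4 : c ^ r = ENNReal.ofReal (c.toReal ^ r) := by
    rw [ENNReal.ofReal_pow ENNReal.toReal_nonneg, ENNReal.ofReal_toReal hcT]
  rw [h4, ← ENNReal.ofReal_mul (by positivity), ← ENNReal.ofReal_mul (by positivity)]
  refine ENNReal.ofReal_le_ofReal ?_
  have h5 := sqrt_div_pow_le_factorial r
  calc (1 / d) ^ r * (c.toReal ^ r * Real.sqrt r ^ r) = c.toReal ^ r * (Real.sqrt r / d) ^ r := by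
        rw [div_pow, div_pow, one_pow]
        ring
    _ ≤ _ := mul_le_mul_of_nonneg_left h5 (by positivity)

theorem smallTimeUniform_singleton {lam t : ℝ} (h : S.SmallTime AR lam t) :
    S.SmallTimeUniform AR lam {t} := by
  rw [SmallTime, b, ← ENNReal.limsup_const_mul_of_ne_top ENNReal.ofReal_ne_top] at h
  simpa only [SmallTimeUniform, Set.mem_singleton_iff, iSup_iSup_eq_left] using h

/-- The contribution to the term of order `r` of the perturbation series in which the first `n`
particles are involved `m` times, and each of the other particles an even number of times. -/
def orderTerm (S : Model H ι R) (h : n ≤ N) (AS : PSpace ι n →L[ℂ] PSpace ι n) (AR : R →ₗ.[ℂ] R)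
    (lam t : ℝ) (r m : ℕ) : ℂ :=
  (I * ((lam / Real.sqrt N : ℝ) : ℂ)) ^ r * S.multiplicitySum h AS AR t r m

theorem enorm_orderTerm_le (hreg : S.Regular AR) (h : n ≤ N) (hN : 1 ≤ N)
    (AS : PSpace ι n →L[ℂ] PSpace ι n) (lam : ℝ) {t : ℝ} (ht : 0 ≤ t) (m s : ℕ) :
    ‖S.orderTerm h AS AR lam t (m + 2 * s) m‖ₑ ≤
      ENNReal.ofReal (‖AS‖ * ((n : ℝ) ^ m / m.factorial / s.factorial)) *
        (ENNReal.ofReal ((2 * |lam| * S.g * t) ^ (m + 2 * s)) * S.beta AR t (m + 2 * s)) := by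
  have hg := S.g_nonneg
  have hN0 : (1 : ℝ) ≤ N := by exact_mod_cast hN
  have hsN : 1 ≤ Real.sqrt N := Real.one_le_sqrt.2 hN0
  have hκ : ‖I * ((lam / Real.sqrt N : ℝ) : ℂ)‖ = |lam| / Real.sqrt N := by
    rw [norm_mul, Complex.norm_I, one_mul, Complex.norm_real, Real.norm_eq_abs, abs_div,
      abs_of_nonneg (Real.sqrt_nonneg _)]
  rw [orderTerm, enorm_mul, ← ofReal_norm (_ ^ _ : ℂ), norm_pow, hκ]
  refine (mul_le_mul_right (enorm_multiplicitySum_le hreg h AS ht m s) _).trans ?_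
  rw [← mul_assoc, ← ENNReal.ofReal_mul (by positivity),
    ← mul_assoc (ENNReal.ofReal (‖AS‖ * _)), ← ENNReal.ofReal_mul (by positivity)]
  refine mul_le_mul_left (ENNReal.ofReal_le_ofReal ?_) _
  -- The factor `N ^ s` from the counting is absorbed by `N ^ (-r/2)`; a spare `N ^ (-m/2)` is
  -- discarded.
  have h1 : (N : ℝ) ^ s ≤ Real.sqrt N ^ (m + 2 * s) := by
    calc (N : ℝ) ^ s = Real.sqrt N ^ (2 * s) := by
          rw [pow_mul, Real.sq_sqrt (Nat.cast_nonneg N)]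
      _ ≤ _ := pow_le_pow_right₀ hsN (by omega)
  have h2 : (N : ℝ) ^ s / Real.sqrt N ^ (m + 2 * s) ≤ 1 := (div_le_one (by positivity)).2 h1
  calc _ = (N : ℝ) ^ s / Real.sqrt N ^ (m + 2 * s) * (‖AS‖ * ((n : ℝ) ^ m / m.factorial /
        s.factorial) * (2 * |lam| * S.g * t) ^ (m + 2 * s)) := by
        rw [div_pow, show 2 * |lam| * S.g * t = |lam| * (2 * S.g * t) by ring,
          mul_pow |lam|]
        ring
    _ ≤ _ := mul_le_of_le_one_left (by positivity) h2

theorem norm_orderTerm_le_of_rate (hreg : S.Regular AR) (h : n ≤ N) (hN : 1 ≤ N)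
    (AS : PSpace ι n →L[ℂ] PSpace ι n) (lam : ℝ) {t : ℝ} (ht : 0 ≤ t) {m s : ℕ} {q : ℝ}
    (hq0 : 0 ≤ q) (hq1 : q ≤ 1)
    (hq : ENNReal.ofReal ((2 * |lam| * S.g * t) ^ (m + 2 * s)) * S.beta AR t (m + 2 * s) ≤
      ENNReal.ofReal (q ^ (m + 2 * s) * ((m + 2 * s) / 2 + 1).factorial)) :
    ‖S.orderTerm h AS AR lam t (m + 2 * s) m‖ ≤ termBound ‖AS‖ n q (m / 2, s) := by
  have h1 := (enorm_orderTerm_le hreg h hN AS lam ht m s).trans (mul_le_mul_right hq _)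
  rw [← ENNReal.ofReal_mul (by positivity), ← ofReal_norm,
    ENNReal.ofReal_le_ofReal_iff (by positivity)] at h1
  refine h1.trans ?_
  set ν := m / 2 with hν
  have e1 : (m + 2 * s) / 2 + 1 = s + (ν + 1) := by omega
  have e2 : ((s + (ν + 1)).factorial : ℝ) / s.factorial =
      ((s + (ν + 1)).choose (ν + 1) : ℝ) * (ν + 1).factorial := by
    rw [div_eq_iff (by positivity)]
    have := Nat.add_choose_mul_factorial_mul_factorial s (ν + 1)
    rw [← this]
    push_cast
    ring
  -- Powers of `q` are kept only for the index `s`. Convergence in `m` comes from the factorials.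
  have e3 : q ^ (m + 2 * s) ≤ (q ^ 2) ^ s := by
    rw [← pow_mul]
    exact pow_le_pow_of_le_one hq0 hq1 (by omega)
  -- The sum of both powers of `n` covers the even and the odd `m` with the same `ν = m / 2`.
  have e4 : (n : ℝ) ^ m / m.factorial ≤
      ((n : ℝ) ^ (2 * ν) + (n : ℝ) ^ (2 * ν + 1)) / (2 * ν).factorial := by
    have h2 : (n : ℝ) ^ m ≤ (n : ℝ) ^ (2 * ν) + (n : ℝ) ^ (2 * ν + 1) := by
      rcases Nat.even_or_odd' m with ⟨k, hk | hk⟩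
      · obtain rfl : k = ν := by omega
        rw [hk]
        exact le_add_of_nonneg_right (by positivity)
      · obtain rfl : k = ν := by omega
        rw [hk]
        exact le_add_of_nonneg_left (by positivity)
    refine div_le_div₀ (by positivity) h2 (by positivity) ?_
    exact_mod_cast Nat.factorial_le (by omega : 2 * ν ≤ m)
  rw [e1]
  calc ‖AS‖ * ((n : ℝ) ^ m / m.factorial / s.factorial) *
        (q ^ (m + 2 * s) * (s + (ν + 1)).factorial)
      = ‖AS‖ * ((n : ℝ) ^ m / m.factorial) * q ^ (m + 2 * s) *
          ((s + (ν + 1)).factorial / s.factorial) := by ring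
    _ ≤ ‖AS‖ * (((n : ℝ) ^ (2 * ν) + (n : ℝ) ^ (2 * ν + 1)) / (2 * ν).factorial) * (q ^ 2) ^ s *
          ((s + (ν + 1)).factorial / s.factorial) := by gcongr
    _ = _ := by
        rw [e2, termBound]
        ring

theorem exists_uniform_bound (hreg : S.Regular AR) (AS : PSpace ι n →L[ℂ] PSpace ι n) {lam : ℝ}
    {K : Set ℝ} (hK : ∀ t ∈ K, 0 ≤ t) (hsmall : S.SmallTimeUniform AR lam K) :
    ∃ q : ℝ, 0 ≤ q ∧ q < 1 ∧ ∃ r₀ : ℕ, ∀ (N : ℕ) (h : n < N), ∀ t ∈ K, ∀ ν s : ℕ,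
      r₀ ≤ 2 * (ν + s) →
      ‖S.orderTerm h.le AS AR lam t (2 * ν + 2 * s) (2 * ν)‖ ≤ termBound ‖AS‖ n q (ν, s) ∧
      ‖S.orderTerm h.le AS AR lam t (2 * ν + 1 + 2 * s) (2 * ν + 1)‖ ≤
        termBound ‖AS‖ n q (ν, s) := by
  obtain ⟨q, hq0, hq1, r₀, hr₀⟩ := exists_rate hK hsmall
  refine ⟨q, hq0, hq1, r₀, fun N h t ht ν s hνs => ?_⟩
  have hN : 1 ≤ N := by omega
  have h1 := norm_orderTerm_le_of_rate hreg h.le hN AS lam (hK t ht) hq0 hq1.le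
    (hr₀ (2 * ν + 2 * s) (by omega) t ht)
  have h2 := norm_orderTerm_le_of_rate hreg h.le hN AS lam (hK t ht) hq0 hq1.le
    (hr₀ (2 * ν + 1 + 2 * s) (by omega) t ht)
  rw [show 2 * ν / 2 = ν by omega] at h1
  rw [show (2 * ν + 1) / 2 = ν by omega] at h2
  exact ⟨h1, h2⟩

end Model

end MeanField

end

noncomputable section

namespace MeanField

open Filter Topology MeasureTheory

universe u v w

/-! ### Rearrangement of the perturbation series -/

namespace Model

variable {H : ℕ → Type u} [∀ j, NormedAddCommGroup (H j)] [∀ j, InnerProductSpace ℂ (H j)]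
  [∀ j, CompleteSpace (H j)] {ι : ℕ → Type w}
  {R : Type v} [NormedAddCommGroup R] [InnerProductSpace ℂ R] [CompleteSpace R]
  {S : Model H ι R} {AR : R →ₗ.[ℂ] R} {n N : ℕ}

theorem coupling_pow_eq (lam : ℝ) (N r : ℕ) : (I * lam) ^ r * ((Real.sqrt N : ℝ) : ℂ)⁻¹ ^ r =
    (I * ((lam / Real.sqrt N : ℝ) : ℂ)) ^ r := by
  rw [← mul_pow]
  congr 1
  push_cast
  ring

theorem XTerm_eq (h : n ≤ N) (AS : PSpace ι n →L[ℂ] PSpace ι n) (lam t : ℝ) (ν r : ℕ) :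
    S.XTerm h AS AR lam t ν r =
      if r ≠ 0 ∧ Even r ∧ 2 * ν ≤ r then S.orderTerm h AS AR lam t r (2 * ν) else 0 := by
  rw [XTerm, coupling_pow_eq]
  rfl

theorem YTerm_eq (h : n ≤ N) (AS : PSpace ι n →L[ℂ] PSpace ι n) (lam t : ℝ) (ν r : ℕ) :
    S.YTerm h AS AR lam t ν r =
      if Odd r ∧ 2 * ν + 1 ≤ r then S.orderTerm h AS AR lam t r (2 * ν + 1) else 0 := by
  rw [YTerm, coupling_pow_eq]
  rfl

theorem norm_XTerm_le (h : n ≤ N) (AS : PSpace ι n →L[ℂ] PSpace ι n) (lam t : ℝ) (ν r : ℕ) :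
    ‖S.XTerm h AS AR lam t ν r‖ ≤ ‖S.orderTerm h AS AR lam t r (2 * ν)‖ := by
  rw [XTerm_eq]
  split_ifs
  · exact le_rfl
  · simp

theorem norm_YTerm_le (h : n ≤ N) (AS : PSpace ι n →L[ℂ] PSpace ι n) (lam t : ℝ) (ν r : ℕ) :
    ‖S.YTerm h AS AR lam t ν r‖ ≤ ‖S.orderTerm h AS AR lam t r (2 * ν + 1)‖ := by
  rw [YTerm_eq]
  split_ifs
  · exact le_rfl
  · simp

theorem XTerm_eq_zero (h : n ≤ N) (AS : PSpace ι n →L[ℂ] PSpace ι n) (lam t : ℝ) {ν r : ℕ}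
    (hr : ∀ s, 2 * ν + 2 * s ≠ r) : S.XTerm h AS AR lam t ν r = 0 := by
  rw [XTerm_eq, if_neg]
  rintro ⟨-, ⟨k, hk⟩, hle⟩
  exact hr (k - ν) (by omega)

theorem YTerm_eq_zero (h : n ≤ N) (AS : PSpace ι n →L[ℂ] PSpace ι n) (lam t : ℝ) {ν r : ℕ}
    (hr : ∀ s, 2 * ν + 1 + 2 * s ≠ r) : S.YTerm h AS AR lam t ν r = 0 := by
  rw [YTerm_eq, if_neg]
  rintro ⟨⟨k, hk⟩, hle⟩
  exact hr (k - ν) (by omega)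

theorem injective_even_order (ν : ℕ) : Function.Injective fun s => 2 * ν + 2 * s :=
  fun s s' hs => by
    simp only at hs
    omega

theorem injective_odd_order (ν : ℕ) : Function.Injective fun s => 2 * ν + 1 + 2 * s :=
  fun s s' hs => by
    simp only at hs
    omega

theorem expX_eq_tsum (h : n < N) (AS : PSpace ι n →L[ℂ] PSpace ι n) (lam t : ℝ) (ν : ℕ) :
    S.expX h.le AS AR lam t ν = ∑' r, S.XTerm h.le AS AR lam t ν r := by
  have hN : (N : ℂ) ≠ 0 := by
    exact_mod_cast (by omega : N ≠ 0)
  rw [expX, X, inv_mul_cancel_left₀ (pow_ne_zero ν hN)]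

theorem expY_eq_tsum (h : n < N) (AS : PSpace ι n →L[ℂ] PSpace ι n) (lam t : ℝ) (ν : ℕ) :
    S.expY h.le AS AR lam t ν = ∑' r, S.YTerm h.le AS AR lam t ν r := by
  have hN : (N : ℂ) ≠ 0 := by
    exact_mod_cast (by omega : N ≠ 0)
  have hN' : ((Real.sqrt N : ℝ) : ℂ) ≠ 0 := by
    exact_mod_cast (Real.sqrt_pos.2 (by exact_mod_cast (by omega : 0 < N))).ne'
  rw [expY, Y, inv_mul_cancel_left₀ (mul_ne_zero (pow_ne_zero ν hN) hN')]

theorem finite_setOf_not_le (r₀ : ℕ) : {p : ℕ × ℕ | ¬ r₀ ≤ 2 * (p.1 + p.2)}.Finite :=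
  (Finset.finite_toSet (Finset.range r₀ ×ˢ Finset.range r₀)).subset fun p hp =>
    Finset.mem_coe.2 (Finset.mem_product.2 ⟨Finset.mem_range.2 (by
      have : ¬ r₀ ≤ 2 * (p.1 + p.2) := hp
      omega), Finset.mem_range.2 (by
      have : ¬ r₀ ≤ 2 * (p.1 + p.2) := hp
      omega)⟩)

/-- Only the orders `r = 2 * ν + 2 * s` contribute. In the indices `(ν, s)`, the uniform bound fails
to apply at finitely many pairs at most. -/
theorem summable_XTerm (hreg : S.Regular AR) (h : n < N) (AS : PSpace ι n →L[ℂ] PSpace ι n)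
    {lam t : ℝ} (ht : 0 ≤ t) (hsmall : S.SmallTime AR lam t) :
    Summable fun p : ℕ × ℕ => ‖S.XTerm h.le AS AR lam t p.1 p.2‖ := by
  obtain ⟨q, hq0, hq1, r₀, hr₀⟩ := exists_uniform_bound hreg AS (K := {t})
    (fun s hs => (Set.mem_singleton_iff.1 hs).symm ▸ ht) (smallTimeUniform_singleton hsmall)
  have hinj : Function.Injective fun p : ℕ × ℕ => (p.1, 2 * p.1 + 2 * p.2) := by
    intro p p' hp
    simp only [Prod.mk.injEq] at hp
    exact Prod.ext hp.1 (by omega)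
  refine (hinj.summable_iff fun p hp => ?_).1 ?_
  · rw [XTerm_eq_zero, norm_zero]
    exact fun s hs => hp ⟨(p.1, s), Prod.ext rfl hs⟩
  · refine (summable_termBound (norm_nonneg AS) n hq0 hq1).of_norm_bounded_eventually ?_
    refine (finite_setOf_not_le r₀).subset fun p hp hle => hp ?_
    change ‖‖S.XTerm h.le AS AR lam t p.1 (2 * p.1 + 2 * p.2)‖‖ ≤ _
    rw [norm_norm]
    exact (norm_XTerm_le h.le AS lam t _ _).trans (hr₀ N h t rfl p.1 p.2 hle).1

theorem summable_YTerm (hreg : S.Regular AR) (h : n < N) (AS : PSpace ι n →L[ℂ] PSpace ι n)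
    {lam t : ℝ} (ht : 0 ≤ t) (hsmall : S.SmallTime AR lam t) :
    Summable fun p : ℕ × ℕ => ‖S.YTerm h.le AS AR lam t p.1 p.2‖ := by
  obtain ⟨q, hq0, hq1, r₀, hr₀⟩ := exists_uniform_bound hreg AS (K := {t})
    (fun s hs => (Set.mem_singleton_iff.1 hs).symm ▸ ht) (smallTimeUniform_singleton hsmall)
  have hinj : Function.Injective fun p : ℕ × ℕ => (p.1, 2 * p.1 + 1 + 2 * p.2) := by
    intro p p' hp
    simp only [Prod.mk.injEq] at hp
    exact Prod.ext hp.1 (by omega)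
  refine (hinj.summable_iff fun p hp => ?_).1 ?_
  · rw [YTerm_eq_zero, norm_zero]
    exact fun s hs => hp ⟨(p.1, s), Prod.ext rfl hs⟩
  · refine (summable_termBound (norm_nonneg AS) n hq0 hq1).of_norm_bounded_eventually ?_
    refine (finite_setOf_not_le r₀).subset fun p hp hle => hp ?_
    change ‖‖S.YTerm h.le AS AR lam t p.1 (2 * p.1 + 1 + 2 * p.2)‖‖ ≤ _
    rw [norm_norm]
    exact (norm_YTerm_le h.le AS lam t _ _).trans (hr₀ N h t rfl p.1 p.2 hle).2

/-- The sum of all contributions to the expansion that are of the order `r` in the coupling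
constant. -/
theorem hasSum_XTerm_add_YTerm (hreg : S.Regular AR) (h : n ≤ N)
    (AS : PSpace ι n →L[ℂ] PSpace ι n) (lam : ℝ) {t : ℝ} (ht : 0 ≤ t)
    (hodd : S.OddMomentsVanish t) (r : ℕ) :
    HasSum (fun ν => S.XTerm h AS AR lam t ν r + S.YTerm h AS AR lam t ν r)
      (if r = 0 then 0 else (I * ((lam / Real.sqrt N : ℝ) : ℂ)) ^ r *
        ∑ j : Fin r → Fin N, iteratedIntegral r t (S.omegaT h AS AR t j)) := by
  have hz : ∀ m, (∀ s, r ≠ m + 2 * s) → S.orderTerm h AS AR lam t r m = 0 := fun m hm => by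
    rw [orderTerm, multiplicitySum_eq_zero hreg h AS ht hm, mul_zero]
  have hsum : HasSum (S.orderTerm h AS AR lam t r) ((I * ((lam / Real.sqrt N : ℝ) : ℂ)) ^ r *
      ∑ j : Fin r → Fin N, iteratedIntegral r t (S.omegaT h AS AR t j)) := by
    rw [← sum_range_multiplicitySum hreg h AS ht hodd, Finset.mul_sum]
    refine hasSum_sum_of_ne_finset_zero fun m hm => hz m fun s hs => hm ?_
    exact Finset.mem_range.2 (by omega)
  rcases Nat.even_or_odd r with hr | hr
  · have hY : ∀ ν, S.YTerm h AS AR lam t ν r = 0 := fun ν => YTerm_eq_zero h AS lam t fun s hs => by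
      obtain ⟨k, hk⟩ := hr
      omega
    simp only [hY, add_zero]
    -- The series of `X` omits order zero, which is accounted for by the free average.
    split_ifs with h0
    · have hX : ∀ ν, S.XTerm h AS AR lam t ν r = 0 := fun ν => by
        rw [XTerm_eq, if_neg fun hc => hc.1 h0]
      simp only [hX]
      exact hasSum_zero
    · have hinj : Function.Injective fun ν : ℕ => 2 * ν := fun a b hab => by
        simp only at hab
        omega
      have h1 := (hinj.hasSum_iff fun m hm => hz m fun s hs => hm (by
        obtain ⟨k, hk⟩ := hr
        exact ⟨k - s, by simp only; omega⟩)).2 hsum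
      refine HasSum.congr_fun h1 fun ν => ?_
      rw [XTerm_eq]
      split_ifs with hc
      · rfl
      · exact (hz (2 * ν) fun s hs => hc ⟨h0, hr, by omega⟩).symm
  · have h0 : r ≠ 0 := by
      rintro rfl
      exact absurd hr (by decide)
    have hX : ∀ ν, S.XTerm h AS AR lam t ν r = 0 := fun ν => XTerm_eq_zero h AS lam t fun s hs => by
      obtain ⟨k, hk⟩ := hr
      omega
    simp only [hX, zero_add, if_neg h0]
    have hinj : Function.Injective fun ν : ℕ => 2 * ν + 1 := fun a b hab => by
      simp only at hab
      omega
    have h1 := (hinj.hasSum_iff fun m hm => hz m fun s hs => hm (by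
      obtain ⟨k, hk⟩ := hr
      exact ⟨k - s, by simp only; omega⟩)).2 hsum
    refine HasSum.congr_fun h1 fun ν => ?_
    rw [YTerm_eq]
    split_ifs with hc
    · rfl
    · exact (hz (2 * ν + 1) fun s hs => hc ⟨hr, by omega⟩).symm

theorem summable_norm_expX (hreg : S.Regular AR) (h : n < N) (AS : PSpace ι n →L[ℂ] PSpace ι n)
    {lam t : ℝ} (ht : 0 ≤ t) (hsmall : S.SmallTime AR lam t) :
    Summable fun ν => ‖S.expX h.le AS AR lam t ν‖ := by
  have hX := summable_XTerm hreg h AS ht hsmall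
  refine Summable.of_nonneg_of_le (fun _ => norm_nonneg _) (fun ν => ?_) hX.prod
  rw [expX_eq_tsum h]
  exact norm_tsum_le_tsum_norm (hX.prod_factor ν)

theorem summable_norm_expY (hreg : S.Regular AR) (h : n < N) (AS : PSpace ι n →L[ℂ] PSpace ι n)
    {lam t : ℝ} (ht : 0 ≤ t) (hsmall : S.SmallTime AR lam t) :
    Summable fun ν => ‖S.expY h.le AS AR lam t ν‖ := by
  have hY := summable_YTerm hreg h AS ht hsmall
  refine Summable.of_nonneg_of_le (fun _ => norm_nonneg _) (fun ν => ?_) hY.prod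
  rw [expY_eq_tsum h]
  exact norm_tsum_le_tsum_norm (hY.prod_factor ν)

theorem sum_iteratedIntegral_zero_omegaT (hreg : S.Regular AR) (h : n ≤ N)
    (AS : PSpace ι n →L[ℂ] PSpace ι n) {t : ℝ} (ht : 0 ≤ t) :
    ∑ j : Fin 0 → Fin N, iteratedIntegral 0 t (S.omegaT h AS AR t j) = S.freeAverage AS AR t := by
  rw [Fintype.sum_subsingleton _ Fin.elim0, ← omega_obsForm_eq_freeAverage hreg h AS ht]
  simp only [iteratedIntegral, omegaT, multiCommutator]

theorem hasAverage_expansion (hreg : S.Regular AR) (h : n < N) (AS : PSpace ι n →L[ℂ] PSpace ι n)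
    {lam : ℝ} {W : UnitaryGroup (TSpace ι R N)} (hW : S.IsPropagator lam N W) {t : ℝ} (ht : 0 ≤ t)
    (hodd : S.OddMomentsVanish t) (hsmall : S.SmallTime AR lam t) :
    S.HasAverage h.le AS AR W t (S.freeAverage AS AR t +
      ∑' ν, (S.expX h.le AS AR lam t ν + S.expY h.le AS AR lam t ν)) := by
  obtain ⟨z, hz, hsum⟩ := exists_hasAverage hreg h.le AS hW ht
  suffices hzeq : S.freeAverage AS AR t +
      ∑' ν, (S.expX h.le AS AR lam t ν + S.expY h.le AS AR lam t ν) = z by rwa [hzeq]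
  have hX := (summable_XTerm hreg h AS ht hsmall).of_norm
  have hY := (summable_YTerm hreg h AS ht hsmall).of_norm
  obtain ⟨T, hT⟩ := hX.add hY
  have h1 : HasSum (fun ν => S.expX h.le AS AR lam t ν + S.expY h.le AS AR lam t ν) T := by
    refine hT.prod_fiberwise fun ν => ?_
    rw [expX_eq_tsum h, expY_eq_tsum h]
    exact (hX.prod_factor ν).hasSum.add (hY.prod_factor ν).hasSum
  have hT' : HasSum (fun p : ℕ × ℕ => S.XTerm h.le AS AR lam t p.2 p.1 +
      S.YTerm h.le AS AR lam t p.2 p.1) T :=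
    (Equiv.prodComm ℕ ℕ).hasSum_iff (f := fun p : ℕ × ℕ => S.XTerm h.le AS AR lam t p.1 p.2 +
      S.YTerm h.le AS AR lam t p.1 p.2) |>.2 hT
  have h2 := hT'.prod_fiberwise fun r => hasSum_XTerm_add_YTerm hreg h.le AS lam ht hodd r
  -- Grouped by `r`, the double series is the perturbation series without its term of order zero.
  have h3 := h2.unique (hasSum_ite_sub_hasSum hsum 0)
  rw [pow_zero, one_mul, sum_iteratedIntegral_zero_omegaT hreg h.le AS ht] at h3
  rw [h1.tsum_eq, h3, add_sub_cancel]

theorem exists_tail_lt (hreg : S.Regular AR) (AS : PSpace ι n →L[ℂ] PSpace ι n) {lam : ℝ}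
    {K : Set ℝ} (hK : ∀ t ∈ K, 0 ≤ t) (hsmall : S.SmallTimeUniform AR lam K) {ε : ℝ} (hε : 0 < ε) :
    ∃ M : ℕ, ∀ (N : ℕ) (hN : n < N), ∀ t ∈ K,
      ∑' ν, (‖S.expX hN.le AS AR lam t (M + ν)‖ + ‖S.expY hN.le AS AR lam t (M + ν)‖) < ε := by
  obtain ⟨q, hq0, hq1, r₀, hr₀⟩ := exists_uniform_bound hreg AS hK hsmall
  have hb := summable_termBound (norm_nonneg AS) n hq0 hq1
  set B : ℕ → ℝ := fun ν => ∑' s, termBound ‖AS‖ n q (ν, s) with hB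
  have hBs : Summable fun ν => 2 * B ν := hb.prod.mul_left 2
  -- Taking `M ≥ r₀` puts every term of the tail in the range of the uniform bound. The factor `2`
  -- covers the `X` and `Y` contributions.
  obtain ⟨M, hM, hMr⟩ := (((tendsto_sum_nat_add fun ν => 2 * B ν).eventually_lt_const hε).and
    (eventually_ge_atTop r₀)).exists
  refine ⟨M, fun N hN t ht => ?_⟩
  have hX : ∀ ν, r₀ ≤ ν → ‖S.expX hN.le AS AR lam t ν‖ ≤ B ν := by
    intro ν hν
    have hle : ∀ s, ‖S.XTerm hN.le AS AR lam t ν (2 * ν + 2 * s)‖ ≤ termBound ‖AS‖ n q (ν, s) :=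
      fun s => (norm_XTerm_le hN.le AS lam t _ _).trans (hr₀ N hN t ht ν s (by omega)).1
    rw [expX_eq_tsum hN, ← (injective_even_order ν).tsum_eq]
    · exact tsum_of_norm_bounded (hb.prod_factor ν).hasSum hle
    · intro r hr
      by_contra hcon
      exact hr (XTerm_eq_zero hN.le AS lam t fun s hs => hcon ⟨s, hs⟩)
  have hY : ∀ ν, r₀ ≤ ν → ‖S.expY hN.le AS AR lam t ν‖ ≤ B ν := by
    intro ν hν
    have hle : ∀ s, ‖S.YTerm hN.le AS AR lam t ν (2 * ν + 1 + 2 * s)‖ ≤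
        termBound ‖AS‖ n q (ν, s) :=
      fun s => (norm_YTerm_le hN.le AS lam t _ _).trans (hr₀ N hN t ht ν s (by omega)).2
    rw [expY_eq_tsum hN, ← (injective_odd_order ν).tsum_eq]
    · exact tsum_of_norm_bounded (hb.prod_factor ν).hasSum hle
    · intro r hr
      by_contra hcon
      exact hr (YTerm_eq_zero hN.le AS lam t fun s hs => hcon ⟨s, hs⟩)
  have hle : ∀ ν, ‖S.expX hN.le AS AR lam t (M + ν)‖ + ‖S.expY hN.le AS AR lam t (M + ν)‖ ≤
      2 * B (ν + M) := by
    intro ν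
    rw [two_mul, add_comm ν M]
    exact add_le_add (hX _ (by omega)) (hY _ (by omega))
  have hs : Summable fun ν => 2 * B (ν + M) := (summable_nat_add_iff M).2 hBs
  exact ((Summable.of_nonneg_of_le (fun _ => by positivity) hle hs).tsum_le_tsum hle hs).trans_lt hM

end Model

end MeanField

end

/-! ### The expansion theorem -/

theorem theorem1p2 {H : ℕ → Type*} [∀ j, NormedAddCommGroup (H j)]
    [∀ j, InnerProductSpace ℂ (H j)] [∀ j, CompleteSpace (H j)] {ι : ℕ → Type*}
    {R : Type*} [NormedAddCommGroup R] [InnerProductSpace ℂ R] [CompleteSpace R]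
    (S : MeanField.Model H ι R) (lam : ℝ)
    (W : ∀ N, MeanField.UnitaryGroup (MeanField.TSpace ι R N))
    (hW : ∀ N, 1 ≤ N → S.IsPropagator lam N (W N))
    (n : ℕ) (AS : MeanField.PSpace ι n →L[ℂ] MeanField.PSpace ι n)
    (AR : R →ₗ.[ℂ] R) (hAR : AR.IsClosable) (hreg : S.Regular AR) :
    -- the expansion at a fixed time, and its absolute convergence, uniformly in `N`
    (∀ t : ℝ, 0 ≤ t → S.OddMomentsVanish t → S.SmallTime AR lam t → S.GrowthBound n AR lam t →
      (∀ (N : ℕ) (hN : n < N),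
        (∀ ν, Summable fun r => ‖S.XTerm hN.le AS AR lam t ν r‖) ∧
        (∀ ν, Summable fun r => ‖S.YTerm hN.le AS AR lam t ν r‖) ∧
        Summable (fun ν => ‖S.expX hN.le AS AR lam t ν‖ + ‖S.expY hN.le AS AR lam t ν‖) ∧
        S.HasAverage hN.le AS AR (W N) t (S.freeAverage AS AR t +
          ∑' ν, (S.expX hN.le AS AR lam t ν + S.expY hN.le AS AR lam t ν))) ∧
      ∀ ε : ℝ, 0 < ε → ∃ M : ℕ, ∀ (N : ℕ) (hN : n < N),
        ∑' ν, (‖S.expX hN.le AS AR lam t (M + ν)‖ + ‖S.expY hN.le AS AR lam t (M + ν)‖) < ε) ∧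
    -- uniformity of the convergence in `N` and in `t` in a compact set
    ∀ K : Set ℝ, IsCompact K → (∀ t ∈ K, 0 ≤ t ∧ S.OddMomentsVanish t ∧ S.GrowthBound n AR lam t) →
      S.SmallTimeUniform AR lam K →
      ∀ ε : ℝ, 0 < ε → ∃ M : ℕ, ∀ (N : ℕ) (hN : n < N), ∀ t ∈ K,
        ∑' ν, (‖S.expX hN.le AS AR lam t (M + ν)‖ + ‖S.expY hN.le AS AR lam t (M + ν)‖) < ε := by
  refine ⟨fun t ht hodd hsmall _ => ⟨fun N hN => ⟨fun ν => ?_, fun ν => ?_, ?_, ?_⟩, fun ε hε => ?_⟩,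
    fun K _ hK hsmall ε hε => ?_⟩
  · exact (MeanField.Model.summable_XTerm hreg hN AS ht hsmall).prod_factor ν
  · exact (MeanField.Model.summable_YTerm hreg hN AS ht hsmall).prod_factor ν
  · exact (MeanField.Model.summable_norm_expX hreg hN AS ht hsmall).add
      (MeanField.Model.summable_norm_expY hreg hN AS ht hsmall)
  · exact MeanField.Model.hasAverage_expansion hreg hN AS (hW N (by omega)) ht hodd hsmall
  · obtain ⟨M, hM⟩ := MeanField.Model.exists_tail_lt hreg AS (K := {t})
      (fun s hs => (Set.mem_singleton_iff.1 hs).symm ▸ ht)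
      (MeanField.Model.smallTimeUniform_singleton hsmall) hε
    exact ⟨M, fun N hN => hM N hN t rfl⟩
  · exact MeanField.Model.exists_tail_lt hreg AS (fun t ht => (hK t ht).1) hsmall hε
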